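/- There is an absolute constant $C>0$ such that the following holds. Let $\Sigma$ be a compact smooth surface (without boundary) with a smooth Riemannian metric $\rho$ of constant scalar curvature $-1$, and let $\mathfrak z$ be a TT-tensor on $(\Sigma,\rho)$, that is, a smooth symmetric $(0,2)$-tensor that is trace free and divergence free with respect to $\rho$; assume that $\mathfrak z$ does not vanish identically. Let $u$ be a smooth solution on $\Sigma$ of Moncrief's equation $$\Delta_\rho u-u+\left(1+2|\xi|^2\right)^{1/2}=0,\qquad 2\xi_{ab}=2\mathfrak z_{ab}-\left(2u_{;ab}-\rho_{ab}\Delta_\rho u\right),$$ where $u_{;ab}$ is the Hessian of $u$ and $|\xi|$ the norm of $\xi$, both with respect to $\rho$. Put $B=(1+2|\xi|^2)^{1/2}$ and let $g$ be the Riemannian metric whose inverse $g^{ab}$ is given by $(1+B)\,g^{ab}=-2\xi^{ab}+B\rho^{ab}$, the indices of $\xi$ being raised with $\rho$. Then $$|\nabla_g\log B|_g\le C\quad\text{everywhere on }\Sigma.$$ In particular $C$ depends neither on $\mathfrak z$ nor on $(\Sigma,\rho)$. -/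

import Mathlib

open scoped Manifold ContDiff Bundle

noncomputable section

namespace Moncrief

/-- The Euclidean plane, on which surfaces are modelled. -/
abbrev Plane : Type := EuclideanSpace ℝ (Fin 2)

/-! ### Riemannian geometry in coordinates

`G : Plane → Matrix (Fin 2) (Fin 2) ℝ` is the matrix `(G_{ab})` of a metric in coordinates;
`(G y)⁻¹` is the matrix `(G^{ab})`. -/

/-- The partial derivative `∂_a f`. -/
def pd (a : Fin 2) (f : Plane → ℝ) (y : Plane) : ℝ :=
  fderiv ℝ f y (EuclideanSpace.single a 1)

/-- The Christoffel symbol `Γ^c_{ab} = ½ G^{cd} (∂_a G_{db} + ∂_b G_{ad} - ∂_d G_{ab})`. -/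
def christoffel (G : Plane → Matrix (Fin 2) (Fin 2) ℝ) (c a b : Fin 2) (y : Plane) : ℝ :=
  1 / 2 * ∑ d, (G y)⁻¹ c d *
    (pd a (fun w => G w d b) y + pd b (fun w => G w a d) y - pd d (fun w => G w a b) y)

/-- The Ricci tensor
`R_{ab} = ∂_c Γ^c_{ab} - ∂_a Γ^c_{cb} + Γ^c_{cd} Γ^d_{ab} - Γ^c_{ad} Γ^d_{cb}`. -/
def ricci (G : Plane → Matrix (Fin 2) (Fin 2) ℝ) (a b : Fin 2) (y : Plane) : ℝ :=
  ∑ c, (pd c (christoffel G c a b) y - pd a (christoffel G c c b) y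
    + ∑ d, (christoffel G c c d y * christoffel G d a b y
      - christoffel G c a d y * christoffel G d c b y))

/-- The scalar curvature `G^{ab} R_{ab}` (twice the Gauss curvature). -/
def scalarCurvature (G : Plane → Matrix (Fin 2) (Fin 2) ℝ) (y : Plane) : ℝ :=
  ∑ a, ∑ b, (G y)⁻¹ a b * ricci G a b y

/-- The Hessian `f_{;ab} = ∂_a ∂_b f - Γ^c_{ab} ∂_c f`. -/
def hessian (G : Plane → Matrix (Fin 2) (Fin 2) ℝ) (f : Plane → ℝ) (a b : Fin 2) (y : Plane) : ℝ :=
  pd a (pd b f) y - ∑ c, christoffel G c a b y * pd c f y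

/-- The Laplace-Beltrami operator `Δ f = G^{ab} f_{;ab}`. -/
def laplacian (G : Plane → Matrix (Fin 2) (Fin 2) ℝ) (f : Plane → ℝ) (y : Plane) : ℝ :=
  ∑ a, ∑ b, (G y)⁻¹ a b * hessian G f a b y

/-- The norm of the gradient, `|∇ f| = (G^{ab} ∂_a f ∂_b f)^{1/2}`. -/
def gradNorm (G : Plane → Matrix (Fin 2) (Fin 2) ℝ) (f : Plane → ℝ) (y : Plane) : ℝ :=
  Real.sqrt (∑ a, ∑ b, (G y)⁻¹ a b * pd a f y * pd b f y)

/-- The trace `G^{ab} T_{ab}` of a (0,2) tensor. -/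
def trace (G T : Plane → Matrix (Fin 2) (Fin 2) ℝ) (y : Plane) : ℝ :=
  ∑ a, ∑ b, (G y)⁻¹ a b * T y a b

/-- The covariant derivative `T_{ab;c} = ∂_c T_{ab} - Γ^d_{ca} T_{db} - Γ^d_{cb} T_{ad}`. -/
def covDeriv (G T : Plane → Matrix (Fin 2) (Fin 2) ℝ) (a b c : Fin 2) (y : Plane) : ℝ :=
  pd c (fun w => T w a b) y
    - ∑ d, (christoffel G d c a y * T y d b + christoffel G d c b y * T y a d)

/-- The divergence `G^{bc} T_{ab;c}` of a (0,2) tensor. -/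
def divergence (G T : Plane → Matrix (Fin 2) (Fin 2) ℝ) (a : Fin 2) (y : Plane) : ℝ :=
  ∑ b, ∑ c, (G y)⁻¹ b c * covDeriv G T a b c y

/-- The squared norm `G^{ac} G^{bd} T_{ab} T_{cd}` of a (0,2) tensor. -/
def normSq (G T : Plane → Matrix (Fin 2) (Fin 2) ℝ) (y : Plane) : ℝ :=
  ∑ a, ∑ b, ∑ c, ∑ d, (G y)⁻¹ a c * (G y)⁻¹ b d * T y a b * T y c d

/-! ### Moncrief's equation in coordinates

`G`, `Z`, `f` are the coordinate expressions of the metric `ρ`, the tensor `𝔷` and the function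
`u`. -/

/-- The tensor `ξ`, given by `2 ξ_{ab} = 2 𝔷_{ab} - (2 u_{;ab} - ρ_{ab} Δ_ρ u)`. -/
def xi (G Z : Plane → Matrix (Fin 2) (Fin 2) ℝ) (f : Plane → ℝ) (y : Plane) :
    Matrix (Fin 2) (Fin 2) ℝ :=
  Matrix.of fun a b =>
    1 / 2 * (2 * Z y a b - (2 * hessian G f a b y - G y a b * laplacian G f y))

/-- The function `B = (1 + 2 |ξ|²)^{1/2}`. -/
def B (G Z : Plane → Matrix (Fin 2) (Fin 2) ℝ) (f : Plane → ℝ) (y : Plane) : ℝ :=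
  Real.sqrt (1 + 2 * normSq G (xi G Z f) y)

/-- The inverse metric `g^{ab}`, given by `(1 + B) g^{ab} = -2 ξ^{ab} + B ρ^{ab}`, where
`ξ^{ab} = ρ^{ac} ρ^{bd} ξ_{cd}`. -/
def gInv (G Z : Plane → Matrix (Fin 2) (Fin 2) ℝ) (f : Plane → ℝ) (y : Plane) :
    Matrix (Fin 2) (Fin 2) ℝ :=
  Matrix.of fun a b =>
    (-2 * (∑ c, ∑ d, (G y)⁻¹ a c * (G y)⁻¹ b d * xi G Z f y c d)
      + B G Z f y * (G y)⁻¹ a b) / (1 + B G Z f y)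

/-- The metric `g_{ab}`, the inverse of `g^{ab}`. -/
def gMetric (G Z : Plane → Matrix (Fin 2) (Fin 2) ℝ) (f : Plane → ℝ) (y : Plane) :
    Matrix (Fin 2) (Fin 2) ℝ :=
  (gInv G Z f y)⁻¹

/-! ### Objects on a smooth surface -/

section Surface

variable {M : Type*} [TopologicalSpace M] [ChartedSpace Plane M] [IsManifold (𝓡 2) ∞ M]

/-- The coordinate expression of a function on `M` in the chart `e`. -/
def funCoord (e : OpenPartialHomeomorph M Plane) (u : M → ℝ) (y : Plane) : ℝ := u (e.symm y)

/-- The coordinate vector field `∂_a` of the chart `e`, at the point with coordinates `y`. -/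
def coordVec (e : OpenPartialHomeomorph M Plane) (a : Fin 2) (y : Plane) :
    TangentSpace (𝓡 2) (e.symm y) :=
  mfderiv 𝓘(ℝ, Plane) (𝓡 2) e.symm y (EuclideanSpace.single a (1 : ℝ) : Plane)

/-- The components `T_{ab} = T(∂_a, ∂_b)` of a (0,2) tensor field in the chart `e`. -/
def tensorCoord (e : OpenPartialHomeomorph M Plane)
    (T : ∀ x : M, TangentSpace (𝓡 2) x →L[ℝ] TangentSpace (𝓡 2) x →L[ℝ] ℝ) (y : Plane) :
    Matrix (Fin 2) (Fin 2) ℝ :=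
  Matrix.of fun a b => T (e.symm y) (coordVec e a y) (coordVec e b y)

variable (M) in
/-- Smooth Riemannian metrics on `M`. -/
abbrev Metric : Type _ :=
  Bundle.ContMDiffRiemannianMetric (IB := 𝓡 2) (n := ∞) (F := Plane)
    (E := fun x : M => TangentSpace (𝓡 2) x)

variable (M) in
/-- Smooth (0,2) tensor fields on `M`. -/
abbrev Tensor02 : Type _ :=
  ContMDiffSection (𝓡 2) (Plane →L[ℝ] Plane →L[ℝ] ℝ) ∞
    (fun x : M => TangentSpace (𝓡 2) x →L[ℝ] TangentSpace (𝓡 2) x →L[ℝ] ℝ)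

/-- The scalar curvature of `ρ` is `-1`. -/
def HasScalarCurvatureNegOne (ρ : Metric M) : Prop :=
  ∀ e ∈ IsManifold.maximalAtlas (𝓡 2) ∞ M, ∀ y ∈ e.target,
    scalarCurvature (tensorCoord e ρ.inner) y = -1

/-- `𝔷` is a TT-tensor on `(M, ρ)`: symmetric, trace free and divergence free. -/
structure IsTT (ρ : Metric M) (𝔷 : Tensor02 M) : Prop where
  symm : ∀ (x : M) (v w : TangentSpace (𝓡 2) x), 𝔷 x v w = 𝔷 x w v
  trace_free : ∀ e ∈ IsManifold.maximalAtlas (𝓡 2) ∞ M, ∀ y ∈ e.target,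
    trace (tensorCoord e ρ.inner) (tensorCoord e 𝔷) y = 0
  div_free : ∀ e ∈ IsManifold.maximalAtlas (𝓡 2) ∞ M, ∀ y ∈ e.target, ∀ a : Fin 2,
    divergence (tensorCoord e ρ.inner) (tensorCoord e 𝔷) a y = 0

/-- `𝔷` does not vanish identically. -/
def IsNontrivial (𝔷 : Tensor02 M) : Prop :=
  ∃ (x : M) (v w : TangentSpace (𝓡 2) x), 𝔷 x v w ≠ 0

/-- `u` is a smooth solution of Moncrief's equation `Δ_ρ u - u + (1 + 2 |ξ|²)^{1/2} = 0`. -/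
structure IsSolution (ρ : Metric M) (𝔷 : Tensor02 M) (u : M → ℝ) : Prop where
  smooth : ContMDiff (𝓡 2) 𝓘(ℝ, ℝ) ∞ u
  equation : ∀ e ∈ IsManifold.maximalAtlas (𝓡 2) ∞ M, ∀ y ∈ e.target,
    laplacian (tensorCoord e ρ.inner) (funCoord e u) y - funCoord e u y
      + B (tensorCoord e ρ.inner) (tensorCoord e 𝔷) (funCoord e u) y = 0

/-- `|∇_g log B|`, computed in the chart `e` at the point with coordinates `y`. -/
def gradLogB (ρ : Metric M) (𝔷 : Tensor02 M) (u : M → ℝ) (e : OpenPartialHomeomorph M Plane)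
    (y : Plane) : ℝ :=
  gradNorm (gMetric (tensorCoord e ρ.inner) (tensorCoord e 𝔷) (funCoord e u))
    (fun w => Real.log (B (tensorCoord e ρ.inner) (tensorCoord e 𝔷) (funCoord e u) w)) y

end Surface

end Moncrief

end

/-! The key object is the tensor `S = 2ξ + Bρ`. Since `ξ` is trace free in dimension two, `|ξ|² = -2
det ξ`, so `S` has determinant `B² - 2|ξ|² = 1` relative to `ρ`. Moncrief's equation reads `Δu + B =
u`, hence `S = 2𝔷 - 2 Hess u + uρ`, and this is a Codazzi tensor: a TT-tensor on a surface is
Codazzi, and the curvature term produced by commuting derivatives of `du` is cancelled by the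
contribution of `uρ`, exactly because the Gauss curvature is `-1/2`.

Where `B > 1`, `S` has eigenvalues `l > 1 > l⁻¹` with `l + l⁻¹ = 2B`. In an orthonormal eigencoframe
`p`, `r` the Codazzi equations determine the connection form from `dl`. With `c² = (l² - 1)/2` the
forms `c p` and `c l⁻¹ r` are closed, so they are orthonormal for a flat metric. The structure
equation `dω = ½ p ∧ r` then becomes the sinh-Gordon equation `Δw = sinh w` for that flat metric,
where `w = log ((l - 1)/(l + 1)) < 0` (`IsCoframe.codazzi`, `IsLocalSolution.exists_eigenframe`,
`IsEigenframe.sinhGordon`).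

Everything to be estimated depends on `w` and the flat metric alone: `B = -coth w`, and the inverse
of `g` is `e^w` times the inverse of the flat metric. Therefore `|∇_g log B|² = e^w |∇w|² / (sinh w
cosh w)²` (`IsEigenframe.weighted_gradient_eq`). No other trace of `ρ`, `𝔷` or `u` remains, which is
why the constant is absolute.

The bound is a maximum principle. On a compact surface `|∇_g log B|` attains its maximum. If `B = 1`
there, then `log B` has a minimum and its gradient vanishes. Otherwise the vanishing of the first
derivatives of `F = |∇_g log B|²` makes `∇w` an eigenvector of the Hessian of `w`, and the
sinh-Gordon equation supplies the other eigenvalue. So `ΔF ≤ 0` becomes an inequality in `w` and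
`|∇w|²` only (`hessian_norm_le`). The coefficient of `|∇w|⁴` in it is the second derivative of the
logarithm of the weight, `2/(sinh w cosh w)²`, which is positive. This gives `F ≤ 13/2 < 9`
(`weight_mul_le`, `IsFlatCoframe.weighted_gradient_le`), hence the constant `3`.

The quantities are defined in charts, so a global maximum makes sense only after their independence
of the chart is known (`gradLogB_transition`). -/

noncomputable section

namespace Moncrief

/-! ### Partial derivatives -/

section PartialDerivatives

variable {f g : Plane → ℝ} {y : Plane} {a b : Fin 2}

theorem contDiffAt_pd (hf : ContDiffAt ℝ ∞ f y) (a : Fin 2) : ContDiffAt ℝ ∞ (pd a f) y :=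
  (hf.fderiv_right (m := ∞) (by simp)).clm_apply contDiffAt_const

theorem pd_congr (h : f =ᶠ[nhds y] g) (a : Fin 2) : pd a f y = pd a g y := by
  simp only [pd, h.fderiv_eq]

theorem pd_comm (hf : ContDiffAt ℝ ∞ f y) (a b : Fin 2) : pd a (pd b f) y = pd b (pd a f) y := by
  have hs : IsSymmSndFDerivAt ℝ f y := hf.isSymmSndFDerivAt
    (by rw [minSmoothness_of_isRCLikeNormedField]; exact ENat.LEInfty.out)
  have hd : DifferentiableAt ℝ (fderiv ℝ f) y :=
    (hf.fderiv_right (m := ∞) (by simp)).differentiableAt (by simp)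
  have key : ∀ a b : Fin 2, pd a (pd b f) y =
      fderiv ℝ (fderiv ℝ f) y (EuclideanSpace.single a 1) (EuclideanSpace.single b 1) := by
    intro a b
    have : pd b f = fun w => fderiv ℝ f w (EuclideanSpace.single b 1) := rfl
    rw [this]
    unfold pd
    rw [fderiv_clm_apply hd (differentiableAt_const _)]
    simp
  rw [key, key]
  exact hs _ _

theorem pd_add (hf : DifferentiableAt ℝ f y) (hg : DifferentiableAt ℝ g y) (a : Fin 2) :
    pd a (fun w => f w + g w) y = pd a f y + pd a g y := by
  simp [pd, fderiv_fun_add hf hg]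

theorem pd_sub (hf : DifferentiableAt ℝ f y) (hg : DifferentiableAt ℝ g y) (a : Fin 2) :
    pd a (fun w => f w - g w) y = pd a f y - pd a g y := by
  simp [pd, fderiv_fun_sub hf hg]

theorem pd_neg (a : Fin 2) : pd a (fun w => -f w) y = -pd a f y := by
  simp [pd, fderiv_fun_neg]

theorem pd_mul (hf : DifferentiableAt ℝ f y) (hg : DifferentiableAt ℝ g y) (a : Fin 2) :
    pd a (fun w => f w * g w) y = pd a f y * g y + f y * pd a g y := by
  simp [pd, fderiv_fun_mul hf hg]; ring

theorem pd_const_mul (hf : DifferentiableAt ℝ f y) (c : ℝ) (a : Fin 2) :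
    pd a (fun w => c * f w) y = c * pd a f y := by
  simp [pd, fderiv_const_mul hf]

/-- The chain rule for a function of one variable. -/
theorem pd_comp {φ : ℝ → ℝ} {φ' : ℝ} (hφ : HasDerivAt φ φ' (f y)) (hf : DifferentiableAt ℝ f y)
    (a : Fin 2) : pd a (fun w => φ (f w)) y = φ' * pd a f y := by
  have := (hφ.comp_hasFDerivAt y hf.hasFDerivAt).fderiv
  simp only [Function.comp_def] at this
  simp [pd, this]

theorem fderiv_eq_sum_pd (f : Plane → ℝ) (y v : Plane) :
    fderiv ℝ f y v = ∑ i, v i * pd i f y := by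
  have hv : v = ∑ i, v i • EuclideanSpace.single i (1 : ℝ) := by
    ext j; fin_cases j <;> simp
  conv_lhs => rw [hv]
  simp [pd]

/-- The chain rule for a map of the plane to itself with components `φ i`. -/
theorem pd_comp_map {φ : Plane → Plane} (hf : DifferentiableAt ℝ f (φ y))
    (hφ : DifferentiableAt ℝ φ y) (a : Fin 2) :
    pd a (fun w => f (φ w)) y = ∑ i, pd a (fun w => φ w i) y * pd i f (φ y) := by
  have h1 : pd a (fun w => f (φ w)) y =
      fderiv ℝ f (φ y) (fderiv ℝ φ y (EuclideanSpace.single a 1)) := by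
    have := fderiv_comp y hf hφ
    simp only [Function.comp_def] at this
    simp [pd, this]
  rw [h1, fderiv_eq_sum_pd]
  refine Finset.sum_congr rfl fun i _ => ?_
  congr 1
  have := ((EuclideanSpace.proj (𝕜 := ℝ) i).hasFDerivAt.comp y hφ.hasFDerivAt).fderiv
  have h2 : (fun w => φ w i) = (EuclideanSpace.proj (𝕜 := ℝ) i) ∘ φ := rfl
  simp only [pd, h2, this]
  simp

end PartialDerivatives

/-! ### Change of coordinates -/

section ChangeOfCoordinates

/-- The Jacobian matrix `J^i_a = ∂_a φ^i`. -/
def jacobian (φ : Plane → Plane) (y : Plane) : Matrix (Fin 2) (Fin 2) ℝ :=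
  Matrix.of fun i a => pd a (fun w => φ w i) y

theorem jacobian_apply (φ : Plane → Plane) (y : Plane) (i a : Fin 2) :
    jacobian φ y i a = pd a (fun w => φ w i) y := rfl

theorem contDiffAt_coord {φ : Plane → Plane} {y : Plane} (hφ : ContDiffAt ℝ ∞ φ y) (i : Fin 2) :
    ContDiffAt ℝ ∞ (fun w => φ w i) y :=
  (EuclideanSpace.proj (𝕜 := ℝ) i).contDiff.contDiffAt.comp y hφ

/-- The Christoffel symbols of the first kind. -/
theorem sum_mul_christoffel {G : Plane → Matrix (Fin 2) (Fin 2) ℝ} {y : Plane}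
    (hdet : (G y).det ≠ 0) (d a b : Fin 2) :
    ∑ c, G y d c * christoffel G c a b y =
      1 / 2 * (pd a (fun w => G w d b) y + pd b (fun w => G w a d) y
        - pd d (fun w => G w a b) y) := by
  have h : G y * (G y)⁻¹ = 1 := Matrix.mul_nonsing_inv _ (Ne.isUnit hdet)
  set X : Fin 2 → ℝ := fun d => 1 / 2 * (pd a (fun w => G w d b) y + pd b (fun w => G w a d) y
    - pd d (fun w => G w a b) y) with hX
  have hΓ : (fun c => christoffel G c a b y) = (G y)⁻¹.mulVec X := by
    funext c
    simp only [christoffel, Matrix.mulVec, dotProduct, Finset.mul_sum, hX]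
    exact Finset.sum_congr rfl fun d _ => by ring
  change (G y).mulVec (fun c => christoffel G c a b y) d = X d
  rw [hΓ, Matrix.mulVec_mulVec, h, Matrix.one_mulVec]

theorem christoffel_symm {G : Plane → Matrix (Fin 2) (Fin 2) ℝ} {y : Plane}
    (hG : ∀ᶠ w in nhds y, ∀ a b, G w a b = G w b a) (c a b : Fin 2) :
    christoffel G c a b y = christoffel G c b a y := by
  have h : ∀ i j k, pd k (fun w => G w i j) y = pd k (fun w => G w j i) y := fun i j k =>
    pd_congr (hG.mono fun w hw => hw i j) k
  simp only [christoffel]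
  congr 1
  refine Finset.sum_congr rfl fun d _ => ?_
  rw [h d b a, h a d b, h a b d]
  ring

variable {φ : Plane → Plane} {G G' Z Z' : Plane → Matrix (Fin 2) (Fin 2) ℝ} {f f' : Plane → ℝ}
  {y : Plane}

/-- The derivative of a (0,2) tensor in terms of the derivative in other coordinates. -/
theorem pd_pullback (hφ : ContDiffAt ℝ ∞ φ y)
    (hG' : ∀ a b, ContDiffAt ℝ ∞ (fun w => G' w a b) (φ y))
    (hG : ∀ᶠ w in nhds y, G w = (jacobian φ w).transpose * G' (φ w) * jacobian φ w)
    (a d b : Fin 2) :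
    pd a (fun w => G w d b) y = ∑ k, ∑ l,
      (pd a (pd d fun w => φ w k) y * G' (φ y) k l * jacobian φ y l b
        + jacobian φ y k d * (∑ i, jacobian φ y i a * pd i (fun w => G' w k l) (φ y))
          * jacobian φ y l b
        + jacobian φ y k d * G' (φ y) k l * pd a (pd b fun w => φ w l) y) := by
  have h1 : pd a (fun w => G w d b) y = pd a (fun w => ∑ k, ∑ l,
      pd d (fun w => φ w k) w * G' (φ w) k l * pd b (fun w => φ w l) w) y := by
    refine pd_congr (hG.mono fun w hw => ?_) a
    simp only [hw, Matrix.mul_apply, Matrix.transpose_apply, jacobian_apply, Fin.sum_univ_two]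
    ring
  have hJ : ∀ i a, DifferentiableAt ℝ (pd a (fun w => φ w i)) y := fun i a =>
    (contDiffAt_pd (contDiffAt_coord hφ i) a).differentiableAt (by simp)
  have hg : ∀ k l, DifferentiableAt ℝ (fun w => G' (φ w) k l) y := fun k l =>
    ((hG' k l).comp y hφ).differentiableAt (by simp)
  have hp : ∀ k l, pd a (fun w => G' (φ w) k l) y =
      ∑ i, jacobian φ y i a * pd i (fun w => G' w k l) (φ y) := fun k l =>
    pd_comp_map (f := fun w => G' w k l) ((hG' k l).differentiableAt (by simp))
      (hφ.differentiableAt (by simp)) a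
  have hterm : ∀ k l, pd a (fun w => pd d (fun w => φ w k) w * G' (φ w) k l *
      pd b (fun w => φ w l) w) y = pd a (pd d fun w => φ w k) y * G' (φ y) k l * jacobian φ y l b
        + jacobian φ y k d * (∑ i, jacobian φ y i a * pd i (fun w => G' w k l) (φ y))
          * jacobian φ y l b
        + jacobian φ y k d * G' (φ y) k l * pd a (pd b fun w => φ w l) y := by
    intro k l
    rw [pd_mul ((hJ k d).fun_mul (hg k l)) (hJ l b), pd_mul (hJ k d) (hg k l), hp]
    simp only [jacobian_apply]
    ring
  have hd : ∀ k l, DifferentiableAt ℝ (fun w => pd d (fun w => φ w k) w * G' (φ w) k l *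
      pd b (fun w => φ w l) w) y := fun k l => ((hJ k d).fun_mul (hg k l)).fun_mul (hJ l b)
  rw [h1]
  simp only [Fin.sum_univ_two] at hterm ⊢
  rw [pd_add ((hd 0 0).fun_add (hd 0 1)) ((hd 1 0).fun_add (hd 1 1)), pd_add (hd 0 0) (hd 0 1),
    pd_add (hd 1 0) (hd 1 1)]
  simp only [hterm]

/-- The transformation law of the Christoffel symbols. -/
theorem christoffel_pullback (hφ : ContDiffAt ℝ ∞ φ y)
    (hG' : ∀ a b, ContDiffAt ℝ ∞ (fun w => G' w a b) (φ y))
    (hG : ∀ᶠ w in nhds y, G w = (jacobian φ w).transpose * G' (φ w) * jacobian φ w)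
    (hsymm : ∀ᶠ w in nhds (φ y), ∀ a b, G' w a b = G' w b a)
    (hJ : (jacobian φ y).det ≠ 0) (hdet : (G' (φ y)).det ≠ 0) (k a b : Fin 2) :
    ∑ c, jacobian φ y k c * christoffel G c a b y = pd a (pd b fun w => φ w k) y
      + ∑ i, ∑ j, christoffel G' k i j (φ y) * jacobian φ y i a * jacobian φ y j b := by
  have hGy := hG.self_of_nhds
  have hdet0 : (G y).det ≠ 0 := by
    rw [hGy, Matrix.det_mul, Matrix.det_mul, Matrix.det_transpose]
    exact mul_ne_zero (mul_ne_zero hJ hdet) hJ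
  have hs := hsymm.self_of_nhds
  have hs' : ∀ i j k, pd k (fun w => G' w i j) (φ y) = pd k (fun w => G' w j i) (φ y) :=
    fun i j k => pd_congr (hsymm.mono fun w hw => hw i j) k
  have hc : ∀ k a b, pd a (pd b fun w => φ w k) y = pd b (pd a fun w => φ w k) y :=
    fun k a b => pd_comm (contDiffAt_coord hφ k) a b
  -- The law is checked after lowering the upper index, where only first derivatives of the metric
  -- and second derivatives of `φ` occur. Of the latter, those involving the index `d` cancel in
  -- pairs. The lowering matrix is invertible and is removed at the end.
  have hlow : ∀ d, ∑ k, ((jacobian φ y).transpose * G' (φ y)) d k *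
      (∑ c, jacobian φ y k c * christoffel G c a b y) =
      ∑ k, ((jacobian φ y).transpose * G' (φ y)) d k * (pd a (pd b fun w => φ w k) y
      + ∑ i, ∑ j, christoffel G' k i j (φ y) * jacobian φ y i a * jacobian φ y j b) := by
    intro d
    have e1 := sum_mul_christoffel hdet0 d a b
    rw [pd_pullback hφ hG' hG, pd_pullback hφ hG' hG, pd_pullback hφ hG' hG] at e1
    have e2 := fun d i j => sum_mul_christoffel hdet d i j
    trans ∑ c, G y d c * christoffel G c a b y
    · rw [hGy]; simp only [Matrix.mul_apply, Fin.sum_univ_two]; ring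
    rw [e1]
    trans ∑ k, ∑ l, jacobian φ y l d * G' (φ y) l k * pd a (pd b fun w => φ w k) y +
      ∑ l, ∑ i, ∑ j, jacobian φ y l d * jacobian φ y i a * jacobian φ y j b *
        ∑ k, G' (φ y) l k * christoffel G' k i j (φ y)
    · simp only [e2, hs 1 0, hs' 1 0, hc _ b a, hc _ d a, hc _ d b, Fin.sum_univ_two]
      ring
    · simp only [Matrix.mul_apply, Matrix.transpose_apply, Fin.sum_univ_two]
      ring
  have hinj : IsUnit ((jacobian φ y).transpose * G' (φ y)) := by
    rw [Matrix.isUnit_iff_isUnit_det, Matrix.det_mul, Matrix.det_transpose]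
    exact (mul_ne_zero hJ hdet).isUnit
  have := (Matrix.mulVec_injective_iff_isUnit.mpr hinj) (funext hlow :
    Matrix.mulVec _ (fun k => ∑ c, jacobian φ y k c * christoffel G c a b y) =
    Matrix.mulVec _ (fun k => pd a (pd b fun w => φ w k) y
      + ∑ i, ∑ j, christoffel G' k i j (φ y) * jacobian φ y i a * jacobian φ y j b))
  exact congrFun this k

theorem pd_pullback_fun (hφ : ContDiffAt ℝ ∞ φ y) (hf' : ContDiffAt ℝ ∞ f' (φ y))
    (hf : ∀ᶠ w in nhds y, f w = f' (φ w)) (a : Fin 2) :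
    pd a f y = ∑ i, jacobian φ y i a * pd i f' (φ y) := by
  rw [pd_congr hf a]
  exact pd_comp_map (hf'.differentiableAt (by simp)) (hφ.differentiableAt (by simp)) a

/-- The Hessian is a tensor. -/
theorem hessian_pullback (hφ : ∀ᶠ w in nhds y, ContDiffAt ℝ ∞ φ w)
    (hG' : ∀ a b, ContDiffAt ℝ ∞ (fun w => G' w a b) (φ y)) 
    (hf' : ∀ᶠ w in nhds (φ y), ContDiffAt ℝ ∞ f' w)
    (hG : ∀ᶠ w in nhds y, G w = (jacobian φ w).transpose * G' (φ w) * jacobian φ w)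
    (hf : ∀ᶠ w in nhds y, f w = f' (φ w))
    (hsymm : ∀ᶠ w in nhds (φ y), ∀ a b, G' w a b = G' w b a)
    (hJ : (jacobian φ y).det ≠ 0) (hdet : (G' (φ y)).det ≠ 0) (a b : Fin 2) :
    hessian G f a b y = ∑ i, ∑ j, jacobian φ y i a * hessian G' f' i j (φ y) *
      jacobian φ y j b := by
  have hφ' := hφ.and ((hφ.self_of_nhds.continuousAt.eventually hf').and hf.eventually_nhds)
  replace hφ := hφ.self_of_nhds
  replace hf' := hf'.self_of_nhds
  have h1 : pd a (pd b f) y = pd a (fun w => ∑ i, pd b (fun w => φ w i) w * pd i f' (φ w)) y :=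
    pd_congr (hφ'.mono fun w hw => pd_pullback_fun hw.1 hw.2.1 hw.2.2 b) a
  have hJd : ∀ i a, DifferentiableAt ℝ (pd a (fun w => φ w i)) y := fun i a =>
    (contDiffAt_pd (contDiffAt_coord hφ i) a).differentiableAt (by simp)
  have hfd : ∀ i, DifferentiableAt ℝ (fun w => pd i f' (φ w)) y := fun i =>
    ((contDiffAt_pd hf' i).comp y hφ).differentiableAt (by simp)
  have hp : ∀ i, pd a (fun w => pd i f' (φ w)) y =
      ∑ j, jacobian φ y j a * pd j (pd i f') (φ y) := fun i =>
    pd_comp_map ((contDiffAt_pd hf' i).differentiableAt (by simp))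
      (hφ.differentiableAt (by simp)) a
  have hΓ := fun k => christoffel_pullback hφ hG' hG hsymm hJ hdet k a b
  have h0 := hΓ 0
  have h2 := hΓ 1
  simp only [hessian]
  rw [h1]
  simp only [pd_pullback_fun hφ hf' hf, Fin.sum_univ_two] at *
  rw [pd_add ((hJd 0 b).fun_mul (hfd 0)) ((hJd 1 b).fun_mul (hfd 1)), pd_mul (hJd 0 b) (hfd 0),
    pd_mul (hJd 1 b) (hfd 1), hp, hp]
  simp only [← jacobian_apply]
  -- The second derivatives of `φ` that arise from differentiating the chain rule are the
  -- inhomogeneous terms of the Christoffel law.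
  linear_combination -pd 0 f' (φ y) * h0 - pd 1 f' (φ y) * h2

/-- Data in two coordinate systems which are related by the change of coordinates `φ`. -/
structure Related (φ : Plane → Plane) (G G' Z Z' : Plane → Matrix (Fin 2) (Fin 2) ℝ)
    (f f' : Plane → ℝ) (y : Plane) : Prop where
  contDiffAt : ContDiffAt ℝ ∞ φ y
  contDiffAt_metric : ∀ a b, ContDiffAt ℝ ∞ (fun w => G' w a b) (φ y)
  det_jacobian : (jacobian φ y).det ≠ 0
  det_metric : (G' (φ y)).det ≠ 0
  metric : G y = (jacobian φ y).transpose * G' (φ y) * jacobian φ y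
  tensor : Z y = (jacobian φ y).transpose * Z' (φ y) * jacobian φ y
  func : f y = f' (φ y)

/-! ### Pullback of inverses, raised indices and traces -/

theorem inv_pullback {J A : Matrix (Fin 2) (Fin 2) ℝ} :
    (J.transpose * A * J)⁻¹ = J⁻¹ * A⁻¹ * J⁻¹.transpose := by
  rw [Matrix.mul_inv_rev, Matrix.mul_inv_rev, Matrix.transpose_nonsing_inv, Matrix.mul_assoc]

/-- Raising the indices of a tensor and pulling back commute. -/
theorem raise_pullback {J A X : Matrix (Fin 2) (Fin 2) ℝ} (hJ : J.det ≠ 0) :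
    (J.transpose * A * J)⁻¹ * (J.transpose * X * J) * ((J.transpose * A * J)⁻¹).transpose =
      J⁻¹ * (A⁻¹ * X * A⁻¹.transpose) * J⁻¹.transpose := by
  have h1 : J * J⁻¹ = 1 := Matrix.mul_nonsing_inv _ hJ.isUnit
  have h2 : J⁻¹.transpose * J.transpose = 1 := by
    rw [← Matrix.transpose_mul, h1, Matrix.transpose_one]
  rw [inv_pullback]
  simp only [Matrix.transpose_mul, Matrix.transpose_transpose]
  calc _ = J⁻¹ * A⁻¹ * (J⁻¹.transpose * J.transpose) * X * (J * J⁻¹) * A⁻¹.transpose *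
        J⁻¹.transpose := by simp only [Matrix.mul_assoc]
    _ = _ := by rw [h1, h2]; simp only [Matrix.mul_assoc, Matrix.one_mul]

/-- The Jacobian factors cancel in pairs, one pair only after a cyclic permutation under the trace.
This is the invariance of full contractions, used for the Laplacian and for `normSq`. -/
theorem trace_mul_pullback {J A X : Matrix (Fin 2) (Fin 2) ℝ} (hJ : J.det ≠ 0) :
    (J⁻¹ * A * J⁻¹.transpose * (J.transpose * X * J)).trace = (A * X).trace := by
  have h1 : J * J⁻¹ = 1 := Matrix.mul_nonsing_inv _ hJ.isUnit
  have h2 : J⁻¹.transpose * J.transpose = 1 := by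
    rw [← Matrix.transpose_mul, h1, Matrix.transpose_one]
  calc _ = (J⁻¹ * (A * (J⁻¹.transpose * J.transpose) * X * J)).trace := by
        simp only [Matrix.mul_assoc]
    _ = (A * (J⁻¹.transpose * J.transpose) * X * (J * J⁻¹)).trace := by
        rw [Matrix.trace_mul_comm]; simp only [Matrix.mul_assoc]
    _ = _ := by rw [h1, h2]; simp

theorem laplacian_eq_trace (G : Plane → Matrix (Fin 2) (Fin 2) ℝ) (f : Plane → ℝ) (y : Plane) :
    laplacian G f y = ((G y)⁻¹ * (Matrix.of fun a b => hessian G f a b y).transpose).trace := by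
  simp [laplacian, Matrix.trace, Matrix.mul_apply, Matrix.transpose_apply]

theorem normSq_eq_trace (G T : Plane → Matrix (Fin 2) (Fin 2) ℝ) (y : Plane) :
    normSq G T y =
      ((G y)⁻¹ * T y * ((G y)⁻¹).transpose * (T y).transpose).trace := by
  simp only [normSq, Matrix.trace, Matrix.mul_apply, Matrix.transpose_apply, Fin.sum_univ_two,
    Matrix.diag_apply]
  ring

theorem gInv_eq (G Z : Plane → Matrix (Fin 2) (Fin 2) ℝ) (f : Plane → ℝ) (y : Plane) :
    gInv G Z f y = (1 + B G Z f y)⁻¹ • ((-2 : ℝ) • ((G y)⁻¹ * xi G Z f y * ((G y)⁻¹).transpose)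
      + B G Z f y • (G y)⁻¹) := by
  ext a b
  simp only [gInv, Matrix.of_apply, Matrix.smul_apply, Matrix.add_apply, Matrix.mul_apply,
    Matrix.transpose_apply, Fin.sum_univ_two, smul_eq_mul]
  ring

theorem xi_eq (G Z : Plane → Matrix (Fin 2) (Fin 2) ℝ) (f : Plane → ℝ) (y : Plane) :
    xi G Z f y = Z y - (Matrix.of fun a b => hessian G f a b y)
      + (1 / 2 * laplacian G f y) • G y := by
  ext a b
  simp only [xi, Matrix.of_apply, Matrix.smul_apply, Matrix.add_apply, Matrix.sub_apply,
    smul_eq_mul]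
  ring

/-! ### Coordinate invariance of `ξ`, `B` and `g` -/

namespace Related

theorem hessian_eq (h : ∀ᶠ w in nhds y, Related φ G G' Z Z' f f' w)
    (hs : ∀ᶠ w in nhds (φ y), ∀ a b, G' w a b = G' w b a)
    (hf : ∀ᶠ w in nhds (φ y), ContDiffAt ℝ ∞ f' w) :
    (Matrix.of fun a b => hessian G f a b y) = (jacobian φ y).transpose *
      (Matrix.of fun a b => hessian G' f' a b (φ y)) * jacobian φ y := by
  have hy := h.self_of_nhds
  ext a b
  simp only [Matrix.of_apply]
  rw [hessian_pullback (h.mono fun w hw => hw.contDiffAt) hy.contDiffAt_metric hf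
    (h.mono fun w hw => hw.metric) (h.mono fun w hw => hw.func) hs hy.det_jacobian hy.det_metric]
  simp only [Matrix.mul_apply, Matrix.transpose_apply, Fin.sum_univ_two, Matrix.of_apply]
  ring

theorem xi_eq
    (h : ∀ᶠ w in nhds y, Related φ G G' Z Z' f f' w)
    (hs : ∀ᶠ w in nhds (φ y), ∀ a b, G' w a b = G' w b a)
    (hf : ∀ᶠ w in nhds (φ y), ContDiffAt ℝ ∞ f' w) :
    xi G Z f y = (jacobian φ y).transpose * xi G' Z' f' (φ y) * jacobian φ y := by
  have hy := h.self_of_nhds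
  have hH := hessian_eq h hs hf
  have hL : laplacian G f y = laplacian G' f' (φ y) := by
    rw [laplacian_eq_trace, laplacian_eq_trace, hH, hy.metric, inv_pullback]
    simp only [Matrix.transpose_mul, Matrix.transpose_transpose]
    rw [← Matrix.mul_assoc (jacobian φ y).transpose]
    exact trace_mul_pullback hy.det_jacobian
  rw [Moncrief.xi_eq, Moncrief.xi_eq, hL, hH, hy.tensor, hy.metric]
  simp only [Matrix.mul_add, Matrix.add_mul, Matrix.mul_sub, Matrix.sub_mul, Matrix.mul_smul,
    Matrix.smul_mul]

theorem B_eq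
    (h : ∀ᶠ w in nhds y, Related φ G G' Z Z' f f' w)
    (hs : ∀ᶠ w in nhds (φ y), ∀ a b, G' w a b = G' w b a)
    (hf : ∀ᶠ w in nhds (φ y), ContDiffAt ℝ ∞ f' w) :
    B G Z f y = B G' Z' f' (φ y) := by
  have hy := h.self_of_nhds
  have hn : normSq G (xi G Z f) y = normSq G' (xi G' Z' f') (φ y) := by
    rw [normSq_eq_trace, normSq_eq_trace, xi_eq h hs hf, hy.metric,
      raise_pullback hy.det_jacobian]
    simp only [Matrix.transpose_mul, Matrix.transpose_transpose]
    rw [← Matrix.mul_assoc (jacobian φ y).transpose]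
    exact trace_mul_pullback hy.det_jacobian
  rw [B, B, hn]

theorem gInv_eq
    (h : ∀ᶠ w in nhds y, Related φ G G' Z Z' f f' w)
    (hs : ∀ᶠ w in nhds (φ y), ∀ a b, G' w a b = G' w b a)
    (hf : ∀ᶠ w in nhds (φ y), ContDiffAt ℝ ∞ f' w) :
    gInv G Z f y = (jacobian φ y)⁻¹ * gInv G' Z' f' (φ y) *
    (jacobian φ y)⁻¹.transpose := by
  have hy := h.self_of_nhds
  rw [Moncrief.gInv_eq, Moncrief.gInv_eq, B_eq h hs hf, xi_eq h hs hf, hy.metric,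
    raise_pullback hy.det_jacobian, inv_pullback]
  simp only [Matrix.mul_add, Matrix.add_mul, Matrix.mul_smul, Matrix.smul_mul]

/-- The gradient norm contracts with the inverse of `gMetric`, a double inverse of `gInv`. Inverting
twice reverses the factors twice, so only the Jacobian has to be invertible here. -/
theorem gMetric_inv_eq
    (h : ∀ᶠ w in nhds y, Related φ G G' Z Z' f f' w)
    (hs : ∀ᶠ w in nhds (φ y), ∀ a b, G' w a b = G' w b a)
    (hf : ∀ᶠ w in nhds (φ y), ContDiffAt ℝ ∞ f' w) :
    (gMetric G Z f y)⁻¹ = (jacobian φ y)⁻¹ *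
    (gMetric G' Z' f' (φ y))⁻¹ * (jacobian φ y)⁻¹.transpose := by
  have hJ : (jacobian φ y)⁻¹⁻¹ = jacobian φ y :=
    Matrix.nonsing_inv_nonsing_inv _ h.self_of_nhds.det_jacobian.isUnit
  simp only [gMetric]
  rw [gInv_eq h hs hf]
  simp only [Matrix.mul_inv_rev, ← Matrix.transpose_nonsing_inv, Matrix.mul_assoc, hJ]

end Related

/-- The norm of the gradient does not depend on the coordinates. -/
theorem gradNorm_pullback (hφ : ContDiffAt ℝ ∞ φ y) (hf' : ContDiffAt ℝ ∞ f' (φ y))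
    (hf : ∀ᶠ w in nhds y, f w = f' (φ w)) (hJ : (jacobian φ y).det ≠ 0)
    (hG : (G y)⁻¹ = (jacobian φ y)⁻¹ * (G' (φ y))⁻¹ * (jacobian φ y)⁻¹.transpose) :
    gradNorm G f y = gradNorm G' f' (φ y) := by
  have key : ∀ (A : Matrix (Fin 2) (Fin 2) ℝ) (v : Fin 2 → ℝ),
      ∑ a, ∑ b, A a b * v a * v b = dotProduct v (A.mulVec v) := by
    intro A v
    simp only [dotProduct, Matrix.mulVec, Fin.sum_univ_two]
    ring
  have h1 : (jacobian φ y)⁻¹.transpose * (jacobian φ y).transpose = 1 := by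
    rw [← Matrix.transpose_mul, Matrix.mul_nonsing_inv _ hJ.isUnit, Matrix.transpose_one]
  have hv : (fun a => pd a f y) =
      (jacobian φ y).transpose.mulVec (fun a => pd a f' (φ y)) := by
    funext a
    rw [pd_pullback_fun hφ hf' hf]
    simp [Matrix.mulVec, dotProduct]
  simp only [gradNorm]
  rw [key _ (fun a => pd a f y), key _ (fun a => pd a f' (φ y)), hv, hG, Matrix.mulVec_mulVec,
    Matrix.mul_assoc, h1, Matrix.mul_one, ← Matrix.mulVec_mulVec, Matrix.mulVec_transpose,
    ← Matrix.dotProduct_mulVec, Matrix.mulVec_mulVec, Matrix.mul_nonsing_inv _ hJ.isUnit,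
    Matrix.one_mulVec]

end ChangeOfCoordinates

/-! ### Orthonormal coframes and the structure equations -/

/-- `p`, `r` are the components of a smooth orthonormal coframe on `U` for the metric `G`. -/
structure IsCoframe (G : Plane → Matrix (Fin 2) (Fin 2) ℝ) (p r : Fin 2 → Plane → ℝ)
    (U : Set Plane) : Prop where
  isOpen : IsOpen U
  smooth_fst : ∀ b, ∀ y ∈ U, ContDiffAt ℝ ∞ (p b) y
  smooth_snd : ∀ b, ∀ y ∈ U, ContDiffAt ℝ ∞ (r b) y
  metric : ∀ y ∈ U, ∀ a b, G y a b = p a y * p b y + r a y * r b y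
  area_ne_zero : ∀ y ∈ U, p 0 y * r 1 y - p 1 y * r 0 y ≠ 0

/-- The connection form `ω_a`, determined by `∇_a p = ω_a r`. -/
def connForm (G : Plane → Matrix (Fin 2) (Fin 2) ℝ) (p r : Fin 2 → Plane → ℝ) (a : Fin 2)
    (y : Plane) : ℝ :=
  (p 0 y * (pd a (p 1) y - ∑ c, christoffel G c a 1 y * p c y)
    - p 1 y * (pd a (p 0) y - ∑ c, christoffel G c a 0 y * p c y)) /
      (p 0 y * r 1 y - p 1 y * r 0 y)

/-- The hypotheses say that the symmetric part of `x ⊗ p + y ⊗ r` vanishes. Relative to the basis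
`p`, `r` the coefficients of `(x, y)` thus form an antisymmetric matrix, and in dimension two this
is one number `κ`. The auxiliary facts `hx`, `hy`, `hxy` are the two vanishing diagonal entries and
the opposite off-diagonal ones. -/
theorem eq_mul_of_symm_eq_zero {p0 p1 r0 r1 x0 x1 y0 y1 : ℝ} (hD : p0 * r1 - p1 * r0 ≠ 0)
    (h00 : x0 * p0 + y0 * r0 = 0) (h01 : x0 * p1 + p0 * x1 + y0 * r1 + r0 * y1 = 0)
    (h11 : x1 * p1 + y1 * r1 = 0) :
    let κ := (p0 * x1 - p1 * x0) / (p0 * r1 - p1 * r0)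
    (x0 = κ * r0 ∧ x1 = κ * r1) ∧ (y0 = -κ * p0 ∧ y1 = -κ * p1) := by
  have hx : x0 * r1 - x1 * r0 = 0 := by
    apply mul_left_cancel₀ hD
    linear_combination r1 ^ 2 * h00 - r0 * r1 * h01 + r0 ^ 2 * h11
  have hy : p0 * y1 - p1 * y0 = 0 := by
    apply mul_left_cancel₀ hD
    linear_combination p1 ^ 2 * h00 - p0 * p1 * h01 + p0 ^ 2 * h11
  have hxy : (y0 * r1 - y1 * r0) + (p0 * x1 - p1 * x0) = 0 := by
    apply mul_left_cancel₀ hD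
    linear_combination -2 * p1 * r1 * h00 + (p0 * r1 + p1 * r0) * h01 - 2 * p0 * r0 * h11
  intro κ
  have hκ : κ * (p0 * r1 - p1 * r0) = p0 * x1 - p1 * x0 := div_mul_cancel₀ _ hD
  refine ⟨⟨?_, ?_⟩, ?_, ?_⟩ <;> apply mul_left_cancel₀ hD
  · linear_combination p0 * hx - r0 * hκ
  · linear_combination p1 * hx - r1 * hκ
  · linear_combination p0 * hxy + p0 * hκ + r0 * hy
  · linear_combination p1 * hxy + p1 * hκ + r1 * hy

namespace IsCoframe

variable {G Z : Plane → Matrix (Fin 2) (Fin 2) ℝ} {p r : Fin 2 → Plane → ℝ} {U : Set Plane}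
  {u : Plane → ℝ} {y : Plane}

theorem eventually (h : IsCoframe G p r U) (hy : y ∈ U) {P : Plane → Prop}
    (hP : ∀ w ∈ U, P w) : ∀ᶠ w in nhds y, P w :=
  Filter.mem_of_superset (h.isOpen.mem_nhds hy) hP

theorem det_eq (h : IsCoframe G p r U) (hy : y ∈ U) :
    (G y).det = (p 0 y * r 1 y - p 1 y * r 0 y) ^ 2 := by
  rw [Matrix.det_fin_two]
  simp only [h.metric y hy]
  ring

theorem det_ne_zero (h : IsCoframe G p r U) (hy : y ∈ U) : (G y).det ≠ 0 := by
  rw [h.det_eq hy]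
  exact pow_ne_zero _ (h.area_ne_zero y hy)

theorem symm (h : IsCoframe G p r U) : ∀ y ∈ U, ∀ a b, G y a b = G y b a := by
  intro y hy a b
  rw [h.metric y hy, h.metric y hy]
  ring

theorem smooth_metric (h : IsCoframe G p r U) (hy : y ∈ U) (a b : Fin 2) :
    ContDiffAt ℝ ∞ (fun w => G w a b) y :=
  (((h.smooth_fst a y hy).mul (h.smooth_fst b y hy)).add
    ((h.smooth_snd a y hy).mul (h.smooth_snd b y hy))).congr_of_eventuallyEq
    (h.eventually hy fun w hw => h.metric w hw a b)

end IsCoframe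

theorem contDiffAt_inv {G : Plane → Matrix (Fin 2) (Fin 2) ℝ} {y : Plane}
    (hG : ∀ a b, ContDiffAt ℝ ∞ (fun w => G w a b) y) (hdet : (G y).det ≠ 0) (a b : Fin 2) :
    ContDiffAt ℝ ∞ (fun w => (G w)⁻¹ a b) y := by
  have hd : ContDiffAt ℝ ∞ (fun w => (G w).det) y := by
    simp only [Matrix.det_fin_two]
    exact ((hG 0 0).mul (hG 1 1)).sub ((hG 0 1).mul (hG 1 0))
  have h : ∀ w, (G w)⁻¹ a b = (G w).det⁻¹ * (!![G w 1 1, -G w 0 1; -G w 1 0, G w 0 0] a b) := by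
    intro w
    rw [Matrix.inv_def, Matrix.adjugate_fin_two, Ring.inverse_eq_inv', Matrix.smul_apply,
      smul_eq_mul]
  simp only [h]
  refine (hd.inv hdet).mul ?_
  fin_cases a <;> fin_cases b <;> simp
  · exact hG 1 1
  · exact (hG 0 1).neg
  · exact (hG 1 0).neg
  · exact hG 0 0

theorem contDiffAt_christoffel {G : Plane → Matrix (Fin 2) (Fin 2) ℝ} {y : Plane}
    (hG : ∀ a b, ContDiffAt ℝ ∞ (fun w => G w a b) y) (hdet : (G y).det ≠ 0) (c a b : Fin 2) :
    ContDiffAt ℝ ∞ (christoffel G c a b) y := by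
  unfold christoffel
  refine contDiffAt_const.mul (ContDiffAt.sum fun d _ => (contDiffAt_inv hG hdet c d).mul ?_)
  exact ((contDiffAt_pd (hG _ _) _).add (contDiffAt_pd (hG _ _) _)).sub (contDiffAt_pd (hG _ _) _)

namespace IsCoframe

variable {G Z : Plane → Matrix (Fin 2) (Fin 2) ℝ} {p r : Fin 2 → Plane → ℝ} {U : Set Plane}
  {u : Plane → ℝ} {y : Plane}

theorem smooth_christoffel (h : IsCoframe G p r U) (hy : y ∈ U) (c a b : Fin 2) :
    ContDiffAt ℝ ∞ (christoffel G c a b) y :=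
  contDiffAt_christoffel (h.smooth_metric hy) (h.det_ne_zero hy) c a b

theorem smooth_connForm (h : IsCoframe G p r U) (hy : y ∈ U) (a : Fin 2) :
    ContDiffAt ℝ ∞ (connForm G p r a) y := by
  have hp := fun b => h.smooth_fst b y hy
  have hr := fun b => h.smooth_snd b y hy
  have hdp := fun b => contDiffAt_pd (hp b) a
  have hΓ := fun c b => h.smooth_christoffel hy c a b
  unfold connForm
  simp only [Fin.sum_univ_two]
  refine ContDiffAt.div ?_ ?_ (h.area_ne_zero y hy) <;> fun_prop

theorem christoffel_comm (h : IsCoframe G p r U) (hy : y ∈ U) (c a b : Fin 2) :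
    christoffel G c a b y = christoffel G c b a y :=
  christoffel_symm (h.eventually hy h.symm) c a b

/-- Metric compatibility of the Levi-Civita connection, `∇_a (p ⊗ p + r ⊗ r) = 0`, read off from the
Christoffel symbols of the first kind. -/
theorem conn_aux (h : IsCoframe G p r U) (hy : y ∈ U) (a b c : Fin 2) :
    (pd a (p b) y - ∑ d, christoffel G d a b y * p d y) * p c y
      + p b y * (pd a (p c) y - ∑ d, christoffel G d a c y * p d y)
      + (pd a (r b) y - ∑ d, christoffel G d a b y * r d y) * r c y
      + r b y * (pd a (r c) y - ∑ d, christoffel G d a c y * r d y) = 0 := by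
  have hs : ∀ i j k, pd k (fun w => G w i j) y = pd k (fun w => G w j i) y := fun i j k =>
    pd_congr (h.eventually hy fun w hw => h.symm w hw i j) k
  have e1 := sum_mul_christoffel (h.det_ne_zero hy) c a b
  have e2 := sum_mul_christoffel (h.det_ne_zero hy) b a c
  have hp : ∀ b, DifferentiableAt ℝ (p b) y := fun b =>
    (h.smooth_fst b y hy).differentiableAt (by simp)
  have hr : ∀ b, DifferentiableAt ℝ (r b) y := fun b =>
    (h.smooth_snd b y hy).differentiableAt (by simp)
  have e3 : pd a (fun w => G w b c) y = pd a (p b) y * p c y + p b y * pd a (p c) y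
      + (pd a (r b) y * r c y + r b y * pd a (r c) y) := by
    rw [pd_congr (h.eventually hy fun w hw => h.metric w hw b c) a,
      pd_add ((hp b).fun_mul (hp c)) ((hr b).fun_mul (hr c)), pd_mul (hp b) (hp c),
      pd_mul (hr b) (hr c)]
  simp only [h.metric y hy, Fin.sum_univ_two] at e1 e2 ⊢
  rw [hs c b a] at e1
  linear_combination -e3 - e1 - e2

/-- By `conn_aux` the covariant derivative of an orthonormal coframe is an infinitesimal rotation,
so a single one-form describes it. -/
theorem conn (h : IsCoframe G p r U) (hy : y ∈ U) (a b : Fin 2) :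
    pd a (p b) y = ∑ d, christoffel G d a b y * p d y + connForm G p r a y * r b y ∧
      pd a (r b) y = ∑ d, christoffel G d a b y * r d y - connForm G p r a y * p b y := by
  have h00 := h.conn_aux hy a 0 0
  have h01 := h.conn_aux hy a 0 1
  have h11 := h.conn_aux hy a 1 1
  have key := eq_mul_of_symm_eq_zero (h.area_ne_zero y hy)
    (x0 := pd a (p 0) y - ∑ d, christoffel G d a 0 y * p d y)
    (x1 := pd a (p 1) y - ∑ d, christoffel G d a 1 y * p d y)
    (y0 := pd a (r 0) y - ∑ d, christoffel G d a 0 y * r d y)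
    (y1 := pd a (r 1) y - ∑ d, christoffel G d a 1 y * r d y)
    (by linear_combination h00 / 2) h01 (by linear_combination h11 / 2)
  obtain ⟨⟨k1, k2⟩, k3, k4⟩ := key
  have hω : connForm G p r a y = (p 0 y * (pd a (p 1) y - ∑ c, christoffel G c a 1 y * p c y)
    - p 1 y * (pd a (p 0) y - ∑ c, christoffel G c a 0 y * p c y)) /
      (p 0 y * r 1 y - p 1 y * r 0 y) := rfl
  rw [← hω] at k1 k2 k3 k4
  revert b
  rw [Fin.forall_fin_two]
  exact ⟨⟨by linear_combination k1, by linear_combination k3⟩,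
    by linear_combination k2, by linear_combination k4⟩

/-- The first structure equations `dp = ω ∧ r`, `dr = -ω ∧ p`. -/
theorem d_fst (h : IsCoframe G p r U) (hy : y ∈ U) :
    pd 0 (p 1) y - pd 1 (p 0) y =
      connForm G p r 0 y * r 1 y - connForm G p r 1 y * r 0 y := by
  rw [(h.conn hy 0 1).1, (h.conn hy 1 0).1]
  simp only [h.christoffel_comm hy _ 1 0]
  ring

theorem d_snd (h : IsCoframe G p r U) (hy : y ∈ U) :
    pd 0 (r 1) y - pd 1 (r 0) y =
      -(connForm G p r 0 y * p 1 y - connForm G p r 1 y * p 0 y) := by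
  rw [(h.conn hy 0 1).2, (h.conn hy 1 0).2]
  simp only [h.christoffel_comm hy _ 1 0]
  ring

/-- The second structure equation `dω = ½ p ∧ r`, for a metric of scalar curvature `-1`. -/
theorem d_connForm (h : IsCoframe G p r U) (hy : y ∈ U) (hR : scalarCurvature G y = -1) :
    pd 0 (connForm G p r 1) y - pd 1 (connForm G p r 0) y =
      1 / 2 * (p 0 y * r 1 y - p 1 y * r 0 y) := by
  have hp : ∀ b, DifferentiableAt ℝ (p b) y := fun b =>
    (h.smooth_fst b y hy).differentiableAt (by simp)
  have hr : ∀ b, DifferentiableAt ℝ (r b) y := fun b =>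
    (h.smooth_snd b y hy).differentiableAt (by simp)
  have hΓ : ∀ c a b, DifferentiableAt ℝ (christoffel G c a b) y := fun c a b =>
    (h.smooth_christoffel hy c a b).differentiableAt (by simp)
  have hω : ∀ a, DifferentiableAt ℝ (connForm G p r a) y := fun a =>
    (h.smooth_connForm hy a).differentiableAt (by simp)
  have ep : ∀ c a b, pd c (pd a (p b)) y =
      (pd c (christoffel G 0 a b) y * p 0 y + christoffel G 0 a b y * pd c (p 0) y
        + (pd c (christoffel G 1 a b) y * p 1 y + christoffel G 1 a b y * pd c (p 1) y))
        + (pd c (connForm G p r a) y * r b y + connForm G p r a y * pd c (r b) y) := by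
    intro c a b
    rw [pd_congr (h.eventually hy fun w hw => (h.conn hw a b).1) c]
    simp only [Fin.sum_univ_two]
    rw [pd_add (by fun_prop) (by fun_prop), pd_add (by fun_prop) (by fun_prop),
      pd_mul (hΓ _ _ _) (hp _), pd_mul (hΓ _ _ _) (hp _), pd_mul (hω _) (hr _)]
  have er : ∀ c a b, pd c (pd a (r b)) y =
      (pd c (christoffel G 0 a b) y * r 0 y + christoffel G 0 a b y * pd c (r 0) y
        + (pd c (christoffel G 1 a b) y * r 1 y + christoffel G 1 a b y * pd c (r 1) y))
        - (pd c (connForm G p r a) y * p b y + connForm G p r a y * pd c (p b) y) := by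
    intro c a b
    rw [pd_congr (h.eventually hy fun w hw => (h.conn hw a b).2) c]
    simp only [Fin.sum_univ_two]
    rw [pd_sub (by fun_prop) (by fun_prop), pd_add (by fun_prop) (by fun_prop),
      pd_mul (hΓ _ _ _) (hr _), pd_mul (hΓ _ _ _) (hr _), pd_mul (hω _) (hp _)]
  -- The curvature tensor with its antisymmetric pair of indices fixed to `0`, `1`, the only
  -- independent choice in dimension two.
  set R : Fin 2 → Fin 2 → ℝ := fun d b => pd 0 (christoffel G d 1 b) y
    - pd 1 (christoffel G d 0 b) y + ∑ e, (christoffel G d 0 e y * christoffel G e 1 b y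
      - christoffel G d 1 e y * christoffel G e 0 b y) with hRdef
  set Ω := pd 0 (connForm G p r 1) y - pd 1 (connForm G p r 0) y with hΩ
  -- Equality of mixed partial derivatives of the coframe is the Ricci identity: curvature acts on
  -- the coframe as the rotation `Ω = dω`.
  have hRp : ∀ b, R 0 b * p 0 y + R 1 b * p 1 y = -Ω * r b y := by
    intro b
    have e := pd_comm (h.smooth_fst b y hy) 0 1
    rw [ep, ep] at e
    simp only [fun a b => (h.conn hy a b).1, fun a b => (h.conn hy a b).2,
      Fin.sum_univ_two] at e
    simp only [hRdef, hΩ, Fin.sum_univ_two]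
    linear_combination e
  have hRr : ∀ b, R 0 b * r 0 y + R 1 b * r 1 y = Ω * p b y := by
    intro b
    have e := pd_comm (h.smooth_snd b y hy) 0 1
    rw [er, er] at e
    simp only [fun a b => (h.conn hy a b).1, fun a b => (h.conn hy a b).2,
      Fin.sum_univ_two] at e
    simp only [hRdef, hΩ, Fin.sum_univ_two]
    linear_combination e
  have hD := h.area_ne_zero y hy
  set D := p 0 y * r 1 y - p 1 y * r 0 y with hDdef
  -- Solving for the curvature leaves only `Ω` and the metric. Contraction then gives scalar
  -- curvature `-2Ω/D`.
  have hR0 : ∀ b, D * R 0 b = -Ω * G y b 1 := by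
    intro b
    rw [h.metric y hy]
    linear_combination r 1 y * hRp b - p 1 y * hRr b
  have hR1 : ∀ b, D * R 1 b = Ω * G y b 0 := by
    intro b
    rw [h.metric y hy]
    linear_combination p 0 y * hRr b - r 0 y * hRp b
  have hinv : (G y)⁻¹ * G y = 1 := Matrix.nonsing_inv_mul _ (h.det_ne_zero hy).isUnit
  have i0 := congrFun (congrFun hinv 0) 0
  have i1 := congrFun (congrFun hinv 1) 1
  simp only [Matrix.mul_apply, Fin.sum_univ_two, Matrix.one_apply_eq] at i0 i1
  have hS : scalarCurvature G y = (G y)⁻¹ 0 0 * (-R 1 0) + (G y)⁻¹ 0 1 * (-R 1 1)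
      + (G y)⁻¹ 1 0 * R 0 0 + (G y)⁻¹ 1 1 * R 0 1 := by
    simp only [scalarCurvature, ricci, hRdef, Fin.sum_univ_two]
    ring
  rw [hR] at hS
  have : D = 2 * Ω := by
    linear_combination -D * hS + (G y)⁻¹ 0 0 * hR1 0 + (G y)⁻¹ 0 1 * hR1 1 -
      (G y)⁻¹ 1 0 * hR0 0 - (G y)⁻¹ 1 1 * hR0 1 + Ω * i0 + Ω * i1
  linarith

end IsCoframe

/-! ### Frame components and the Codazzi equation -/

section Components

variable (Z : Plane → Matrix (Fin 2) (Fin 2) ℝ) (p r : Fin 2 → Plane → ℝ) (u : Plane → ℝ)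

/-- The component of `Z` on the square of the first vector of the dual frame. -/
def compDiag (y : Plane) : ℝ :=
  (r 1 y * r 1 y * Z y 0 0 - 2 * (r 0 y * r 1 y * Z y 0 1) + r 0 y * r 0 y * Z y 1 1) /
    (p 0 y * r 1 y - p 1 y * r 0 y) ^ 2

/-- The off-diagonal component of `Z` in the dual frame. -/
def compOff (y : Plane) : ℝ :=
  (-(p 1 y * r 1 y * Z y 0 0) + (p 0 y * r 1 y + p 1 y * r 0 y) * Z y 0 1
    - p 0 y * r 0 y * Z y 1 1) / (p 0 y * r 1 y - p 1 y * r 0 y) ^ 2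

/-- The derivative of `u` along the first vector of the frame dual to `p`, `r`. -/
def derivFst (y : Plane) : ℝ :=
  (pd 0 u y * r 1 y - pd 1 u y * r 0 y) / (p 0 y * r 1 y - p 1 y * r 0 y)

/-- The derivative of `u` along the second vector of the frame dual to `p`, `r`. -/
def derivSnd (y : Plane) : ℝ :=
  (p 0 y * pd 1 u y - p 1 y * pd 0 u y) / (p 0 y * r 1 y - p 1 y * r 0 y)

variable {Z p r u} {y : Plane}

theorem pd_eq_deriv (hD : p 0 y * r 1 y - p 1 y * r 0 y ≠ 0) (a : Fin 2) :
    pd a u y = derivFst p r u y * p a y + derivSnd p r u y * r a y := by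
  have h1 : derivFst p r u y * (p 0 y * r 1 y - p 1 y * r 0 y) =
      pd 0 u y * r 1 y - pd 1 u y * r 0 y := div_mul_cancel₀ _ hD
  have h2 : derivSnd p r u y * (p 0 y * r 1 y - p 1 y * r 0 y) =
      p 0 y * pd 1 u y - p 1 y * pd 0 u y := div_mul_cancel₀ _ hD
  revert a
  rw [Fin.forall_fin_two]
  constructor <;> apply mul_left_cancel₀ hD
  · linear_combination -p 0 y * h1 - r 0 y * h2
  · linear_combination -p 1 y * h1 - r 1 y * h2

end Components

namespace IsCoframe

variable {G Z : Plane → Matrix (Fin 2) (Fin 2) ℝ} {p r : Fin 2 → Plane → ℝ} {U : Set Plane}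
  {u : Plane → ℝ} {y : Plane}

theorem smooth_area (h : IsCoframe G p r U) (hy : y ∈ U) :
    ContDiffAt ℝ ∞ (fun y => p 0 y * r 1 y - p 1 y * r 0 y) y :=
  ((h.smooth_fst 0 y hy).mul (h.smooth_snd 1 y hy)).sub
    ((h.smooth_fst 1 y hy).mul (h.smooth_snd 0 y hy))

theorem smooth_compDiag (h : IsCoframe G p r U) (hy : y ∈ U)
    (hZ : ∀ a b, ContDiffAt ℝ ∞ (fun w => Z w a b) y) : ContDiffAt ℝ ∞ (compDiag Z p r) y := by
  have hr := fun b => h.smooth_snd b y hy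
  have h00 := hZ 0 0
  have h01 := hZ 0 1
  have h11 := hZ 1 1
  unfold compDiag
  refine ContDiffAt.div ?_ ((h.smooth_area hy).pow 2) (pow_ne_zero 2 (h.area_ne_zero y hy))
  fun_prop

theorem smooth_compOff (h : IsCoframe G p r U) (hy : y ∈ U)
    (hZ : ∀ a b, ContDiffAt ℝ ∞ (fun w => Z w a b) y) : ContDiffAt ℝ ∞ (compOff Z p r) y := by
  have hp := fun b => h.smooth_fst b y hy
  have hr := fun b => h.smooth_snd b y hy
  have h00 := hZ 0 0
  have h01 := hZ 0 1
  have h11 := hZ 1 1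
  unfold compOff
  refine ContDiffAt.div ?_ ((h.smooth_area hy).pow 2) (pow_ne_zero 2 (h.area_ne_zero y hy))
  fun_prop

theorem smooth_derivFst (h : IsCoframe G p r U) (hy : y ∈ U) (hu : ContDiffAt ℝ ∞ u y) :
    ContDiffAt ℝ ∞ (derivFst p r u) y :=
  (((contDiffAt_pd hu 0).mul (h.smooth_snd 1 y hy)).sub
    ((contDiffAt_pd hu 1).mul (h.smooth_snd 0 y hy))).div (h.smooth_area hy) (h.area_ne_zero y hy)

theorem smooth_derivSnd (h : IsCoframe G p r U) (hy : y ∈ U) (hu : ContDiffAt ℝ ∞ u y) :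
    ContDiffAt ℝ ∞ (derivSnd p r u) y :=
  (((h.smooth_fst 0 y hy).mul (contDiffAt_pd hu 1)).sub
    ((h.smooth_fst 1 y hy).mul (contDiffAt_pd hu 0))).div (h.smooth_area hy) (h.area_ne_zero y hy)

theorem inv_apply (h : IsCoframe G p r U) (hy : y ∈ U) :
    (p 0 y * r 1 y - p 1 y * r 0 y) ^ 2 * (G y)⁻¹ 0 0 = G y 1 1 ∧
    (p 0 y * r 1 y - p 1 y * r 0 y) ^ 2 * (G y)⁻¹ 0 1 = -G y 0 1 ∧
    (p 0 y * r 1 y - p 1 y * r 0 y) ^ 2 * (G y)⁻¹ 1 0 = -G y 0 1 ∧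
    (p 0 y * r 1 y - p 1 y * r 0 y) ^ 2 * (G y)⁻¹ 1 1 = G y 0 0 := by
  have hD := pow_ne_zero 2 (h.area_ne_zero y hy)
  rw [Matrix.inv_def, Matrix.adjugate_fin_two, Ring.inverse_eq_inv', h.det_eq hy,
    h.symm y hy 0 1]
  simp [mul_inv_cancel_left₀ hD]

/-- A symmetric trace free tensor in terms of its frame components. -/
theorem eq_comp (h : IsCoframe G p r U) (hy : y ∈ U) (hs : Z y 1 0 = Z y 0 1)
    (htr : trace G Z y = 0) (a b : Fin 2) :
    Z y a b = compDiag Z p r y * (p a y * p b y - r a y * r b y)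
      + compOff Z p r y * (p a y * r b y + r a y * p b y) := by
  obtain ⟨i00, i01, i10, i11⟩ := h.inv_apply hy
  have hD := pow_ne_zero 2 (h.area_ne_zero y hy)
  have h1 : compDiag Z p r y * (p 0 y * r 1 y - p 1 y * r 0 y) ^ 2 = _ := div_mul_cancel₀ _ hD
  have h2 : compOff Z p r y * (p 0 y * r 1 y - p 1 y * r 0 y) ^ 2 = _ := div_mul_cancel₀ _ hD
  simp only [trace, Fin.sum_univ_two, hs] at htr
  rw [h.metric y hy] at i00 i01 i10 i11
  have ht : (p 1 y * p 1 y + r 1 y * r 1 y) * Z y 0 0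
      - 2 * (p 0 y * p 1 y + r 0 y * r 1 y) * Z y 0 1
      + (p 0 y * p 0 y + r 0 y * r 0 y) * Z y 1 1 = 0 := by
    linear_combination (p 0 y * r 1 y - p 1 y * r 0 y) ^ 2 * htr - Z y 0 0 * i00 - Z y 0 1 * i01
      - Z y 0 1 * i10 - Z y 1 1 * i11
  revert a b
  simp only [Fin.forall_fin_two, hs]
  refine ⟨⟨?_, ?_⟩, ?_, ?_⟩ <;> apply mul_left_cancel₀ hD
  · linear_combination -(p 0 y ^ 2 - r 0 y ^ 2) * h1 - 2 * p 0 y * r 0 y * h2 + r 0 y ^ 2 * ht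
  · linear_combination -(p 0 y * p 1 y - r 0 y * r 1 y) * h1
      - (p 0 y * r 1 y + r 0 y * p 1 y) * h2 + r 0 y * r 1 y * ht
  · linear_combination -(p 0 y * p 1 y - r 0 y * r 1 y) * h1
      - (p 0 y * r 1 y + r 0 y * p 1 y) * h2 + r 0 y * r 1 y * ht
  · linear_combination -(p 1 y ^ 2 - r 1 y ^ 2) * h1 - 2 * p 1 y * r 1 y * h2 + r 1 y ^ 2 * ht

/-- The equation `div Z = 0` for a trace free tensor in terms of frame components. -/
theorem div_comp (h : IsCoframe G p r U) (hy : y ∈ U) (hs : ∀ w ∈ U, Z w 1 0 = Z w 0 1)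
    (hZ : ∀ w ∈ U, ∀ a b, ContDiffAt ℝ ∞ (fun w => Z w a b) w)
    (htr : ∀ w ∈ U, trace G Z w = 0) (hdiv : ∀ a, divergence G Z a y = 0) :
    let σ := fun c => pd c (compDiag Z p r) y - 2 * compOff Z p r y * connForm G p r c y
    let τ := fun c => pd c (compOff Z p r) y + 2 * compDiag Z p r y * connForm G p r c y
    (σ 0 * p 1 y - σ 1 * p 0 y) + (τ 0 * r 1 y - τ 1 * r 0 y) = 0 ∧
    (σ 0 * r 1 y - σ 1 * r 0 y) - (τ 0 * p 1 y - τ 1 * p 0 y) = 0 := by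
  intro σ τ
  have hp : ∀ b, DifferentiableAt ℝ (p b) y := fun b =>
    (h.smooth_fst b y hy).differentiableAt (by simp)
  have hr : ∀ b, DifferentiableAt ℝ (r b) y := fun b =>
    (h.smooth_snd b y hy).differentiableAt (by simp)
  have hα : DifferentiableAt ℝ (compDiag Z p r) y :=
    (h.smooth_compDiag hy (hZ y hy)).differentiableAt (by simp)
  have hβ : DifferentiableAt ℝ (compOff Z p r) y :=
    (h.smooth_compOff hy (hZ y hy)).differentiableAt (by simp)
  -- A trace free symmetric tensor rotates by twice the angle of the frame, whence the terms `2ω` in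
  -- `σ` and `τ`.
  have hcov : ∀ a b c, covDeriv G Z a b c y = σ c * (p a y * p b y - r a y * r b y)
      + τ c * (p a y * r b y + r a y * p b y) := by
    intro a b c
    have e1 := (h.eventually hy fun w hw => h.eq_comp hw (hs w hw) (htr w hw) a b)
    unfold covDeriv
    rw [pd_congr e1 c, pd_add (by fun_prop) (by fun_prop), pd_mul hα (by fun_prop),
      pd_mul hβ (by fun_prop), pd_sub (by fun_prop) (by fun_prop),
      pd_add (by fun_prop) (by fun_prop), pd_mul (hp a) (hp b), pd_mul (hr a) (hr b),
      pd_mul (hp a) (hr b), pd_mul (hr a) (hp b)]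
    simp only [h.eq_comp hy (hs y hy) (htr y hy), fun a b => (h.conn hy a b).1,
      fun a b => (h.conn hy a b).2, Fin.sum_univ_two, σ, τ]
    ring
  obtain ⟨i00, i01, i10, i11⟩ := h.inv_apply hy
  have hD := h.area_ne_zero y hy
  -- The two coefficients here are, up to sign and an interchange of `p` and `r`, those of the
  -- exterior covariant derivative of `Z`. For trace free symmetric tensors on a surface, being
  -- divergence free is therefore the same as being Codazzi.
  have key : ∀ a, ((σ 0 * r 1 y - σ 1 * r 0 y) - (τ 0 * p 1 y - τ 1 * p 0 y)) * p a y +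
      ((σ 0 * p 1 y - σ 1 * p 0 y) + (τ 0 * r 1 y - τ 1 * r 0 y)) * r a y = 0 := by
    intro a
    have e := hdiv a
    rw [h.metric y hy] at i00 i01 i10 i11
    simp only [divergence, Fin.sum_univ_two] at e
    apply mul_left_cancel₀ hD
    linear_combination (p 0 y * r 1 y - p 1 y * r 0 y) ^ 2 * e - covDeriv G Z a 0 0 y * i00
      - covDeriv G Z a 0 1 y * i01 - covDeriv G Z a 1 0 y * i10 - covDeriv G Z a 1 1 y * i11
      - (p 1 y * p 1 y + r 1 y * r 1 y) * hcov a 0 0 + (p 0 y * p 1 y + r 0 y * r 1 y) *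
      (hcov a 0 1 + hcov a 1 0) - (p 0 y * p 0 y + r 0 y * r 0 y) * hcov a 1 1
  constructor <;> apply mul_left_cancel₀ hD
  · linear_combination p 0 y * key 1 - p 1 y * key 0
  · linear_combination r 1 y * key 0 - r 0 y * key 1

/-- The Hessian in terms of frame components. -/
theorem hessian_comp (h : IsCoframe G p r U) (hy : y ∈ U)
    (hu : ∀ w ∈ U, ContDiffAt ℝ ∞ u w) (a b : Fin 2) :
    hessian G u a b y =
      (pd a (derivFst p r u) y - derivSnd p r u y * connForm G p r a y) * p b y
      + (pd a (derivSnd p r u) y + derivFst p r u y * connForm G p r a y) * r b y := by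
  have hp : ∀ b, DifferentiableAt ℝ (p b) y := fun b =>
    (h.smooth_fst b y hy).differentiableAt (by simp)
  have hr : ∀ b, DifferentiableAt ℝ (r b) y := fun b =>
    (h.smooth_snd b y hy).differentiableAt (by simp)
  have h1 : DifferentiableAt ℝ (derivFst p r u) y :=
    (h.smooth_derivFst hy (hu y hy)).differentiableAt (by simp)
  have h2 : DifferentiableAt ℝ (derivSnd p r u) y :=
    (h.smooth_derivSnd hy (hu y hy)).differentiableAt (by simp)
  unfold hessian
  rw [pd_congr (h.eventually hy fun w hw => pd_eq_deriv (h.area_ne_zero w hw) b) a,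
    pd_add (by fun_prop) (by fun_prop), pd_mul h1 (hp b), pd_mul h2 (hr b)]
  simp only [pd_eq_deriv (u := u) (h.area_ne_zero y hy), fun a b => (h.conn hy a b).1,
    fun a b => (h.conn hy a b).2, Fin.sum_univ_two]
  ring

/-- The Codazzi equation: if `2 Z - 2 Hess u + u G` is diagonal in the coframe, with eigenvalues
`l` and `m`, then `dl ∧ p = (m - l) ω ∧ r` and `dm ∧ r = (m - l) ω ∧ p`. -/
theorem codazzi (h : IsCoframe G p r U) (hs : ∀ w ∈ U, Z w 1 0 = Z w 0 1)
    (hZ : ∀ w ∈ U, ∀ a b, ContDiffAt ℝ ∞ (fun w => Z w a b) w)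
    (htr : ∀ w ∈ U, trace G Z w = 0) (hdiv : ∀ w ∈ U, ∀ a, divergence G Z a w = 0)
    (hR : ∀ w ∈ U, scalarCurvature G w = -1)
    (hu : ∀ w ∈ U, ContDiffAt ℝ ∞ u w) {l m : Plane → ℝ}
    (hl : ∀ w ∈ U, DifferentiableAt ℝ l w) (hm : ∀ w ∈ U, DifferentiableAt ℝ m w)
    (hS : ∀ w ∈ U, ∀ a b, 2 * Z w a b - 2 * hessian G u a b w + u w * G w a b =
      l w * (p a w * p b w) + m w * (r a w * r b w)) (hy : y ∈ U) :
    pd 0 l y * p 1 y - pd 1 l y * p 0 y =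
      (m y - l y) * (connForm G p r 0 y * r 1 y - connForm G p r 1 y * r 0 y) ∧
    pd 0 m y * r 1 y - pd 1 m y * r 0 y =
      (m y - l y) * (connForm G p r 0 y * p 1 y - connForm G p r 1 y * p 0 y) := by
  have hp : ∀ b, DifferentiableAt ℝ (p b) y := fun b =>
    (h.smooth_fst b y hy).differentiableAt (by simp)
  have hr : ∀ b, DifferentiableAt ℝ (r b) y := fun b =>
    (h.smooth_snd b y hy).differentiableAt (by simp)
  have hα : DifferentiableAt ℝ (compDiag Z p r) y :=
    (h.smooth_compDiag hy (hZ y hy)).differentiableAt (by simp)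
  have hβ : DifferentiableAt ℝ (compOff Z p r) y :=
    (h.smooth_compOff hy (hZ y hy)).differentiableAt (by simp)
  have h1 := h.smooth_derivFst hy (hu y hy)
  have h2 := h.smooth_derivSnd hy (hu y hy)
  have h1d : DifferentiableAt ℝ (derivFst p r u) y := h1.differentiableAt (by simp)
  have h2d : DifferentiableAt ℝ (derivSnd p r u) y := h2.differentiableAt (by simp)
  have hω : ∀ a, DifferentiableAt ℝ (connForm G p r a) y := fun a =>
    (h.smooth_connForm hy a).differentiableAt (by simp)
  have hud : DifferentiableAt ℝ u y := (hu y hy).differentiableAt (by simp)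
  have hld := hl y hy
  have hmd := hm y hy
  -- The diagonal form is solved for the derivatives of the frame components of `du`. The Codazzi
  -- equations are the integrability conditions of this first order system.
  have hco : ∀ w ∈ U, ∀ a, (pd a (derivFst p r u) w = derivSnd p r u w * connForm G p r a w
        + (compDiag Z p r w + 1 / 2 * u w - 1 / 2 * l w) * p a w + compOff Z p r w * r a w) ∧
      (pd a (derivSnd p r u) w = -(derivFst p r u w * connForm G p r a w)
        + (1 / 2 * u w - compDiag Z p r w - 1 / 2 * m w) * r a w
        + compOff Z p r w * p a w) := by
    intro w hw a
    have hD := h.area_ne_zero w hw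
    have e0 := hS w hw a 0
    have e1 := hS w hw a 1
    simp only [h.hessian_comp hw hu, h.eq_comp hw (hs w hw) (htr w hw), h.metric w hw] at e0 e1
    constructor <;> apply mul_left_cancel₀ hD
    · linear_combination -1 / 2 * r 1 w * e0 + 1 / 2 * r 0 w * e1
    · linear_combination 1 / 2 * p 1 w * e0 - 1 / 2 * p 0 w * e1
  have e1 : ∀ c a, pd c (pd a (derivFst p r u)) y =
      pd c (derivSnd p r u) y * connForm G p r a y + derivSnd p r u y * pd c (connForm G p r a) y
      + ((pd c (compDiag Z p r) y + 1 / 2 * pd c u y - 1 / 2 * pd c l y) * p a y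
        + (compDiag Z p r y + 1 / 2 * u y - 1 / 2 * l y) * pd c (p a) y)
      + (pd c (compOff Z p r) y * r a y + compOff Z p r y * pd c (r a) y) := by
    intro c a
    rw [pd_congr (h.eventually hy fun w hw => (hco w hw a).1) c,
      pd_add (by fun_prop) (by fun_prop), pd_add (by fun_prop) (by fun_prop),
      pd_mul h2d (hω a), pd_mul (by fun_prop) (hp a), pd_mul hβ (hr a),
      pd_sub (by fun_prop) (by fun_prop), pd_add (by fun_prop) (by fun_prop),
      pd_const_mul hud, pd_const_mul hld]
  have e2 : ∀ c a, pd c (pd a (derivSnd p r u)) y =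
      -(pd c (derivFst p r u) y * connForm G p r a y + derivFst p r u y * pd c (connForm G p r a) y)
      + ((1 / 2 * pd c u y - pd c (compDiag Z p r) y - 1 / 2 * pd c m y) * r a y
        + (1 / 2 * u y - compDiag Z p r y - 1 / 2 * m y) * pd c (r a) y)
      + (pd c (compOff Z p r) y * p a y + compOff Z p r y * pd c (p a) y) := by
    intro c a
    rw [pd_congr (h.eventually hy fun w hw => (hco w hw a).2) c,
      pd_add (by fun_prop) (by fun_prop), pd_add (by fun_prop) (by fun_prop),
      pd_neg, pd_mul h1d (hω a), pd_mul (by fun_prop) (hr a), pd_mul hβ (hp a),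
      pd_sub (by fun_prop) (by fun_prop), pd_sub (by fun_prop) (by fun_prop),
      pd_const_mul hud, pd_const_mul hmd]
  obtain ⟨t1, t2⟩ := h.div_comp hy hs hZ htr (hdiv y hy)
  have dp := h.d_fst hy
  have dr := h.d_snd hy
  have dω := h.d_connForm hy (hR y hy)
  have c1 := pd_comm h1 0 1
  have c2 := pd_comm h2 0 1
  rw [e1, e1] at c1
  rw [e2, e2] at c2
  have hu' := fun a => pd_eq_deriv (u := u) (h.area_ne_zero y hy) a
  have hc := hco y hy
  simp only [hu', fun a => (hc a).1, fun a => (hc a).2] at c1 c2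
  -- The term with `dω = ½ p ∧ r` cancels the derivative of `½ u` (here the value `-1` of the
  -- curvature matters), and `t1`, `t2` remove the derivatives of `Z`.
  constructor
  · linear_combination -2 * c1 + 2 * derivSnd p r u y * dω
      + (2 * compDiag Z p r y + u y - l y) * dp + 2 * compOff Z p r y * dr + 2 * t1
  · linear_combination -2 * c2 - 2 * derivFst p r u y * dω
      + (u y - 2 * compDiag Z p r y - m y) * dr + 2 * compOff Z p r y * dp - 2 * t2

end IsCoframe

/-! ### The gradient estimate for the sinh-Gordon equation in a flat frame -/

/-- The second derivative test at a local maximum. -/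
theorem second_deriv_nonpos_of_isLocalMax {F : Plane → ℝ} {y : Plane}
    (hF : ∀ᶠ w in nhds y, ContDiffAt ℝ ∞ F w) (hmax : IsLocalMax F y) (v : Fin 2 → ℝ) :
    ∑ a, ∑ b, v a * v b * pd b (pd a F) y ≤ 0 := by
  set V : Plane := WithLp.toLp 2 v with hV
  set γ : ℝ → Plane := fun s => y + s • V with hγ
  have hγ0 : γ 0 = y := by simp [hγ]
  have hγd : ∀ s, HasDerivAt γ V s := fun s => by
    have := ((hasDerivAt_id s).smul_const V).const_add y
    rw [one_smul] at this
    exact this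
  have hγc : ContinuousAt γ 0 := (hγd 0).continuousAt
  have hd : ∀ {f : Plane → ℝ} {s : ℝ}, DifferentiableAt ℝ f (γ s) →
      HasDerivAt (fun s => f (γ s)) (∑ a, v a * pd a f (γ s)) s := by
    intro f s hf
    have := hf.hasFDerivAt.comp_hasDerivAt s (hγd s)
    rw [fderiv_eq_sum_pd] at this
    exact this
  have hF0 : ∀ᶠ s in nhds (0 : ℝ), ContDiffAt ℝ ∞ F (γ s) := by
    apply hγc.eventually
    rwa [hγ0]
  have h1 : deriv (fun s => F (γ s)) =ᶠ[nhds 0] fun s => ∑ a, v a * pd a F (γ s) :=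
    hF0.mono fun s hs => (hd (hs.differentiableAt (by simp))).deriv
  have hFy := hF.self_of_nhds
  have h2 : deriv (deriv fun s => F (γ s)) 0 = ∑ a, ∑ b, v a * v b * pd b (pd a F) y := by
    rw [h1.deriv_eq]
    have h3 : ∀ a, HasDerivAt (fun s => v a * pd a F (γ s))
        (v a * ∑ b, v b * pd b (pd a F) (γ 0)) 0 := fun a =>
      (hd (by rw [hγ0]; exact (contDiffAt_pd hFy a).differentiableAt (by simp))).const_mul (v a)
    have h4 := (HasDerivAt.fun_sum (u := Finset.univ) fun a _ => h3 a).deriv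
    rw [h4, hγ0]
    simp only [Finset.mul_sum, mul_assoc]
  have hmax' : IsLocalMax (fun s => F (γ s)) 0 := by
    have : ∀ᶠ w in nhds (γ 0), F w ≤ F y := by rw [hγ0]; exact hmax
    have h := hγc.eventually this
    rw [← hγ0] at h
    exact h
  by_contra hcon
  rw [not_le, ← h2] at hcon
  have hcont : ContinuousAt (fun s => F (γ s)) 0 := by
    apply ContinuousAt.comp _ hγc
    rw [hγ0]
    exact hFy.continuousAt
  -- A positive second derivative would make the point a local minimum along the line as well, so
  -- the function would be locally constant there.
  have hmin := isLocalMin_of_deriv_deriv_pos hcon hmax'.deriv_eq_zero hcont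
  have hconst : (fun s => F (γ s)) =ᶠ[nhds 0] fun _ => F (γ 0) := by
    filter_upwards [hmin, hmax'] with s h1 h2
    exact le_antisymm h2 h1
  have : deriv (deriv fun s => F (γ s)) 0 = 0 := by
    rw [hconst.deriv.deriv_eq]
    simp
  linarith

/-- A first order differential operator without zeroth order term. -/
def IsDerivation (D : (Plane → ℝ) → Plane → ℝ) (y : Plane) : Prop :=
  ∃ c : Fin 2 → ℝ, ∀ f, D f y = ∑ a, c a * pd a f y

theorem isDerivation_derivFst (p r : Fin 2 → Plane → ℝ) (y : Plane) :
    IsDerivation (derivFst p r) y :=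
  ⟨![r 1 y / (p 0 y * r 1 y - p 1 y * r 0 y), -r 0 y / (p 0 y * r 1 y - p 1 y * r 0 y)], fun f => by
    simp [derivFst]; ring⟩

theorem isDerivation_derivSnd (p r : Fin 2 → Plane → ℝ) (y : Plane) :
    IsDerivation (derivSnd p r) y :=
  ⟨![-p 1 y / (p 0 y * r 1 y - p 1 y * r 0 y), p 0 y / (p 0 y * r 1 y - p 1 y * r 0 y)], fun f => by
    simp [derivSnd]; ring⟩

namespace IsDerivation

variable {D : (Plane → ℝ) → Plane → ℝ} {y : Plane} {f g : Plane → ℝ}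

theorem congr (hD : IsDerivation D y) (h : f =ᶠ[nhds y] g) : D f y = D g y := by
  obtain ⟨c, hc⟩ := hD
  simp only [hc, pd_congr h]

theorem add (hD : IsDerivation D y) (hf : DifferentiableAt ℝ f y) (hg : DifferentiableAt ℝ g y) :
    D (fun w => f w + g w) y = D f y + D g y := by
  obtain ⟨c, hc⟩ := hD
  simp only [hc, pd_add hf hg, Fin.sum_univ_two]
  ring

theorem sub (hD : IsDerivation D y) (hf : DifferentiableAt ℝ f y) (hg : DifferentiableAt ℝ g y) :
    D (fun w => f w - g w) y = D f y - D g y := by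
  obtain ⟨c, hc⟩ := hD
  simp only [hc, pd_sub hf hg, Fin.sum_univ_two]
  ring

theorem mul (hD : IsDerivation D y) (hf : DifferentiableAt ℝ f y) (hg : DifferentiableAt ℝ g y) :
    D (fun w => f w * g w) y = D f y * g y + f y * D g y := by
  obtain ⟨c, hc⟩ := hD
  simp only [hc, pd_mul hf hg, Fin.sum_univ_two]
  ring

theorem comp (hD : IsDerivation D y) {φ : ℝ → ℝ} {φ' : ℝ} (hφ : HasDerivAt φ φ' (f y))
    (hf : DifferentiableAt ℝ f y) : D (fun w => φ (f w)) y = φ' * D f y := by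
  obtain ⟨c, hc⟩ := hD
  simp only [hc, pd_comp hφ hf, Fin.sum_univ_two]
  ring

theorem eq_zero_of_isLocalMax (hD : IsDerivation D y) (h : IsLocalMax f y) : D f y = 0 := by
  obtain ⟨c, hc⟩ := hD
  simp [hc, pd, h.fderiv_eq_zero]

end IsDerivation

/-- A coframe consisting of closed forms. -/
structure IsFlatCoframe (p r : Fin 2 → Plane → ℝ) (U : Set Plane) : Prop where
  isOpen : IsOpen U
  smooth_fst : ∀ b, ∀ y ∈ U, ContDiffAt ℝ ∞ (p b) y
  smooth_snd : ∀ b, ∀ y ∈ U, ContDiffAt ℝ ∞ (r b) y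
  area_ne_zero : ∀ y ∈ U, p 0 y * r 1 y - p 1 y * r 0 y ≠ 0
  closed_fst : ∀ y ∈ U, pd 0 (p 1) y = pd 1 (p 0) y
  closed_snd : ∀ y ∈ U, pd 0 (r 1) y = pd 1 (r 0) y

namespace IsFlatCoframe

variable {p r : Fin 2 → Plane → ℝ} {U : Set Plane} {u w F : Plane → ℝ} {y : Plane}

theorem eventually (h : IsFlatCoframe p r U) (hy : y ∈ U) {P : Plane → Prop}
    (hP : ∀ w ∈ U, P w) : ∀ᶠ w in nhds y, P w :=
  Filter.mem_of_superset (h.isOpen.mem_nhds hy) hP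

/-- The underlying coframe is orthonormal for the flat metric it defines. -/
theorem isCoframe (h : IsFlatCoframe p r U) :
    IsCoframe (fun y => Matrix.of fun a b => p a y * p b y + r a y * r b y) p r U :=
  ⟨h.isOpen, h.smooth_fst, h.smooth_snd, fun _ _ _ _ => rfl, h.area_ne_zero⟩

/-- The frame dual to a closed coframe commutes, so its derivatives behave like partial derivatives
in flat coordinates. -/
theorem comm (h : IsFlatCoframe p r U) (hu : ∀ z ∈ U, ContDiffAt ℝ ∞ u z) (hy : y ∈ U) :
    derivFst p r (derivSnd p r u) y = derivSnd p r (derivFst p r u) y := by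
  have hD := h.area_ne_zero y hy
  have hp : ∀ b, DifferentiableAt ℝ (p b) y := fun b =>
    (h.smooth_fst b y hy).differentiableAt (by simp)
  have hr : ∀ b, DifferentiableAt ℝ (r b) y := fun b =>
    (h.smooth_snd b y hy).differentiableAt (by simp)
  have h1 : DifferentiableAt ℝ (derivFst p r u) y :=
    (h.isCoframe.smooth_derivFst hy (hu y hy)).differentiableAt (by simp)
  have h2 : DifferentiableAt ℝ (derivSnd p r u) y :=
    (h.isCoframe.smooth_derivSnd hy (hu y hy)).differentiableAt (by simp)
  have e : ∀ a b, pd a (pd b u) y = pd a (derivFst p r u) y * p b y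
      + derivFst p r u y * pd a (p b) y + (pd a (derivSnd p r u) y * r b y
      + derivSnd p r u y * pd a (r b) y) := by
    intro a b
    rw [pd_congr (h.eventually hy fun z hz => pd_eq_deriv (h.area_ne_zero z hz) b) a,
      pd_add (by fun_prop) (by fun_prop), pd_mul h1 (hp b), pd_mul h2 (hr b)]
  have c := pd_comm (hu y hy) 0 1
  rw [e, e] at c
  simp only [pd_eq_deriv (u := derivFst p r u) hD, pd_eq_deriv (u := derivSnd p r u) hD] at c
  apply mul_left_cancel₀ hD
  linear_combination c - derivFst p r u y * h.closed_fst y hy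
    - derivSnd p r u y * h.closed_snd y hy

/-- At a critical point the derivatives of the frame coefficients multiply `dF = 0`, so the iterated
frame derivative is the second derivative in a fixed direction. -/
theorem second_deriv_fst_nonpos (h : IsFlatCoframe p r U) (hF : ∀ z ∈ U, ContDiffAt ℝ ∞ F z)
    (hy : y ∈ U) (hmax : IsLocalMax F y) : derivFst p r (derivFst p r F) y ≤ 0 := by
  have hz : ∀ a, pd a F y = 0 := fun a => by simp [pd, hmax.fderiv_eq_zero]
  have hq : ∀ b, DifferentiableAt ℝ
      (fun y => r b y / (p 0 y * r 1 y - p 1 y * r 0 y)) y := fun b =>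
    ((h.smooth_snd b y hy).div (h.isCoframe.smooth_area hy)
      (h.area_ne_zero y hy)).differentiableAt (by simp)
  have hFd : ∀ b, DifferentiableAt ℝ (pd b F) y := fun b =>
    (contDiffAt_pd (hF y hy) b).differentiableAt (by simp)
  have e : ∀ a, pd a (derivFst p r F) y =
      r 1 y / (p 0 y * r 1 y - p 1 y * r 0 y) * pd a (pd 0 F) y
      - r 0 y / (p 0 y * r 1 y - p 1 y * r 0 y) * pd a (pd 1 F) y := by
    intro a
    have : derivFst p r F = fun y => r 1 y / (p 0 y * r 1 y - p 1 y * r 0 y) * pd 0 F y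
      - r 0 y / (p 0 y * r 1 y - p 1 y * r 0 y) * pd 1 F y := by
      funext z; simp only [derivFst]; ring
    rw [this, pd_sub ((hq 1).fun_mul (hFd 0)) ((hq 0).fun_mul (hFd 1)), pd_mul (hq 1) (hFd 0),
      pd_mul (hq 0) (hFd 1), hz, hz]
    ring
  have key := second_deriv_nonpos_of_isLocalMax (h.eventually hy hF) hmax
    ![r 1 y / (p 0 y * r 1 y - p 1 y * r 0 y), -(r 0 y / (p 0 y * r 1 y - p 1 y * r 0 y))]
  refine le_of_eq_of_le ?_ key
  rw [derivFst, e, e]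
  simp only [Fin.sum_univ_two, Matrix.cons_val_zero, Matrix.cons_val_one]
  ring

theorem second_deriv_snd_nonpos (h : IsFlatCoframe p r U) (hF : ∀ z ∈ U, ContDiffAt ℝ ∞ F z)
    (hy : y ∈ U) (hmax : IsLocalMax F y) : derivSnd p r (derivSnd p r F) y ≤ 0 := by
  have hs : IsFlatCoframe r p U := ⟨h.isOpen, h.smooth_snd, h.smooth_fst,
    fun z hz h0 => h.area_ne_zero z hz (by linear_combination -h0), h.closed_snd, h.closed_fst⟩
  -- Interchanging the two forms changes the sign of both the numerator and the area.
  have he : derivSnd p r = derivFst r p := by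
    funext f z
    simp only [derivFst, derivSnd]
    rw [← neg_div_neg_eq]
    congr 1 <;> ring
  rw [he]
  exact hs.second_deriv_fst_nonpos hF hy hmax

end IsFlatCoframe

/-- Here `(A, B)` stands for `∇w`, the entries `a`, `b`, `c` for its Hessian, `s` for the Laplacian,
and `l`, `l'` for the first and second derivatives of the logarithm of the weight. With `N = |∇w|²`,
the critical point equations say that `∇w` is an eigenvector of the Hessian with eigenvalue `-lN/2`;
the other eigenvalue is then `s + lN/2`. Substituting, all multiples of `l² N²` in `hL` cancel. -/
theorem hessian_norm_le {A B a b c s l l' C : ℝ} (hN : 0 < A ^ 2 + B ^ 2) (hs : a + c = s)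
    (h1 : l * A * (A ^ 2 + B ^ 2) + 2 * (A * a + B * b) = 0)
    (h2 : l * B * (A ^ 2 + B ^ 2) + 2 * (A * b + B * c) = 0)
    (hL : (l' + l ^ 2) * (A ^ 2 + B ^ 2) ^ 2 + l * s * (A ^ 2 + B ^ 2)
      + 2 * l * (A * (2 * A * a + 2 * B * b) + B * (2 * A * b + 2 * B * c))
      + 2 * (a ^ 2 + 2 * b ^ 2 + c ^ 2) + 2 * C * (A ^ 2 + B ^ 2) ≤ 0) :
    l' * (A ^ 2 + B ^ 2) ^ 2 + (3 * l * s + 2 * C) * (A ^ 2 + B ^ 2) + 2 * s ^ 2 ≤ 0 := by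
  set N := A ^ 2 + B ^ 2 with hNdef
  -- The eigenvalue `-lN/2` enters through its characteristic equation, which eliminates `b²`.
  have hdet : (a + l * N / 2) * (c + l * N / 2) - b ^ 2 = 0 := by
    apply mul_left_cancel₀ hN.ne'
    rw [hNdef]
    linear_combination (A * (c + l * N / 2) - B * b) / 2 * h1 +
      (B * (a + l * N / 2) - A * b) / 2 * h2
  have h3 : A * (2 * A * a + 2 * B * b) + B * (2 * A * b + 2 * B * c) = -l * N ^ 2 := by
    rw [hNdef]
    linear_combination A * h1 + B * h2
  rw [h3] at hL
  have hc : c = s - a := by linarith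
  subst hc
  linarith [hL, hdet]

/-- The weight relating `|∇_g log B|²` and the squared gradient of a sinh-Gordon potential. -/
def weight (x : ℝ) : ℝ := Real.exp x / (Real.sinh x * Real.cosh x) ^ 2

/-- The logarithmic derivative of the weight. -/
def logWeightDeriv (x : ℝ) : ℝ :=
  1 - 2 * (Real.cosh x / Real.sinh x) - 2 * (Real.sinh x / Real.cosh x)

theorem hasDerivAt_weight {x : ℝ} (hx : x ≠ 0) :
    HasDerivAt weight (weight x * logWeightDeriv x) x := by
  have hs : Real.sinh x ≠ 0 := Real.sinh_eq_zero.not.mpr hx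
  have hc : Real.cosh x ≠ 0 := (Real.cosh_pos x).ne'
  have h := (Real.hasDerivAt_exp x).div
    (((Real.hasDerivAt_sinh x).mul (Real.hasDerivAt_cosh x)).pow 2)
    (pow_ne_zero 2 (mul_ne_zero hs hc))
  refine h.congr_deriv ?_
  simp only [weight, logWeightDeriv, Pi.mul_apply, Pi.pow_apply]
  field_simp
  ring

theorem hasDerivAt_logWeightDeriv {x : ℝ} (hx : x ≠ 0) :
    HasDerivAt logWeightDeriv (2 / (Real.sinh x * Real.cosh x) ^ 2) x := by
  have hs : Real.sinh x ≠ 0 := Real.sinh_eq_zero.not.mpr hx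
  have hc : Real.cosh x ≠ 0 := (Real.cosh_pos x).ne'
  have h := ((((Real.hasDerivAt_cosh x).div (Real.hasDerivAt_sinh x) hs).const_mul 2).const_sub
    1).sub (((Real.hasDerivAt_sinh x).div (Real.hasDerivAt_cosh x) hc).const_mul 2)
  refine h.congr_deriv ?_
  have h2 := Real.cosh_sq x
  field_simp
  rw [h2]
  ring

theorem contDiffAt_weight {x : ℝ} (hx : x ≠ 0) : ContDiffAt ℝ ∞ weight x := by
  have hs : Real.sinh x ≠ 0 := Real.sinh_eq_zero.not.mpr hx
  have hc : Real.cosh x ≠ 0 := (Real.cosh_pos x).ne'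
  exact Real.contDiff_exp.contDiffAt.div
    ((Real.contDiff_sinh.contDiffAt.mul Real.contDiff_cosh.contDiffAt).pow 2)
    (pow_ne_zero 2 (mul_ne_zero hs hc))

/-! ### First and second frame derivatives of the weighted squared gradient -/

section WeightedProduct

variable {D : (Plane → ℝ) → Plane → ℝ} {y : Plane} {w A B : Plane → ℝ}

theorem deriv_weighted (hD : IsDerivation D y) (hw0 : w y ≠ 0) (hw : DifferentiableAt ℝ w y)
    (hA : DifferentiableAt ℝ A y) (hB : DifferentiableAt ℝ B y) :
    D (fun z => weight (w z) * (A z * A z + B z * B z)) y =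
      weight (w y) * (logWeightDeriv (w y) * (D w y * (A y * A y + B y * B y))
        + 2 * (A y * D A y + B y * D B y)) := by
  have h1 : DifferentiableAt ℝ (fun z => weight (w z)) y :=
    (hasDerivAt_weight hw0).differentiableAt.comp y hw
  rw [hD.mul h1 (by fun_prop), hD.comp (hasDerivAt_weight hw0) hw,
    hD.add (by fun_prop) (by fun_prop), hD.mul hA hA, hD.mul hB hB]
  ring

theorem deriv_deriv_weighted (hD : ∀ᶠ z in nhds y, IsDerivation D z)
    (hw0 : ∀ᶠ z in nhds y, w z ≠ 0) (hw : ∀ᶠ z in nhds y, DifferentiableAt ℝ w z)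
    (hA : ∀ᶠ z in nhds y, DifferentiableAt ℝ A z) (hB : ∀ᶠ z in nhds y, DifferentiableAt ℝ B z)
    (hDw : DifferentiableAt ℝ (D w) y) (hDA : DifferentiableAt ℝ (D A) y)
    (hDB : DifferentiableAt ℝ (D B) y) :
    D (D fun z => weight (w z) * (A z * A z + B z * B z)) y =
      weight (w y) * ((2 / (Real.sinh (w y) * Real.cosh (w y)) ^ 2 + logWeightDeriv (w y) ^ 2) *
          (D w y ^ 2 * (A y ^ 2 + B y ^ 2))
        + logWeightDeriv (w y) * (D (D w) y * (A y ^ 2 + B y ^ 2))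
        + 2 * logWeightDeriv (w y) * (D w y * (2 * A y * D A y + 2 * B y * D B y))
        + 2 * (D A y ^ 2 + A y * D (D A) y + D B y ^ 2 + B y * D (D B) y)) := by
  have hDy := hD.self_of_nhds
  have e : (D fun z => weight (w z) * (A z * A z + B z * B z)) =ᶠ[nhds y] fun z =>
      weight (w z) * (logWeightDeriv (w z) * (D w z * (A z * A z + B z * B z))
        + 2 * (A z * D A z + B z * D B z)) := by
    filter_upwards [hD, hw0, hw, hA, hB] with z h1 h2 h3 h4 h5 using deriv_weighted h1 h2 h3 h4 h5
  have hw0y := hw0.self_of_nhds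
  have hwy := hw.self_of_nhds
  have hAy := hA.self_of_nhds
  have hBy := hB.self_of_nhds
  have h1 : DifferentiableAt ℝ (fun z => weight (w z)) y :=
    (hasDerivAt_weight hw0y).differentiableAt.comp y hwy
  have h2 : DifferentiableAt ℝ (fun z => logWeightDeriv (w z)) y :=
    (hasDerivAt_logWeightDeriv hw0y).differentiableAt.comp y hwy
  have h3 : D (fun z => 2 * (A z * D A z + B z * D B z)) y =
      2 * (D A y * D A y + A y * D (D A) y + (D B y * D B y + B y * D (D B) y)) := by
    obtain ⟨c, hc⟩ := hDy
    have : ∀ f : Plane → ℝ, DifferentiableAt ℝ f y → D (fun z => 2 * f z) y = 2 * D f y := by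
      intro f hf
      simp only [hc, pd_const_mul hf, Fin.sum_univ_two]
      ring
    rw [this _ (by fun_prop), hD.self_of_nhds.add (by fun_prop) (by fun_prop),
      hD.self_of_nhds.mul hAy hDA, hD.self_of_nhds.mul hBy hDB]
  rw [hDy.congr e, hDy.mul h1 (by fun_prop), hDy.comp (hasDerivAt_weight hw0y) hwy,
    hDy.add (by fun_prop) (by fun_prop), h3, hDy.mul h2 (by fun_prop),
    hDy.comp (hasDerivAt_logWeightDeriv hw0y) hwy, hDy.mul hDw (by fun_prop),
    hDy.add (by fun_prop) (by fun_prop), hDy.mul hAy hAy, hDy.mul hBy hBy]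
  ring

end WeightedProduct

/-- For `q = N / (sinh x cosh x)²`, dropping `2 sinh² x` and dividing by `N` leaves `2q ≤ -3 sinh x
+ 4 cosh x + 6 sinh² x / cosh x ≤ 13 cosh x`. The weighted quantity is `e^x q`, and `e^x cosh x = (1
+ e^(2x))/2 ≤ 1` for negative `x`. This yields `13/2`; the constant `9` is a convenient square above
it. -/
theorem weight_mul_le {x N : ℝ} (hx : x < 0) (hN : 0 < N)
    (h : 2 / (Real.sinh x * Real.cosh x) ^ 2 * N ^ 2
      + (3 * logWeightDeriv x * Real.sinh x + 2 * Real.cosh x) * N + 2 * Real.sinh x ^ 2 ≤ 0) :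
    weight x * N ≤ 9 := by
  have hs : Real.sinh x < 0 := Real.sinh_neg_iff.mpr hx
  have hc : 0 < Real.cosh x := Real.cosh_pos x
  have hE : Real.exp x = Real.cosh x + Real.sinh x := (Real.cosh_add_sinh x).symm
  have hEp := Real.exp_pos x
  have h2 := Real.cosh_sq x
  rw [weight, hE] at *
  unfold logWeightDeriv at h
  set s := Real.sinh x
  set C := Real.cosh x
  set q := N / (s * C) ^ 2 with hq
  have e1 : 2 / (s * C) ^ 2 * N ^ 2 = 2 * q * N := by rw [hq]; ring
  have e2 : 3 * (1 - 2 * (C / s) - 2 * (s / C)) * s + 2 * C =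
      3 * s - 4 * C - 6 * (s ^ 2 / C) := by
    have hs' : s ≠ 0 := hs.ne
    field_simp
    ring
  rw [e1, e2] at h
  have h3 : (2 * q + (3 * s - 4 * C - 6 * (s ^ 2 / C))) * N ≤ 0 := by nlinarith [sq_nonneg s]
  have h4 : 2 * q ≤ -3 * s + 4 * C + 6 * (s ^ 2 / C) := by
    have := nonpos_of_mul_nonpos_left h3 hN
    linarith
  have h5 : s ^ 2 / C ≤ C := by
    rw [div_le_iff₀ hc]
    nlinarith
  have h6 : q ≤ 13 / 2 * C := by linarith
  have h7 : (C + s) / (s * C) ^ 2 * N = (C + s) * q := by rw [hq]; ring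
  rw [h7]
  calc (C + s) * q ≤ (C + s) * (13 / 2 * C) := mul_le_mul_of_nonneg_left h6 hEp.le
    _ ≤ 9 := by nlinarith

/-- The gradient estimate: in a flat frame, at a local maximum of the weighted squared gradient
of a negative solution of the sinh-Gordon equation. -/
theorem IsFlatCoframe.weighted_gradient_le {p r : Fin 2 → Plane → ℝ} {U : Set Plane}
    {w : Plane → ℝ} {y : Plane} (h : IsFlatCoframe p r U) (hw : ∀ z ∈ U, ContDiffAt ℝ ∞ w z)
    (hneg : ∀ z ∈ U, w z < 0)
    (heq : ∀ z ∈ U, derivFst p r (derivFst p r w) z + derivSnd p r (derivSnd p r w) z =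
      Real.sinh (w z)) (hy : y ∈ U)
    (hmax : IsLocalMax (fun z => weight (w z) * (derivFst p r w z * derivFst p r w z
      + derivSnd p r w z * derivSnd p r w z)) y) :
    weight (w y) * (derivFst p r w y * derivFst p r w y
      + derivSnd p r w y * derivSnd p r w y) ≤ 9 := by
  set A := derivFst p r w with hA
  set B := derivSnd p r w with hB
  have sfst : ∀ {f : Plane → ℝ}, (∀ z ∈ U, ContDiffAt ℝ ∞ f z) →
      ∀ z ∈ U, ContDiffAt ℝ ∞ (derivFst p r f) z := fun hf z hz =>
    h.isCoframe.smooth_derivFst hz (hf z hz)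
  have ssnd : ∀ {f : Plane → ℝ}, (∀ z ∈ U, ContDiffAt ℝ ∞ f z) →
      ∀ z ∈ U, ContDiffAt ℝ ∞ (derivSnd p r f) z := fun hf z hz =>
    h.isCoframe.smooth_derivSnd hz (hf z hz)
  have hd : ∀ {f : Plane → ℝ}, (∀ z ∈ U, ContDiffAt ℝ ∞ f z) →
      ∀ z ∈ U, DifferentiableAt ℝ f z := fun hf z hz => (hf z hz).differentiableAt (by simp)
  have sA := sfst hw
  have sB := ssnd hw
  rw [← hA] at sA
  rw [← hB] at sB
  have hF : ∀ z ∈ U, ContDiffAt ℝ ∞ (fun z => weight (w z) * (A z * A z + B z * B z)) z :=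
    fun z hz => ((contDiffAt_weight (hneg z hz).ne).comp z (hw z hz)).mul
      (((sA z hz).mul (sA z hz)).add ((sB z hz).mul (sB z hz)))
  -- If the gradient vanishes there is nothing to prove; otherwise its square may be divided out.
  rcases (add_nonneg (mul_self_nonneg (A y)) (mul_self_nonneg (B y))).eq_or_lt with h0 | hN
  · rw [← h0]; norm_num
  have D1 := isDerivation_derivFst p r y
  have D2 := isDerivation_derivSnd p r y
  have hwy := (hneg y hy).ne
  have hpos : 0 < weight (w y) := by
    have hs : Real.sinh (w y) ≠ 0 := Real.sinh_eq_zero.not.mpr hwy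
    have hc := Real.cosh_pos (w y)
    exact div_pos (Real.exp_pos _) (by positivity)
  have hcomm : derivFst p r B y = derivSnd p r A y := h.comm hw hy
  have hcomm' : derivSnd p r A =ᶠ[nhds y] derivFst p r B :=
    h.eventually hy fun z hz => (h.comm hw hz).symm
  have f1 := D1.eq_zero_of_isLocalMax hmax
  have f2 := D2.eq_zero_of_isLocalMax hmax
  rw [deriv_weighted D1 hwy (hd hw y hy) (hd sA y hy) (hd sB y hy), ← hA, hcomm] at f1
  rw [deriv_weighted D2 hwy (hd hw y hy) (hd sA y hy) (hd sB y hy), ← hB] at f2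
  have g1 := h.second_deriv_fst_nonpos hF hy hmax
  have g2 := h.second_deriv_snd_nonpos hF hy hmax
  have ev : ∀ {f : Plane → ℝ}, (∀ z ∈ U, ContDiffAt ℝ ∞ f z) →
      ∀ᶠ z in nhds y, DifferentiableAt ℝ f z := fun hf => h.eventually hy (hd hf)
  have e0 : ∀ᶠ z in nhds y, w z ≠ 0 := h.eventually hy fun z hz => (hneg z hz).ne
  rw [deriv_deriv_weighted (Filter.Eventually.of_forall fun z => isDerivation_derivFst p r z)
    e0 (ev hw) (ev sA) (ev sB) (hd sA y hy) (hd (sfst sA) y hy) (hd (sfst sB) y hy), ← hA,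
    hcomm] at g1
  rw [deriv_deriv_weighted (Filter.Eventually.of_forall fun z => isDerivation_derivSnd p r z)
    e0 (ev hw) (ev sA) (ev sB) (hd sB y hy) (hd (ssnd sA) y hy) (hd (ssnd sB) y hy), ← hB] at g2
  have hsinh : DifferentiableAt ℝ (fun z => Real.sinh (w z)) y := (hd hw y hy).sinh
  -- Differentiating the sinh-Gordon equation along the commuting frame gives the linearized
  -- equation for each component of the gradient.
  have L1 : derivFst p r (derivFst p r A) y + derivSnd p r (derivSnd p r A) y =
      Real.cosh (w y) * A y := by
    rw [D2.congr hcomm', ← h.comm sB hy, D1.congr (g := fun z => Real.sinh (w z)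
      - derivFst p r A z) (f := derivSnd p r B)
      (h.eventually hy fun z hz => eq_sub_of_add_eq' (heq z hz)),
      D1.sub hsinh (hd (sfst sA) y hy), D1.comp (Real.hasDerivAt_sinh _) (hd hw y hy)]
    ring
  have L2 : derivFst p r (derivFst p r B) y + derivSnd p r (derivSnd p r B) y =
      Real.cosh (w y) * B y := by
    rw [D1.congr hcomm'.symm, h.comm sA hy, D2.congr (g := fun z => Real.sinh (w z)
      - derivFst p r A z) (f := derivSnd p r B)
      (h.eventually hy fun z hz => eq_sub_of_add_eq' (heq z hz)),
      D2.sub hsinh (hd (sfst sA) y hy), D2.comp (Real.hasDerivAt_sinh _) (hd hw y hy)]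
    ring
  have hN' : 0 < A y ^ 2 + B y ^ 2 := by nlinarith
  have k1 := (mul_eq_zero.mp f1).resolve_left hpos.ne'
  have k2 := (mul_eq_zero.mp f2).resolve_left hpos.ne'
  have k3 := nonpos_of_mul_nonpos_right g1 hpos
  have k4 := nonpos_of_mul_nonpos_right g2 hpos
  -- The sum of the two second derivative inequalities, divided by the positive weight, is the flat
  -- Laplacian of the weighted squared gradient at the maximum.
  have key := hessian_norm_le (C := Real.cosh (w y))
    (l' := 2 / (Real.sinh (w y) * Real.cosh (w y)) ^ 2) hN' (heq y hy)
    (l := logWeightDeriv (w y)) (b := derivSnd p r A y)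
    (by linear_combination k1) (by linear_combination k2)
    (by
      have hA2 : A y * derivFst p r (derivFst p r A) y + A y * derivSnd p r (derivSnd p r A) y =
        Real.cosh (w y) * A y ^ 2 := by linear_combination A y * L1
      have hB2 : B y * derivFst p r (derivFst p r B) y + B y * derivSnd p r (derivSnd p r B) y =
        Real.cosh (w y) * B y ^ 2 := by linear_combination B y * L2
      refine le_of_eq_of_le ?_ (add_nonpos k3 k4)
      linear_combination -2 * hA2 - 2 * hB2 - logWeightDeriv (w y) * (A y ^ 2 + B y ^ 2) * heq y hy)
  have := weight_mul_le (hneg y hy) hN' key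
  calc _ = weight (w y) * (A y ^ 2 + B y ^ 2) := by ring
    _ ≤ 9 := this

/-! ### The sinh-Gordon equation in an eigenframe -/

/-- The potential `log ((l - 1) / (l + 1))`, where `l` is the larger eigenvalue. -/
def potential (l : Plane → ℝ) (y : Plane) : ℝ := Real.log ((l y - 1) / (l y + 1))

/-- The factor which turns the first form of an eigenframe into a closed one. -/
def scaleFactor (l : Plane → ℝ) (y : Plane) : ℝ := Real.sqrt ((l y ^ 2 - 1) / 2)

section Potential

variable {l : Plane → ℝ} {y : Plane}

theorem scaleFactor_pos (hl : 1 < l y) : 0 < scaleFactor l y :=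
  Real.sqrt_pos.mpr (by nlinarith)

theorem scaleFactor_sq (hl : 1 < l y) : scaleFactor l y ^ 2 = (l y ^ 2 - 1) / 2 :=
  Real.sq_sqrt (by nlinarith)

theorem smooth_scaleFactor (hl : 1 < l y) (hs : ContDiffAt ℝ ∞ l y) :
    ContDiffAt ℝ ∞ (scaleFactor l) y := by
  have h1 : ContDiffAt ℝ ∞ (fun z => (l z ^ 2 - 1) / 2) y := by fun_prop
  exact h1.sqrt (by nlinarith)

theorem pd_scaleFactor (hl : 1 < l y) (hs : DifferentiableAt ℝ l y) (a : Fin 2) :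
    2 * scaleFactor l y * pd a (scaleFactor l) y = l y * pd a l y := by
  have hd : HasDerivAt (fun x : ℝ => Real.sqrt ((x ^ 2 - 1) / 2))
      (l y / (2 * scaleFactor l y)) (l y) := by
    have h1 : HasDerivAt (fun x : ℝ => (x ^ 2 - 1) / 2) (l y) (l y) :=
      ((((hasDerivAt_id (l y)).pow 2).sub_const 1).div_const 2).congr_deriv (by simp)
    exact h1.sqrt (by nlinarith)
  have h := pd_comp hd hs a
  have hc := scaleFactor_pos hl
  change pd a (scaleFactor l) y = _ at h
  rw [h]
  field_simp

theorem exp_potential (hl : 1 < l y) : Real.exp (potential l y) = (l y - 1) / (l y + 1) :=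
  Real.exp_log (div_pos (by linarith) (by linarith))

theorem sinh_potential (hl : 1 < l y) :
    Real.sinh (potential l y) = -(2 * l y) / (l y ^ 2 - 1) := by
  have h1 : l y - 1 ≠ 0 := by linarith
  have h2 : l y + 1 ≠ 0 := by linarith
  have h3 : l y ^ 2 - 1 ≠ 0 := by nlinarith
  rw [Real.sinh_eq, Real.exp_neg, exp_potential hl]
  field_simp
  ring

/-- Together with `sinh_potential` this gives `-coth w = (l + l⁻¹)/2`, which is `B` in the
application. -/
theorem cosh_potential (hl : 1 < l y) :
    Real.cosh (potential l y) = (l y ^ 2 + 1) / (l y ^ 2 - 1) := by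
  have h1 : l y - 1 ≠ 0 := by linarith
  have h2 : l y + 1 ≠ 0 := by linarith
  have h3 : l y ^ 2 - 1 ≠ 0 := by nlinarith
  rw [Real.cosh_eq, Real.exp_neg, exp_potential hl]
  field_simp
  ring

theorem potential_neg (hl : 1 < l y) : potential l y < 0 :=
  Real.log_neg (div_pos (by linarith) (by linarith)) (by rw [div_lt_one (by linarith)]; linarith)

theorem smooth_potential (hl : 1 < l y) (hs : ContDiffAt ℝ ∞ l y) :
    ContDiffAt ℝ ∞ (potential l) y :=
  ((hs.sub contDiffAt_const).div (hs.add contDiffAt_const) (by linarith)).log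
    (div_pos (by linarith) (by linarith)).ne'

theorem pd_potential (hl : 1 < l y) (hs : DifferentiableAt ℝ l y) (a : Fin 2) :
    pd a (potential l) y = 2 / (l y ^ 2 - 1) * pd a l y := by
  have h1 : l y - 1 ≠ 0 := by linarith
  have h2 : l y + 1 ≠ 0 := by linarith
  have h3 : l y ^ 2 - 1 ≠ 0 := by nlinarith
  have hd : HasDerivAt (fun x : ℝ => Real.log ((x - 1) / (x + 1))) (2 / (l y ^ 2 - 1)) (l y) := by
    have h := (((hasDerivAt_id (l y)).sub_const 1).div ((hasDerivAt_id (l y)).add_const 1) h2).log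
      (div_ne_zero h1 h2)
    refine h.congr_deriv ?_
    simp only [id, Pi.div_apply]
    have h3' : (l y - 1) * (l y + 1) ≠ 0 := mul_ne_zero h1 h2
    rw [show l y ^ 2 - 1 = (l y - 1) * (l y + 1) by ring]
    field_simp
    ring
  exact pd_comp hd hs a

end Potential

/-- An orthonormal coframe in which a Codazzi tensor of determinant one is diagonal, with larger
eigenvalue `l`. -/
structure IsEigenframe (G : Plane → Matrix (Fin 2) (Fin 2) ℝ) (p r : Fin 2 → Plane → ℝ)
    (l : Plane → ℝ) (U : Set Plane) : Prop extends IsCoframe G p r U where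
  smooth : ∀ y ∈ U, ContDiffAt ℝ ∞ l y
  one_lt : ∀ y ∈ U, 1 < l y
  curvature : ∀ y ∈ U, scalarCurvature G y = -1
  codazzi_fst : ∀ y ∈ U, pd 0 l y * p 1 y - pd 1 l y * p 0 y =
      ((l y)⁻¹ - l y) * (connForm G p r 0 y * r 1 y - connForm G p r 1 y * r 0 y)
  codazzi_snd : ∀ y ∈ U,
      pd 0 (fun z => (l z)⁻¹) y * r 1 y - pd 1 (fun z => (l z)⁻¹) y * r 0 y =
      ((l y)⁻¹ - l y) * (connForm G p r 0 y * p 1 y - connForm G p r 1 y * p 0 y)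

namespace IsEigenframe

variable {G : Plane → Matrix (Fin 2) (Fin 2) ℝ} {p r : Fin 2 → Plane → ℝ} {l : Plane → ℝ}
  {U : Set Plane} {y : Plane}

/-- The first closed form. -/
def flatFst (p : Fin 2 → Plane → ℝ) (l : Plane → ℝ) (a : Fin 2) (y : Plane) : ℝ :=
  scaleFactor l y * p a y

/-- The second closed form. -/
def flatSnd (r : Fin 2 → Plane → ℝ) (l : Plane → ℝ) (a : Fin 2) (y : Plane) : ℝ :=
  scaleFactor l y * (l y)⁻¹ * r a y

theorem flat_area (y : Plane) : flatFst p l 0 y * flatSnd r l 1 y - flatFst p l 1 y *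
    flatSnd r l 0 y = scaleFactor l y ^ 2 * (l y)⁻¹ * (p 0 y * r 1 y - p 1 y * r 0 y) := by
  simp only [flatFst, flatSnd]
  ring

theorem pd_inv (h : IsEigenframe G p r l U) (hy : y ∈ U) (a : Fin 2) :
    pd a (fun z => (l z)⁻¹) y = -(l y ^ 2)⁻¹ * pd a l y :=
  pd_comp (hasDerivAt_inv (by linarith [h.one_lt y hy]))
    ((h.smooth y hy).differentiableAt (by simp)) a

theorem codazzi_snd' (h : IsEigenframe G p r l U) (hy : y ∈ U) :
    pd 0 l y * r 1 y - pd 1 l y * r 0 y = l y * (l y ^ 2 - 1) *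
      (connForm G p r 0 y * p 1 y - connForm G p r 1 y * p 0 y) := by
  have hl : l y ≠ 0 := by linarith [h.one_lt y hy]
  have e := h.codazzi_snd y hy
  rw [h.pd_inv hy, h.pd_inv hy] at e
  field_simp at e
  linear_combination -e

/-- With `c` the scale factor, `2c dc = l dl`, so the first Codazzi equation gives `d(c p) = dc ∧ p
+ c ω ∧ r = ((1 - l²)/(2c) + c) ω ∧ r`. This vanishes precisely when `c² = (l² - 1)/2`, which is the
origin of `scaleFactor`. The second equation gives `d(c l⁻¹ r) = (c/l)(l² - 2c² - 1) ω ∧ p`, which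
vanishes for the same `c`. -/
theorem isFlatCoframe (h : IsEigenframe G p r l U) :
    IsFlatCoframe (flatFst p l) (flatSnd r l) U := by
  have hc := fun y (hy : y ∈ U) => smooth_scaleFactor (h.one_lt y hy) (h.smooth y hy)
  have hl0 : ∀ y ∈ U, l y ≠ 0 := fun y hy => by linarith [h.one_lt y hy]
  have hinv := fun y (hy : y ∈ U) => (h.smooth y hy).inv (hl0 y hy)
  refine ⟨h.isOpen, fun b y hy => (hc y hy).mul (h.smooth_fst b y hy),
    fun b y hy => ((hc y hy).mul (hinv y hy)).mul (h.smooth_snd b y hy), fun y hy => ?_,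
    fun y hy => ?_, fun y hy => ?_⟩
  · rw [flat_area]
    exact mul_ne_zero (mul_ne_zero (pow_ne_zero 2 (scaleFactor_pos (h.one_lt y hy)).ne')
      (inv_ne_zero (hl0 y hy))) (h.area_ne_zero y hy)
  all_goals
    have hcd : DifferentiableAt ℝ (scaleFactor l) y := (hc y hy).differentiableAt (by simp)
    have hp : ∀ b, DifferentiableAt ℝ (p b) y := fun b =>
      (h.smooth_fst b y hy).differentiableAt (by simp)
    have hr : ∀ b, DifferentiableAt ℝ (r b) y := fun b =>
      (h.smooth_snd b y hy).differentiableAt (by simp)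
    have hi : DifferentiableAt ℝ (fun z => (l z)⁻¹) y := (hinv y hy).differentiableAt (by simp)
    have hcp := scaleFactor_pos (h.one_lt y hy)
    have hsq := scaleFactor_sq (h.one_lt y hy)
    have hld := (h.smooth y hy).differentiableAt (by simp)
    have hp0 := pd_scaleFactor (h.one_lt y hy) hld 0
    have hp1 := pd_scaleFactor (h.one_lt y hy) hld 1
    have k1 := h.codazzi_fst y hy
    have k2 := h.codazzi_snd' hy
    have k3 := h.codazzi_snd y hy
    have hil : l y * (l y)⁻¹ = 1 := mul_inv_cancel₀ (hl0 y hy)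
  · have e : ∀ a b, pd a (flatFst p l b) y = pd a (scaleFactor l) y * p b y
        + scaleFactor l y * pd a (p b) y := fun a b => pd_mul hcd (hp b) a
    rw [e, e]
    have dp := h.d_fst hy
    rw [← sub_eq_zero]
    apply mul_left_cancel₀ (mul_pos two_pos hcp).ne'
    linear_combination p 1 y * hp0 - p 0 y * hp1 + 2 * scaleFactor l y ^ 2 * dp + l y * k1
      + (connForm G p r 0 y * r 1 y - connForm G p r 1 y * r 0 y) * (2 * hsq + hil)
  · have e : ∀ a b, pd a (flatSnd r l b) y = (pd a (scaleFactor l) y * (l y)⁻¹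
        + scaleFactor l y * pd a (fun z => (l z)⁻¹) y) * r b y
        + scaleFactor l y * (l y)⁻¹ * pd a (r b) y := fun a b => by
      have h1 := pd_mul (hcd.fun_mul hi) (hr b) a
      rw [pd_mul hcd hi] at h1
      exact h1
    rw [e, e]
    have dr := h.d_snd hy
    rw [← sub_eq_zero]
    apply mul_left_cancel₀ (mul_pos two_pos hcp).ne'
    linear_combination (l y)⁻¹ * (r 1 y * hp0 - r 0 y * hp1)
      + 2 * scaleFactor l y ^ 2 * (l y)⁻¹ * dr + l y * (l y)⁻¹ * k2
      + 2 * scaleFactor l y ^ 2 * k3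
      + l y * (connForm G p r 0 y * p 1 y - connForm G p r 1 y * p 0 y) * (-2 * hsq)
      + (l y * (l y ^ 2 - 1) * (connForm G p r 0 y * p 1 y - connForm G p r 1 y * p 0 y)) * hil

/-- The Codazzi equations express both `ω ∧ p` and `ω ∧ r` through `dl`, hence determine `ω`. The
result is `ω = -½ ⋆dw` with the Hodge star of the flat metric, so that `dω` is `-½ Δw` times the
flat area form. -/
theorem connForm_eq (h : IsEigenframe G p r l U) (hy : y ∈ U) (a : Fin 2) :
    connForm G p r a y =
      1 / 2 * (derivSnd (flatFst p l) (flatSnd r l) (potential l) y * flatFst p l a y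
        - derivFst (flatFst p l) (flatSnd r l) (potential l) y * flatSnd r l a y) := by
  have hl := h.one_lt y hy
  have hl0 : l y ≠ 0 := by linarith
  have hl2 : l y ^ 2 - 1 ≠ 0 := by nlinarith
  have hil : l y * (l y)⁻¹ = 1 := mul_inv_cancel₀ hl0
  have hD := h.area_ne_zero y hy
  have hc := (scaleFactor_pos hl).ne'
  have hsq := scaleFactor_sq hl
  have hld := (h.smooth y hy).differentiableAt (n := ∞) (by simp)
  have k1 := h.codazzi_fst y hy
  have k2 := h.codazzi_snd' hy
  have hK : 2 / (l y ^ 2 - 1) * (l y ^ 2 - 1) = 2 := div_mul_cancel₀ _ hl2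
  have hF := h.isFlatCoframe.area_ne_zero y hy
  have e1 : derivFst (flatFst p l) (flatSnd r l) (potential l) y *
      (scaleFactor l y * (p 0 y * r 1 y - p 1 y * r 0 y)) =
      2 * l y * (connForm G p r 0 y * p 1 y - connForm G p r 1 y * p 0 y) := by
    have e : derivFst (flatFst p l) (flatSnd r l) (potential l) y * _ = _ := div_mul_cancel₀ _ hF
    rw [flat_area, pd_potential hl hld, pd_potential hl hld] at e
    simp only [flatSnd] at e
    apply mul_left_cancel₀ (mul_ne_zero hc (inv_ne_zero hl0))
    linear_combination e + scaleFactor l y * (l y)⁻¹ * (2 / (l y ^ 2 - 1)) * k2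
      + scaleFactor l y * (l y)⁻¹ * l y *
        (connForm G p r 0 y * p 1 y - connForm G p r 1 y * p 0 y) * hK
  have e2 : derivSnd (flatFst p l) (flatSnd r l) (potential l) y *
      (scaleFactor l y * (p 0 y * r 1 y - p 1 y * r 0 y)) =
      2 * (connForm G p r 0 y * r 1 y - connForm G p r 1 y * r 0 y) := by
    have e : derivSnd (flatFst p l) (flatSnd r l) (potential l) y * _ = _ := div_mul_cancel₀ _ hF
    rw [flat_area, pd_potential hl hld, pd_potential hl hld] at e
    simp only [flatFst] at e
    apply mul_left_cancel₀ (mul_ne_zero hc (inv_ne_zero hl0))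
    linear_combination e - scaleFactor l y * (2 / (l y ^ 2 - 1)) * k1
      + scaleFactor l y * (l y)⁻¹ *
        (connForm G p r 0 y * r 1 y - connForm G p r 1 y * r 0 y) * hK
      - scaleFactor l y * (2 / (l y ^ 2 - 1)) * l y *
        (connForm G p r 0 y * r 1 y - connForm G p r 1 y * r 0 y) * hil
  apply mul_left_cancel₀ hD
  simp only [flatFst, flatSnd]
  revert a
  rw [Fin.forall_fin_two]
  constructor
  · linear_combination -1 / 2 * p 0 y * e2 + 1 / 2 * r 0 y * (l y)⁻¹ * e1
      + r 0 y * (connForm G p r 0 y * p 1 y - connForm G p r 1 y * p 0 y) * hil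
  · linear_combination -1 / 2 * p 1 y * e2 + 1 / 2 * r 1 y * (l y)⁻¹ * e1
      + r 1 y * (connForm G p r 0 y * p 1 y - connForm G p r 1 y * p 0 y) * hil

/-- The potential solves the sinh-Gordon equation. -/
theorem sinhGordon (h : IsEigenframe G p r l U) (hy : y ∈ U) :
    derivFst (flatFst p l) (flatSnd r l) (derivFst (flatFst p l) (flatSnd r l) (potential l)) y
      + derivSnd (flatFst p l) (flatSnd r l) (derivSnd (flatFst p l) (flatSnd r l) (potential l)) y
      = Real.sinh (potential l y) := by
  have hF := h.isFlatCoframe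
  have hl := h.one_lt y hy
  have hl0 : l y ≠ 0 := by linarith
  have hl2 : l y ^ 2 - 1 ≠ 0 := by nlinarith
  have hw := smooth_potential hl (h.smooth y hy)
  have hp : ∀ b, DifferentiableAt ℝ (flatFst p l b) y := fun b =>
    (hF.smooth_fst b y hy).differentiableAt (by simp)
  have hr : ∀ b, DifferentiableAt ℝ (flatSnd r l b) y := fun b =>
    (hF.smooth_snd b y hy).differentiableAt (by simp)
  have h1 : DifferentiableAt ℝ (derivFst (flatFst p l) (flatSnd r l) (potential l)) y :=
    (hF.isCoframe.smooth_derivFst hy hw).differentiableAt (by simp)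
  have h2 : DifferentiableAt ℝ (derivSnd (flatFst p l) (flatSnd r l) (potential l)) y :=
    (hF.isCoframe.smooth_derivSnd hy hw).differentiableAt (by simp)
  have hD := h.area_ne_zero y hy
  have harea := flat_area (p := p) (r := r) (l := l) y
  have hne := hF.area_ne_zero y hy
  have c1 := hF.closed_fst y hy
  have c2 := hF.closed_snd y hy
  have dω := h.d_connForm hy (h.curvature y hy)
  have hω := fun a => h.eventually hy fun z hz => h.connForm_eq hz a
  set P := flatFst p l
  set R := flatSnd r l
  set A := derivFst P R (potential l)
  set B := derivSnd P R (potential l)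
  have e : ∀ a b, pd a (connForm G p r b) y = 1 / 2 * (pd a B y * P b y + B y * pd a (P b) y
      - (pd a A y * R b y + A y * pd a (R b) y)) := by
    intro a b
    rw [pd_congr (hω b) a, pd_const_mul (by fun_prop), pd_sub (by fun_prop) (by fun_prop),
      pd_mul h2 (hp b), pd_mul h1 (hr b)]
  rw [e, e] at dω
  simp only [pd_eq_deriv (u := A) hne, pd_eq_deriv (u := B) hne] at dω
  -- Since `dω = ½ p ∧ r`, the Laplacian is minus the ratio of the two area forms, that is `-2l/(l²
  -- - 1) = sinh w`.
  have key : (derivFst P R A y + derivSnd P R B y) * (P 0 y * R 1 y - P 1 y * R 0 y) =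
      -(p 0 y * r 1 y - p 1 y * r 0 y) := by
    linear_combination -2 * dω + B y * c1 - A y * c2
  rw [harea, scaleFactor_sq hl] at key
  rw [sinh_potential hl, eq_div_iff hl2]
  apply mul_right_cancel₀ hD
  have hil : l y * (l y)⁻¹ = 1 := mul_inv_cancel₀ hl0
  linear_combination 2 * l y * key - (derivFst P R A y + derivSnd P R B y) * (l y ^ 2 - 1) *
    (p 0 y * r 1 y - p 1 y * r 0 y) * hil

/-- The weighted squared gradient of the potential in terms of the eigenframe. -/
theorem weighted_gradient_eq (h : IsEigenframe G p r l U) (hy : y ∈ U) {f : Plane → ℝ}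
    (hf : ∀ a, pd a f y = (l y ^ 2 - 1) / (l y * (l y ^ 2 + 1)) * pd a l y) :
    ((l y)⁻¹ * derivFst p r f y ^ 2 + l y * derivSnd p r f y ^ 2) /
      (1 + (l y + (l y)⁻¹) / 2) = weight (potential l y) *
      (derivFst (flatFst p l) (flatSnd r l) (potential l) y *
        derivFst (flatFst p l) (flatSnd r l) (potential l) y
      + derivSnd (flatFst p l) (flatSnd r l) (potential l) y *
        derivSnd (flatFst p l) (flatSnd r l) (potential l) y) := by
  have hl := h.one_lt y hy
  have hl0 : l y ≠ 0 := by linarith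
  have hl2 : l y ^ 2 - 1 ≠ 0 := by nlinarith
  have hl1 : l y + 1 ≠ 0 := by linarith
  have hl3 : l y ^ 2 + 1 ≠ 0 := by nlinarith
  have hD := h.area_ne_zero y hy
  have hc := (scaleFactor_pos hl).ne'
  have hsq := scaleFactor_sq hl
  have hld := (h.smooth y hy).differentiableAt (n := ∞) (by simp)
  have a1 : derivFst p r f y = (l y ^ 2 - 1) / (l y * (l y ^ 2 + 1)) * derivFst p r l y := by
    simp only [derivFst, hf]; ring
  have a2 : derivSnd p r f y = (l y ^ 2 - 1) / (l y * (l y ^ 2 + 1)) * derivSnd p r l y := by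
    simp only [derivSnd, hf]; ring
  have b1 : derivFst (flatFst p l) (flatSnd r l) (potential l) y =
      2 / (l y ^ 2 - 1) / scaleFactor l y * derivFst p r l y := by
    rw [derivFst, derivFst, flat_area, pd_potential hl hld, pd_potential hl hld, flatSnd, flatSnd]
    rw [div_eq_iff (mul_ne_zero (mul_ne_zero (pow_ne_zero 2 hc) (inv_ne_zero hl0)) hD)]
    generalize p 0 y * r 1 y - p 1 y * r 0 y = D at hD ⊢
    field_simp
  have b2 : derivSnd (flatFst p l) (flatSnd r l) (potential l) y =
      2 / (l y ^ 2 - 1) / scaleFactor l y * l y * derivSnd p r l y := by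
    rw [derivSnd, derivSnd, flat_area, pd_potential hl hld, pd_potential hl hld, flatFst, flatFst]
    rw [div_eq_iff (mul_ne_zero (mul_ne_zero (pow_ne_zero 2 hc) (inv_ne_zero hl0)) hD)]
    generalize p 0 y * r 1 y - p 1 y * r 0 y = D at hD ⊢
    field_simp
  have hw : weight (potential l y) = (l y - 1) / (l y + 1) * ((l y ^ 2 - 1) ^ 2) ^ 2 /
      (4 * l y ^ 2 * (l y ^ 2 + 1) ^ 2) := by
    rw [weight, exp_potential hl, sinh_potential hl, cosh_potential hl]
    field_simp
    ring
  have hb : 1 + (l y + (l y)⁻¹) / 2 = (l y + 1) ^ 2 / (2 * l y) := by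
    field_simp
    ring
  have hq : (2 / (l y ^ 2 - 1) / scaleFactor l y) ^ 2 = 8 / (l y ^ 2 - 1) ^ 3 := by
    rw [div_pow, hsq]
    field_simp
    ring
  -- A rational identity in `l`, expressing two facts: `d log B = -dw/(sinh w cosh w)`, and `g` is
  -- conformal to the flat metric, its inverse carrying the factor `(l - 1)/(l + 1) = e^w`.
  calc _ = ((l y ^ 2 - 1) / (l y * (l y ^ 2 + 1))) ^ 2 * ((l y)⁻¹ * derivFst p r l y ^ 2
        + l y * derivSnd p r l y ^ 2) / ((l y + 1) ^ 2 / (2 * l y)) := by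
        rw [a1, a2, hb]; ring
    _ = weight (potential l y) * (8 / (l y ^ 2 - 1) ^ 3) * (derivFst p r l y ^ 2
        + l y ^ 2 * derivSnd p r l y ^ 2) := by
        rw [hw]
        field_simp
        ring
    _ = _ := by
        rw [← hq, b1, b2]
        ring

end IsEigenframe

/-! ### Solutions of Moncrief's equation in coordinates -/

/-! ### Smoothness of `ξ`, `B` and the inverse of `g` -/

section Smoothness

variable {G Z : Plane → Matrix (Fin 2) (Fin 2) ℝ} {f : Plane → ℝ} {y : Plane}

theorem contDiffAt_hessian
    (hG : ∀ a b, ContDiffAt ℝ ∞ (fun w => G w a b) y) (hdet : (G y).det ≠ 0)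
    (hf : ContDiffAt ℝ ∞ f y)
    (a b : Fin 2) : ContDiffAt ℝ ∞ (hessian G f a b) y :=
  (contDiffAt_pd (contDiffAt_pd hf b) a).sub (ContDiffAt.sum fun c _ =>
    (contDiffAt_christoffel hG hdet c a b).mul (contDiffAt_pd hf c))

theorem contDiffAt_laplacian
    (hG : ∀ a b, ContDiffAt ℝ ∞ (fun w => G w a b) y) (hdet : (G y).det ≠ 0)
    (hf : ContDiffAt ℝ ∞ f y) : ContDiffAt ℝ ∞ (laplacian G f) y :=
  ContDiffAt.sum fun a _ => ContDiffAt.sum fun b _ =>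
    (contDiffAt_inv hG hdet a b).mul (contDiffAt_hessian hG hdet hf a b)

theorem contDiffAt_xi
    (hG : ∀ a b, ContDiffAt ℝ ∞ (fun w => G w a b) y) (hdet : (G y).det ≠ 0)
    (hZ : ∀ a b, ContDiffAt ℝ ∞ (fun w => Z w a b) y) (hf : ContDiffAt ℝ ∞ f y)
    (a b : Fin 2) : ContDiffAt ℝ ∞ (fun w => xi G Z f w a b) y := by
  simp only [xi, Matrix.of_apply]
  exact contDiffAt_const.mul ((contDiffAt_const.mul (hZ a b)).sub
    ((contDiffAt_const.mul (contDiffAt_hessian hG hdet hf a b)).sub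
      ((hG a b).mul (contDiffAt_laplacian hG hdet hf))))

theorem contDiffAt_normSq
    (hG : ∀ a b, ContDiffAt ℝ ∞ (fun w => G w a b) y) (hdet : (G y).det ≠ 0)
    (hZ : ∀ a b, ContDiffAt ℝ ∞ (fun w => Z w a b) y) (hf : ContDiffAt ℝ ∞ f y) :
    ContDiffAt ℝ ∞ (normSq G (xi G Z f)) y :=
  ContDiffAt.sum fun a _ => ContDiffAt.sum fun b _ => ContDiffAt.sum fun c _ =>
    ContDiffAt.sum fun d _ => (((contDiffAt_inv hG hdet a c).mul (contDiffAt_inv hG hdet b d)).mul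
      (contDiffAt_xi hG hdet hZ hf a b)).mul (contDiffAt_xi hG hdet hZ hf c d)

theorem contDiffAt_B
    (hG : ∀ a b, ContDiffAt ℝ ∞ (fun w => G w a b) y) (hdet : (G y).det ≠ 0)
    (hZ : ∀ a b, ContDiffAt ℝ ∞ (fun w => Z w a b) y) (hf : ContDiffAt ℝ ∞ f y)
    (hn : 0 ≤ normSq G (xi G Z f) y) : ContDiffAt ℝ ∞ (B G Z f) y :=
  (contDiffAt_const.add (contDiffAt_const.mul (contDiffAt_normSq hG hdet hZ hf))).sqrt
    (by linarith)

theorem contDiffAt_gInv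
    (hG : ∀ a b, ContDiffAt ℝ ∞ (fun w => G w a b) y) (hdet : (G y).det ≠ 0)
    (hZ : ∀ a b, ContDiffAt ℝ ∞ (fun w => Z w a b) y) (hf : ContDiffAt ℝ ∞ f y)
    (hn : 0 ≤ normSq G (xi G Z f) y) (a b : Fin 2) :
    ContDiffAt ℝ ∞ (fun w => gInv G Z f w a b) y := by
  have hB := contDiffAt_B hG hdet hZ hf hn
  simp only [gInv, Matrix.of_apply]
  refine ContDiffAt.div ?_ (contDiffAt_const.add hB) ?_
  · exact (contDiffAt_const.mul (ContDiffAt.sum fun c _ => ContDiffAt.sum fun d _ =>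
      ((contDiffAt_inv hG hdet a c).mul (contDiffAt_inv hG hdet b d)).mul
      (contDiffAt_xi hG hdet hZ hf c d))).add (hB.mul (contDiffAt_inv hG hdet a b))
  · have : 0 ≤ B G Z f y := Real.sqrt_nonneg _
    positivity

end Smoothness

/-- The coordinate expressions of a hyperbolic metric, a TT-tensor and a solution of Moncrief's
equation on an open set. -/
structure IsLocalSolution (G Z : Plane → Matrix (Fin 2) (Fin 2) ℝ) (f : Plane → ℝ)
    (U : Set Plane) : Prop where
  isOpen : IsOpen U
  smooth_metric : ∀ y ∈ U, ∀ a b, ContDiffAt ℝ ∞ (fun w => G w a b) y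
  smooth_tensor : ∀ y ∈ U, ∀ a b, ContDiffAt ℝ ∞ (fun w => Z w a b) y
  smooth_fun : ∀ y ∈ U, ContDiffAt ℝ ∞ f y
  metric_symm : ∀ y ∈ U, ∀ a b, G y a b = G y b a
  metric_pos : ∀ y ∈ U, 0 < G y 0 0
  det_pos : ∀ y ∈ U, 0 < (G y).det
  tensor_symm : ∀ y ∈ U, ∀ a b, Z y a b = Z y b a
  trace_free : ∀ y ∈ U, trace G Z y = 0
  div_free : ∀ y ∈ U, ∀ a, divergence G Z a y = 0
  curvature : ∀ y ∈ U, scalarCurvature G y = -1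
  equation : ∀ y ∈ U, laplacian G f y - f y + B G Z f y = 0

theorem det_mul_inv_apply {A : Matrix (Fin 2) (Fin 2) ℝ} (h : A.det ≠ 0) :
    A.det * A⁻¹ 0 0 = A 1 1 ∧ A.det * A⁻¹ 0 1 = -A 0 1 ∧ A.det * A⁻¹ 1 0 = -A 1 0 ∧
      A.det * A⁻¹ 1 1 = A 0 0 := by
  rw [Matrix.inv_def, Matrix.adjugate_fin_two, Ring.inverse_eq_inv']
  simp [mul_inv_cancel_left₀ h]

/-- A symmetric matrix of rank one with positive trace has a positive diagonal entry. -/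
theorem exists_diag_pos {g00 g01 g11 n00 n01 n11 : ℝ} (hg : 0 < g00) (hd : 0 < g00 * g11 - g01 ^ 2)
    (hn : n00 * n11 = n01 ^ 2) (ht : 0 < g11 * n00 - 2 * g01 * n01 + g00 * n11) :
    0 < n00 ∨ 0 < n11 := by
  by_contra! hcon
  obtain ⟨h0, h1⟩ := hcon
  -- The value of the rank one form on `(g01, -g00)`, a vector orthogonal to the first coordinate
  -- vector. Adding `n00` times the determinant of the metric gives `g00` times the quantity in
  -- `ht`.
  have hb : g01 ^ 2 * n00 - 2 * g00 * g01 * n01 + g00 ^ 2 * n11 ≤ 0 := by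
    rcases h0.eq_or_lt with h | h
    · have : n01 = 0 := by
        rw [h, zero_mul] at hn
        exact pow_eq_zero_iff (two_ne_zero) |>.mp hn.symm
      rw [h, this]
      nlinarith [sq_nonneg g00]
    · by_contra! hc
      have h2 : n00 * (g01 ^ 2 * n00 - 2 * g00 * g01 * n01 + g00 ^ 2 * n11) =
          (g01 * n00 - g00 * n01) ^ 2 := by linear_combination g00 ^ 2 * hn
      nlinarith [sq_nonneg (g01 * n00 - g00 * n01), mul_neg_of_neg_of_pos h hc]
  have h3 : g00 * (g11 * n00 - 2 * g01 * n01 + g00 * n11) ≤ 0 := by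
    nlinarith [mul_nonneg_of_nonpos_of_nonpos (sub_nonpos.mpr hd.le) h0]
  nlinarith [mul_pos hg ht]

/-- A smooth family of symmetric matrices of rank one which are positive at a point is, near this
point, the square of a smooth covector field. -/
theorem exists_sqrt_of_rank_one {N : Fin 2 → Fin 2 → Plane → ℝ} {V : Set Plane} {y : Plane}
    (hV : IsOpen V) (hy : y ∈ V) (hs : ∀ z ∈ V, ∀ a b, ContDiffAt ℝ ∞ (N a b) z)
    (hsymm : ∀ z ∈ V, N 1 0 z = N 0 1 z) (hdet : ∀ z ∈ V, N 0 0 z * N 1 1 z = N 0 1 z ^ 2)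
    (hpos : 0 < N 0 0 y ∨ 0 < N 1 1 y) :
    ∃ (W : Set Plane) (p : Fin 2 → Plane → ℝ), IsOpen W ∧ y ∈ W ∧ W ⊆ V ∧
      (∀ a, ∀ z ∈ W, ContDiffAt ℝ ∞ (p a) z) ∧ ∀ z ∈ W, ∀ a b, N a b z = p a z * p b z := by
  obtain ⟨k, hk⟩ : ∃ k, 0 < N k k y := hpos.elim (fun h => ⟨0, h⟩) fun h => ⟨1, h⟩
  have hc : ContinuousOn (N k k) V := fun z hz => (hs z hz k k).continuousAt.continuousWithinAt
  -- If `N = p ⊗ p` then `p a = N a k / √(N k k)` up to sign, for any `k` with a positive diagonal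
  -- entry.
  refine ⟨V ∩ N k k ⁻¹' Set.Ioi 0, fun a z => N a k z / Real.sqrt (N k k z),
    hc.isOpen_inter_preimage hV isOpen_Ioi, ⟨hy, hk⟩, Set.inter_subset_left, ?_, ?_⟩
  · rintro a z ⟨hz, hz'⟩
    have hz' : 0 < N k k z := hz'
    exact (hs z hz a k).div ((hs z hz k k).sqrt hz'.ne') (Real.sqrt_pos.mpr hz').ne'
  · rintro z ⟨hz, hz0⟩ a b
    have hz' : 0 < N k k z := hz0
    have h1 : N a k z / Real.sqrt (N k k z) * (N b k z / Real.sqrt (N k k z)) =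
        N a k z * N b k z / N k k z := by
      rw [div_mul_div_comm, Real.mul_self_sqrt hz'.le]
    rw [h1, eq_div_iff hz'.ne']
    have hd := hdet z hz
    have hm := hsymm z hz
    clear h1 hz' hz0 hc hk
    revert a b k
    simp only [Fin.forall_fin_two, hm]
    refine ⟨⟨⟨?_, ?_⟩, ?_, ?_⟩, ⟨?_, ?_⟩, ?_, ?_⟩ <;>
      first | trivial | ring1 | linear_combination hd

namespace IsLocalSolution

variable {G Z : Plane → Matrix (Fin 2) (Fin 2) ℝ} {f : Plane → ℝ} {U : Set Plane} {y : Plane}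

theorem eventually (h : IsLocalSolution G Z f U) (hy : y ∈ U) {P : Plane → Prop}
    (hP : ∀ w ∈ U, P w) : ∀ᶠ w in nhds y, P w :=
  Filter.mem_of_superset (h.isOpen.mem_nhds hy) hP

theorem xi_symm (h : IsLocalSolution G Z f U) (hy : y ∈ U) :
    xi G Z f y 1 0 = xi G Z f y 0 1 := by
  have h1 : hessian G f 1 0 y = hessian G f 0 1 y := by
    simp only [hessian, pd_comm (h.smooth_fun y hy) 1 0,
      fun c => christoffel_symm (h.eventually hy h.metric_symm) c 1 0]
  simp only [xi, Matrix.of_apply, h1, h.metric_symm y hy 1 0, h.tensor_symm y hy 1 0]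

/-- Both `𝔷` and `Hess u - ½ ρ Δu` are trace free, the latter because the dimension is two. The
trace is multiplied by the determinant to avoid the inverse metric. -/
theorem xi_trace (h : IsLocalSolution G Z f U) (hy : y ∈ U) :
    G y 1 1 * xi G Z f y 0 0 - 2 * G y 0 1 * xi G Z f y 0 1 + G y 0 0 * xi G Z f y 1 1 = 0 := by
  have hd := (h.det_pos y hy).ne'
  obtain ⟨i00, i01, i10, i11⟩ := det_mul_inv_apply hd
  have hx := h.xi_symm hy
  have hs := h.metric_symm y hy 1 0
  have htr := h.trace_free y hy
  have hinv : (G y)⁻¹ * G y = 1 := Matrix.nonsing_inv_mul _ hd.isUnit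
  have j0 := congrFun (congrFun hinv 0) 0
  have j1 := congrFun (congrFun hinv 1) 1
  simp only [Matrix.mul_apply, Fin.sum_univ_two, Matrix.one_apply_eq] at j0 j1
  have hξ : (G y)⁻¹ 0 0 * xi G Z f y 0 0 + (G y)⁻¹ 0 1 * xi G Z f y 0 1
      + (G y)⁻¹ 1 0 * xi G Z f y 1 0 + (G y)⁻¹ 1 1 * xi G Z f y 1 1 = 0 := by
    have hL : laplacian G f y = ∑ a, ∑ b, (G y)⁻¹ a b * hessian G f a b y := rfl
    simp only [trace, Fin.sum_univ_two] at htr hL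
    simp only [xi, Matrix.of_apply, hs]
    rw [hs] at j0
    linear_combination htr + hL + 1 / 2 * laplacian G f y * (j0 + j1)
  rw [hx] at hξ
  rw [hs] at i10
  linear_combination (G y).det * hξ - xi G Z f y 0 0 * i00 - xi G Z f y 0 1 * (i01 + i10)
    - xi G Z f y 1 1 * i11

/-- The eigenvalues of a trace free symmetric tensor in dimension two are opposite, so its squared
norm is minus twice its determinant. -/
theorem normSq_eq (h : IsLocalSolution G Z f U) (hy : y ∈ U) :
    (G y).det * normSq G (xi G Z f) y =
      -2 * (xi G Z f y 0 0 * xi G Z f y 1 1 - xi G Z f y 0 1 ^ 2) := by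
  have hd := (h.det_pos y hy).ne'
  obtain ⟨i00, i01, i10, i11⟩ := det_mul_inv_apply hd
  have hx := h.xi_symm hy
  have hs := h.metric_symm y hy 1 0
  have ht := h.xi_trace hy
  have hdet := Matrix.det_fin_two (G y)
  have e : (G y).det ^ 2 * normSq G (xi G Z f) y = ∑ a, ∑ b, ∑ c, ∑ d,
      ((G y).det * (G y)⁻¹ a c) * ((G y).det * (G y)⁻¹ b d) * xi G Z f y a b * xi G Z f y c d := by
    simp only [normSq, Finset.mul_sum]
    refine Finset.sum_congr rfl fun a _ => Finset.sum_congr rfl fun b _ =>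
      Finset.sum_congr rfl fun c _ => Finset.sum_congr rfl fun d _ => by ring
  simp only [Fin.sum_univ_two, i00, i01, i10, i11, hx, hs] at e
  rw [hs] at hdet
  apply mul_left_cancel₀ hd
  set x00 := xi G Z f y 0 0
  set x01 := xi G Z f y 0 1
  set x11 := xi G Z f y 1 1
  linear_combination e + (G y 1 1 * x00 - 2 * G y 0 1 * x01 + G y 0 0 * x11) * ht
    + 2 * (x00 * x11 - x01 ^ 2) * hdet

/-- Completing the square. Nonnegativity ensures that the square root defining `B` is never taken of
a negative number. -/
theorem normSq_nonneg (h : IsLocalSolution G Z f U) (hy : y ∈ U) :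
    0 ≤ normSq G (xi G Z f) y := by
  have hd := h.det_pos y hy
  have hg := h.metric_pos y hy
  have ht := h.xi_trace hy
  have hn := h.normSq_eq hy
  have hdet := Matrix.det_fin_two (G y)
  rw [h.metric_symm y hy 1 0] at hdet
  set x00 := xi G Z f y 0 0
  set x01 := xi G Z f y 0 1
  set x11 := xi G Z f y 1 1
  have e : G y 0 0 ^ 2 * (x00 * x11 - x01 ^ 2) =
      -((G y 0 0 * x01 - G y 0 1 * x00) ^ 2 + (G y).det * x00 ^ 2) := by
    linear_combination G y 0 0 * x00 * ht + x00 ^ 2 * hdet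
  have h1 : 0 ≤ (G y 0 0 ^ 2 * (G y).det) * normSq G (xi G Z f) y := by
    have : (G y 0 0 ^ 2 * (G y).det) * normSq G (xi G Z f) y =
      2 * ((G y 0 0 * x01 - G y 0 1 * x00) ^ 2 + (G y).det * x00 ^ 2) := by
      linear_combination G y 0 0 ^ 2 * hn - 2 * e
    rw [this]
    positivity
  exact nonneg_of_mul_nonneg_right h1 (by positivity)

theorem B_sq (h : IsLocalSolution G Z f U) (hy : y ∈ U) :
    B G Z f y ^ 2 = 1 + 2 * normSq G (xi G Z f) y :=
  Real.sq_sqrt (by linarith [h.normSq_nonneg hy])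

theorem one_le_B (h : IsLocalSolution G Z f U) (hy : y ∈ U) : 1 ≤ B G Z f y :=
  Real.one_le_sqrt.mpr (by linarith [h.normSq_nonneg hy])

theorem smooth_B (h : IsLocalSolution G Z f U) (hy : y ∈ U) : ContDiffAt ℝ ∞ (B G Z f) y :=
  contDiffAt_B (h.smooth_metric y hy) (h.det_pos y hy).ne' (h.smooth_tensor y hy)
    (h.smooth_fun y hy) (h.normSq_nonneg hy)

/-- Up to the factor `(1 + B)⁻¹` and raised indices, `gInv` is `-2ξ + Bρ`. Relative to `ρ` this has
determinant `B² - 2|ξ|² = 1`, so the double inverse is genuine. -/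
theorem gMetric_inv (h : IsLocalSolution G Z f U) (hy : y ∈ U) :
    (gMetric G Z f y)⁻¹ = gInv G Z f y := by
  have hd := (h.det_pos y hy).ne'
  have hB := h.one_le_B hy
  have hsymm : (G y).transpose = G y := by
    ext a b
    exact h.metric_symm y hy b a
  have e : gInv G Z f y = (1 + B G Z f y)⁻¹ • ((G y)⁻¹ *
      ((-2 : ℝ) • xi G Z f y + B G Z f y • G y) * ((G y)⁻¹).transpose) := by
    rw [gInv_eq, Matrix.mul_add, Matrix.add_mul]
    congr 2
    · simp only [Matrix.mul_smul, Matrix.smul_mul]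
    · rw [Matrix.mul_smul, Matrix.smul_mul, Matrix.nonsing_inv_mul _ hd.isUnit, Matrix.one_mul,
        Matrix.transpose_nonsing_inv, hsymm]
  have hdet : ((-2 : ℝ) • xi G Z f y + B G Z f y • G y).det = (G y).det := by
    have h1 := h.normSq_eq hy
    have h2 := h.B_sq hy
    have h3 := h.xi_trace hy
    have h4 := h.xi_symm hy
    have h5 := Matrix.det_fin_two (G y)
    rw [Matrix.det_fin_two]
    simp only [Matrix.add_apply, Matrix.smul_apply, smul_eq_mul, h4, h.metric_symm y hy 1 0]
      at h5 ⊢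
    linear_combination (G y).det * h2 - B G Z f y ^ 2 * h5 - 2 * B G Z f y * h3 + 2 * h1
  have hne : (gInv G Z f y).det ≠ 0 := by
    rw [e, Matrix.det_smul, Matrix.det_mul, Matrix.det_mul, hdet, Matrix.det_transpose,
      Matrix.det_nonsing_inv, Ring.inverse_eq_inv']
    have : (1 + B G Z f y)⁻¹ ≠ 0 := by positivity
    positivity
  rw [gMetric, Matrix.nonsing_inv_nonsing_inv _ hne.isUnit]

end IsLocalSolution

/-- The larger root of `x² - 2bx + 1`; the product of the roots is one. -/
theorem quadratic_eigenvalue {b : ℝ} (hb : 1 < b) :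
    1 < b + Real.sqrt (b ^ 2 - 1) ∧
      (b + Real.sqrt (b ^ 2 - 1)) + (b + Real.sqrt (b ^ 2 - 1))⁻¹ = 2 * b := by
  have h0 : 0 ≤ b ^ 2 - 1 := by nlinarith
  have h1 := Real.sqrt_nonneg (b ^ 2 - 1)
  have h2 := Real.sq_sqrt h0
  set s := Real.sqrt (b ^ 2 - 1)
  have h3 : b + s ≠ 0 := by linarith
  refine ⟨by linarith, ?_⟩
  field_simp
  linear_combination h2

/-! ### Eigenframes where `B > 1`, and the estimate at a maximum -/

namespace IsLocalSolution

variable {G Z : Plane → Matrix (Fin 2) (Fin 2) ℝ} {f l : Plane → ℝ} {U V : Set Plane} {y : Plane}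
  {p r : Fin 2 → Plane → ℝ}

/-- Near a point where `B > 1` there is an orthonormal coframe which diagonalizes `ξ`. -/
theorem exists_diagonal_coframe (h : IsLocalSolution G Z f U) (hy : y ∈ U)
    (hB : 1 < B G Z f y) :
    ∃ (V : Set Plane) (p r : Fin 2 → Plane → ℝ) (l : Plane → ℝ), y ∈ V ∧ V ⊆ U ∧
      IsCoframe G p r V ∧ (∀ z ∈ V, ContDiffAt ℝ ∞ l z) ∧ (∀ z ∈ V, 1 < l z) ∧
      (∀ z ∈ V, l z + (l z)⁻¹ = 2 * B G Z f z) ∧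
      ∀ z ∈ V, ∀ a b, 2 * xi G Z f z a b + B G Z f z * G z a b =
        l z * (p a z * p b z) + (l z)⁻¹ * (r a z * r b z) := by
  have hc : ContinuousOn (B G Z f) U := fun z hz =>
    (h.smooth_B hz).continuousAt.continuousWithinAt
  set W := U ∩ B G Z f ⁻¹' Set.Ioi 1 with hW
  have hWo : IsOpen W := hc.isOpen_inter_preimage h.isOpen isOpen_Ioi
  have hWU : W ⊆ U := Set.inter_subset_left
  have hBW : ∀ z ∈ W, 1 < B G Z f z := fun z hz => hz.2
  have hyW : y ∈ W := ⟨hy, hB⟩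
  set l : Plane → ℝ := fun z => B G Z f z + Real.sqrt (B G Z f z ^ 2 - 1) with hl
  have hl1 : ∀ z ∈ W, 1 < l z := fun z hz => (quadratic_eigenvalue (hBW z hz)).1
  have hlB : ∀ z ∈ W, l z + (l z)⁻¹ = 2 * B G Z f z := fun z hz =>
    (quadratic_eigenvalue (hBW z hz)).2
  have hli : ∀ z ∈ W, l z * (l z)⁻¹ = 1 := fun z hz =>
    mul_inv_cancel₀ (by linarith [hl1 z hz])
  have hlt : ∀ z ∈ W, 0 < l z - (l z)⁻¹ := fun z hz => by
    have := inv_lt_one_of_one_lt₀ (hl1 z hz)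
    linarith [hl1 z hz]
  have hls : ∀ z ∈ W, ContDiffAt ℝ ∞ l z := fun z hz => by
    have hb := h.smooth_B (hWU hz)
    exact hb.add (((hb.pow 2).sub contDiffAt_const).sqrt (by nlinarith [hBW z hz]))
  have hlis : ∀ z ∈ W, ContDiffAt ℝ ∞ (fun z => (l z)⁻¹) z := fun z hz =>
    (hls z hz).inv (by linarith [hl1 z hz])
  have hSs : ∀ z ∈ W, ∀ a b,
      ContDiffAt ℝ ∞ (fun z => 2 * xi G Z f z a b + B G Z f z * G z a b) z := fun z hz a b =>
    (contDiffAt_const.mul (contDiffAt_xi (h.smooth_metric z (hWU hz)) (h.det_pos z (hWU hz)).ne'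
      (h.smooth_tensor z (hWU hz)) (h.smooth_fun z (hWU hz)) a b)).add
      ((h.smooth_B (hWU hz)).mul (h.smooth_metric z (hWU hz) a b))
  set S : Fin 2 → Fin 2 → Plane → ℝ :=
    fun a b z => 2 * xi G Z f z a b + B G Z f z * G z a b with hS
  have hSsymm : ∀ z ∈ W, S 1 0 z = S 0 1 z := fun z hz => by
    simp only [hS, h.xi_symm (hWU hz), h.metric_symm z (hWU hz) 1 0]
  have hGd : ∀ z ∈ W, (G z).det = G z 0 0 * G z 1 1 - G z 0 1 ^ 2 := fun z hz => by
    rw [Matrix.det_fin_two, h.metric_symm z (hWU hz) 1 0]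
    ring
  have hSd : ∀ z ∈ W, S 0 0 z * S 1 1 z - S 0 1 z ^ 2 = (G z).det := fun z hz => by
    simp only [hS]
    linear_combination -B G Z f z ^ 2 * hGd z hz + (G z).det * h.B_sq (hWU hz)
      + 2 * h.normSq_eq (hWU hz) + 2 * B G Z f z * h.xi_trace (hWU hz)
  have hSt : ∀ z ∈ W, G z 1 1 * S 0 0 z - 2 * G z 0 1 * S 0 1 z + G z 0 0 * S 1 1 z =
      (l z + (l z)⁻¹) * (G z).det := fun z hz => by
    rw [hlB z hz]
    simp only [hS]
    linear_combination 2 * h.xi_trace (hWU hz) - 2 * B G Z f z * hGd z hz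
  have rank : ∀ N : Fin 2 → Fin 2 → Plane → ℝ,
      (∀ z ∈ W, ∀ a b, ContDiffAt ℝ ∞ (N a b) z) → (∀ z ∈ W, N 1 0 z = N 0 1 z) →
      (∀ z ∈ W, N 0 0 z * N 1 1 z = N 0 1 z ^ 2) →
      (G y 1 1 * N 0 0 y - 2 * G y 0 1 * N 0 1 y + G y 0 0 * N 1 1 y = (G y).det) →
      ∃ (V : Set Plane) (p : Fin 2 → Plane → ℝ), IsOpen V ∧ y ∈ V ∧ V ⊆ W ∧
      (∀ a, ∀ z ∈ V, ContDiffAt ℝ ∞ (p a) z) ∧ ∀ z ∈ V, ∀ a b, N a b z = p a z * p b z := by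
    intro N h1 h2 h3 h4
    refine exists_sqrt_of_rank_one hWo hyW h1 h2 h3 (exists_diag_pos (h.metric_pos y hy) ?_
      (h3 y hyW) (g01 := G y 0 1) (g11 := G y 1 1) ?_)
    · rw [← hGd y hyW]; exact h.det_pos y hy
    · rw [h4]; exact h.det_pos y hy
  -- The metric splits into its spectral parts `(S - l⁻¹ G)/(l - l⁻¹)` and `(l G - S)/(l - l⁻¹)`.
  -- They are smooth because `l ≠ l⁻¹` where `B > 1`, singular because `l` and `l⁻¹` are roots of
  -- the characteristic polynomial, and of trace one. Hence each is locally the square of a smooth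
  -- covector field.
  obtain ⟨V, p, hVo, hyV, hVW, hps, hp⟩ := rank
    (fun a b z => (S a b z - (l z)⁻¹ * G z a b) / (l z - (l z)⁻¹))
    (fun z hz a b => ((hSs z hz a b).sub ((hlis z hz).mul (h.smooth_metric z (hWU hz) a b))).div
      ((hls z hz).sub (hlis z hz)) (hlt z hz).ne')
    (fun z hz => by rw [hSsymm z hz, h.metric_symm z (hWU hz) 1 0])
    (fun z hz => by
      rw [div_mul_div_comm, div_pow, ← sq]
      congr 1
      linear_combination hSd z hz - (l z)⁻¹ * hSt z hz - (l z)⁻¹ ^ 2 * hGd z hz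
        - (G z).det * hli z hz)
    (by
      have hk := mul_inv_cancel₀ (hlt y hyW).ne'
      simp only [div_eq_mul_inv]
      linear_combination (l y - (l y)⁻¹)⁻¹ * (hSt y hyW + 2 * (l y)⁻¹ * hGd y hyW)
        + (G y).det * hk)
  obtain ⟨V', r, hVo', hyV', hVW', hrs, hr⟩ := rank
    (fun a b z => (l z * G z a b - S a b z) / (l z - (l z)⁻¹))
    (fun z hz a b => (((hls z hz).mul (h.smooth_metric z (hWU hz) a b)).sub (hSs z hz a b)).div
      ((hls z hz).sub (hlis z hz)) (hlt z hz).ne')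
    (fun z hz => by rw [hSsymm z hz, h.metric_symm z (hWU hz) 1 0])
    (fun z hz => by
      rw [div_mul_div_comm, div_pow, ← sq]
      congr 1
      linear_combination hSd z hz - l z * hSt z hz - l z ^ 2 * hGd z hz
        - (G z).det * hli z hz)
    (by
      have hk := mul_inv_cancel₀ (hlt y hyW).ne'
      simp only [div_eq_mul_inv]
      linear_combination (l y - (l y)⁻¹)⁻¹ * (-hSt y hyW - 2 * l y * hGd y hyW)
        + (G y).det * hk)
  have hmetric : ∀ z ∈ V ∩ V', ∀ a b, G z a b = p a z * p b z + r a z * r b z := by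
    intro z hz a b
    rw [← hp z hz.1, ← hr z hz.2]
    rw [← add_div, eq_div_iff (hlt z (hVW hz.1)).ne']
    ring
  refine ⟨V ∩ V', p, r, l, ⟨hyV, hyV'⟩, fun z hz => hWU (hVW hz.1), ⟨hVo.inter hVo',
    fun a z hz => hps a z hz.1, fun a z hz => hrs a z hz.2, hmetric, fun z hz h0 => ?_⟩,
    fun z hz => hls z (hVW hz.1), fun z hz => hl1 z (hVW hz.1), fun z hz => hlB z (hVW hz.1),
    fun z hz a b => ?_⟩
  · have hd := h.det_pos z (hWU (hVW hz.1))
    rw [Matrix.det_fin_two] at hd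
    simp only [hmetric z hz] at hd
    have : (p 0 z * p 0 z + r 0 z * r 0 z) * (p 1 z * p 1 z + r 1 z * r 1 z)
        - (p 0 z * p 1 z + r 0 z * r 1 z) * (p 1 z * p 0 z + r 1 z * r 0 z) =
        (p 0 z * r 1 z - p 1 z * r 0 z) ^ 2 := by ring
    rw [this, h0] at hd
    simp at hd
  · rw [← hp z hz.1, ← hr z hz.2]
    have h1 := (hlt z (hVW hz.1)).ne'
    have h2 := hli z (hVW hz.1)
    change S a b z = _
    rw [← mul_right_inj' h1]
    trans l z * (S a b z - (l z)⁻¹ * G z a b) + (l z)⁻¹ * (l z * G z a b - S a b z)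
    · ring
    · rw [mul_add]
      congr 1
      · rw [mul_left_comm, mul_div_cancel₀ _ h1]
      · rw [mul_left_comm, mul_div_cancel₀ _ h1]

/-- Near a point where `B > 1` there is an eigenframe. -/
theorem exists_eigenframe (h : IsLocalSolution G Z f U) (hy : y ∈ U) (hB : 1 < B G Z f y) :
    ∃ (V : Set Plane) (p r : Fin 2 → Plane → ℝ) (l : Plane → ℝ), y ∈ V ∧ V ⊆ U ∧
      IsEigenframe G p r l V ∧ (∀ z ∈ V, l z + (l z)⁻¹ = 2 * B G Z f z) ∧
      ∀ z ∈ V, ∀ a b, 2 * xi G Z f z a b + B G Z f z * G z a b =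
        l z * (p a z * p b z) + (l z)⁻¹ * (r a z * r b z) := by
  obtain ⟨V, p, r, l, hyV, hVU, hcf, hls, hl1, hlB, hS⟩ := h.exists_diagonal_coframe hy hB
  have hcod := fun z (hz : z ∈ V) => hcf.codazzi (u := f) (l := l) (m := fun z => (l z)⁻¹)
    (fun w hw => h.tensor_symm w (hVU hw) 1 0) (fun w hw => h.smooth_tensor w (hVU hw))
    (fun w hw => h.trace_free w (hVU hw)) (fun w hw => h.div_free w (hVU hw))
    (fun w hw => h.curvature w (hVU hw)) (fun w hw => h.smooth_fun w (hVU hw))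
    (fun w hw => (hls w hw).differentiableAt (by simp))
    (fun w hw => ((hls w hw).inv (by linarith [hl1 w hw])).differentiableAt (by simp))
    (fun w hw a b => by
      rw [← hS w hw]
      simp only [xi, Matrix.of_apply]
      -- Moncrief's equation replaces `Δu + B` by `u`, which puts `2ξ + Bρ` into the Codazzi form.
      linear_combination -G w a b * h.equation w (hVU hw)) hz
  exact ⟨V, p, r, l, hyV, hVU, ⟨hcf, hls, hl1, fun z hz => h.curvature z (hVU hz),
    fun z hz => (hcod z hz).1, fun z hz => (hcod z hz).2⟩, hlB, hS⟩

/-- The quadratic form `g^{ab}` in an eigenframe. -/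
theorem sum_gInv (hcf : IsCoframe G p r V) {l : ℝ} {u : Plane → ℝ} (hyV : y ∈ V)
    (hlB : l + l⁻¹ = 2 * B G Z f y)
    (hS : ∀ a b, 2 * xi G Z f y a b + B G Z f y * G y a b =
        l * (p a y * p b y) + l⁻¹ * (r a y * r b y)) :
    ∑ a, ∑ b, gInv G Z f y a b * pd a u y * pd b u y =
      (l⁻¹ * derivFst p r u y ^ 2 + l * derivSnd p r u y ^ 2) / (1 + (l + l⁻¹) / 2) := by
  obtain ⟨i00, i01, i10, i11⟩ := hcf.inv_apply hyV
  have hD := hcf.area_ne_zero y hyV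
  have hm := hcf.metric y hyV
  have hBl : 1 + (l + l⁻¹) / 2 = 1 + B G Z f y := by rw [hlB]; ring
  rw [hBl]
  have e1 : (∑ a, (G y)⁻¹ a 0 * pd a u y) * p 0 y + (∑ a, (G y)⁻¹ a 1 * pd a u y) * p 1 y =
      derivFst p r u y := by
    rw [derivFst, eq_div_iff hD]
    apply mul_left_cancel₀ hD
    simp only [Fin.sum_univ_two, hm] at *
    linear_combination p 0 y * (pd 0 u y * i00 + pd 1 u y * i10) * (1 : ℝ)
      + p 1 y * (pd 0 u y * i01 + pd 1 u y * i11)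
  have e2 : (∑ a, (G y)⁻¹ a 0 * pd a u y) * r 0 y + (∑ a, (G y)⁻¹ a 1 * pd a u y) * r 1 y =
      derivSnd p r u y := by
    rw [derivSnd, eq_div_iff hD]
    apply mul_left_cancel₀ hD
    simp only [Fin.sum_univ_two, hm] at *
    linear_combination r 0 y * (pd 0 u y * i00 + pd 1 u y * i10)
      + r 1 y * (pd 0 u y * i01 + pd 1 u y * i11)
  have e3 : ∑ a, ∑ b, (G y)⁻¹ a b * pd a u y * pd b u y =
      derivFst p r u y ^ 2 + derivSnd p r u y ^ 2 := by
    have h0 := pd_eq_deriv (u := u) hD 0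
    have h1 := pd_eq_deriv (u := u) hD 1
    simp only [Fin.sum_univ_two] at e1 e2 ⊢
    linear_combination derivFst p r u y * e1 + derivSnd p r u y * e2
      + ((G y)⁻¹ 0 0 * pd 0 u y + (G y)⁻¹ 1 0 * pd 1 u y) * h0
      + ((G y)⁻¹ 0 1 * pd 0 u y + (G y)⁻¹ 1 1 * pd 1 u y) * h1
  have hξ : ∀ a b, xi G Z f y a b = 1 / 2 * ((l - B G Z f y) * (p a y * p b y)
      + (l⁻¹ - B G Z f y) * (r a y * r b y)) := fun a b => by
    linear_combination 1 / 2 * hS a b - 1 / 2 * B G Z f y * hm a b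
  have e4 : ∑ a, ∑ b, (∑ c, ∑ d, (G y)⁻¹ a c * (G y)⁻¹ b d * xi G Z f y c d) * pd a u y * pd b u y =
      1 / 2 * ((l - B G Z f y) * derivFst p r u y ^ 2
        + (l⁻¹ - B G Z f y) * derivSnd p r u y ^ 2) := by
    rw [← e1, ← e2]
    simp only [hξ, Fin.sum_univ_two]
    ring
  have e5 : ∑ a, ∑ b, gInv G Z f y a b * pd a u y * pd b u y =
      (-2 * ∑ a, ∑ b, (∑ c, ∑ d, (G y)⁻¹ a c * (G y)⁻¹ b d * xi G Z f y c d) * pd a u y * pd b u y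
      + B G Z f y * ∑ a, ∑ b, (G y)⁻¹ a b * pd a u y * pd b u y) / (1 + B G Z f y) := by
    simp only [gInv, Matrix.of_apply, Finset.mul_sum, ← Finset.sum_add_distrib, Finset.sum_div]
    refine Finset.sum_congr rfl fun a _ => Finset.sum_congr rfl fun b _ => ?_
    simp only [Fin.sum_univ_two]
    ring
  rw [e5, e4, e3]
  congr 1
  -- The eigenvalues of `-2ξ + Bρ` are `2B - l = l⁻¹` and `2B - l⁻¹ = l`: those of `S` interchanged.
  linear_combination -(derivFst p r u y ^ 2 + derivSnd p r u y ^ 2) * hlB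

theorem pd_log_B (h : IsEigenframe G p r l V) (hlB : ∀ z ∈ V, l z + (l z)⁻¹ = 2 * B G Z f z)
    (hy : y ∈ V) (a : Fin 2) : pd a (fun z => Real.log (B G Z f z)) y =
      (l y ^ 2 - 1) / (l y * (l y ^ 2 + 1)) * pd a l y := by
  have hl := h.one_lt y hy
  have hl0 : l y ≠ 0 := by linarith
  have hl3 : l y ^ 2 + 1 ≠ 0 := by positivity
  have hpos : (l y + (l y)⁻¹) / 2 ≠ 0 := by positivity
  have hd : HasDerivAt (fun x : ℝ => Real.log ((x + x⁻¹) / 2))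
      ((l y ^ 2 - 1) / (l y * (l y ^ 2 + 1))) (l y) := by
    have := (((hasDerivAt_id (l y)).add (hasDerivAt_inv hl0)).div_const 2).log hpos
    refine this.congr_deriv ?_
    simp only [id, Pi.add_apply]
    field_simp
    ring
  rw [← pd_comp hd ((h.smooth y hy).differentiableAt (by simp)) a]
  exact pd_congr (h.eventually hy fun z hz => by rw [hlB z hz]; congr 1; ring) a

/-- The gradient estimate at a local maximum. -/
theorem gradNorm_le_of_isLocalMax (h : IsLocalSolution G Z f U) (hy : y ∈ U)
    (hmax : IsLocalMax (gradNorm (gMetric G Z f) fun z => Real.log (B G Z f z)) y) :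
    gradNorm (gMetric G Z f) (fun z => Real.log (B G Z f z)) y ≤ 3 := by
  rcases (h.one_le_B hy).eq_or_lt with h1 | hB
  -- At points with `B = 1` the eigenvalues coincide and the eigenframe construction is unavailable,
  -- but `log B` attains its least value there.
  · have hmin : IsLocalMin (fun z => Real.log (B G Z f z)) y := by
      filter_upwards [h.eventually hy fun z hz => h.one_le_B hz] with z hz
      rw [← h1, Real.log_one]
      exact Real.log_nonneg hz
    have : ∀ a, pd a (fun z => Real.log (B G Z f z)) y = 0 := fun a => by
      simp [pd, hmin.fderiv_eq_zero]
    simp [gradNorm, this]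
  obtain ⟨V, p, r, l, hyV, hVU, hE, hlB, hS⟩ := h.exists_eigenframe hy hB
  set w := potential l
  set P := IsEigenframe.flatFst p l
  set R := IsEigenframe.flatSnd r l
  set F : Plane → ℝ := fun z => weight (w z) * (derivFst P R w z * derivFst P R w z
      + derivSnd P R w z * derivSnd P R w z) with hF
  have hF0 : ∀ z, 0 ≤ F z := fun z => by
    have : 0 ≤ weight (w z) := div_nonneg (Real.exp_pos _).le (sq_nonneg _)
    exact mul_nonneg this (add_nonneg (mul_self_nonneg _) (mul_self_nonneg _))
  have hgF : ∀ z ∈ V, gradNorm (gMetric G Z f) (fun z => Real.log (B G Z f z)) z =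
      Real.sqrt (F z) := by
    intro z hz
    rw [gradNorm, h.gMetric_inv (hVU hz), sum_gInv hE.toIsCoframe hz (hlB z hz) (hS z hz),
      hE.weighted_gradient_eq hz (pd_log_B hE hlB hz)]
  have hFmax : IsLocalMax F y := by
    filter_upwards [hmax, hE.eventually hyV fun z hz => hz] with z hz hzV
    rw [hgF z hzV, hgF y hyV] at hz
    exact (Real.sqrt_le_sqrt_iff (hF0 y)).mp hz
  have hle : F y ≤ 9 := hE.isFlatCoframe.weighted_gradient_le
    (fun z hz => smooth_potential (hE.one_lt z hz) (hE.smooth z hz))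
    (fun z hz => potential_neg (hE.one_lt z hz)) (fun z hz => hE.sinhGordon hz) hyV hFmax
  rw [hgF y hyV]
  calc Real.sqrt (F y) ≤ Real.sqrt (3 ^ 2) := Real.sqrt_le_sqrt (by linarith)
    _ = 3 := Real.sqrt_sq (by norm_num)

end IsLocalSolution

/-! ### From charts to the surface -/

section Surface

variable {M : Type*} [TopologicalSpace M] {e e' : OpenPartialHomeomorph M Plane} {y : Plane}

/-- The change of coordinates between two charts. -/
def transition (e e' : OpenPartialHomeomorph M Plane) (w : Plane) : Plane := e' (e.symm w)

theorem eventually_transition (hy : y ∈ e.target) (hy' : e.symm y ∈ e'.source) :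
    ∀ᶠ w in nhds y, w ∈ e.target ∧ e.symm w ∈ e'.source :=
  Filter.Eventually.and (e.open_target.mem_nhds hy)
    (e.symm.continuousAt hy (e'.open_source.mem_nhds hy'))

variable [ChartedSpace Plane M]

theorem contMDiffAt_chart_symm (he : e ∈ IsManifold.maximalAtlas (𝓡 2) ∞ M) (hy : y ∈ e.target) :
    ContMDiffAt 𝓘(ℝ, Plane) (𝓡 2) ∞ e.symm y :=
  (contMDiffOn_symm_of_mem_maximalAtlas he).contMDiffAt (e.open_target.mem_nhds hy)

theorem contMDiffAt_chart (he : e ∈ IsManifold.maximalAtlas (𝓡 2) ∞ M) {x : M}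
    (hx : x ∈ e.source) : ContMDiffAt (𝓡 2) 𝓘(ℝ, Plane) ∞ e x :=
  (contMDiffOn_of_mem_maximalAtlas he).contMDiffAt (e.open_source.mem_nhds hx)

theorem contDiffAt_funCoord (he : e ∈ IsManifold.maximalAtlas (𝓡 2) ∞ M) (hy : y ∈ e.target)
    {u : M → ℝ} (hu : ContMDiff (𝓡 2) 𝓘(ℝ, ℝ) ∞ u) : ContDiffAt ℝ ∞ (funCoord e u) y :=
  contMDiffAt_iff_contDiffAt.mp (hu.contMDiffAt.comp y (contMDiffAt_chart_symm he hy))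

theorem contDiffAt_transition (he : e ∈ IsManifold.maximalAtlas (𝓡 2) ∞ M)
    (he' : e' ∈ IsManifold.maximalAtlas (𝓡 2) ∞ M) (hy : y ∈ e.target)
    (hy' : e.symm y ∈ e'.source) : ContDiffAt ℝ ∞ (transition e e') y :=
  contMDiffAt_iff_contDiffAt.mp
    ((contMDiffAt_chart he' hy').comp y (contMDiffAt_chart_symm he hy))

theorem fderiv_single (φ : Plane → Plane) (hφ : DifferentiableAt ℝ φ y) (a : Fin 2) :
    fderiv ℝ φ y (EuclideanSpace.single a 1) =
      ∑ i, jacobian φ y i a • (EuclideanSpace.single i 1 : Plane) := by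
  ext j
  have : pd a (fun w => φ w j) y = fderiv ℝ φ y (EuclideanSpace.single a 1) j := by
    have h := ((EuclideanSpace.proj (𝕜 := ℝ) j : Plane →L[ℝ] ℝ).hasFDerivAt.comp y
      hφ.hasFDerivAt).fderiv
    have h' : ((EuclideanSpace.proj (𝕜 := ℝ) j : Plane →L[ℝ] ℝ) ∘ φ) = fun w => φ w j := rfl
    rw [h'] at h
    rw [pd, h]
    rfl
  rw [← this]
  fin_cases j <;> simp [jacobian_apply]

theorem map_sum_smul (L : Plane →L[ℝ] Plane) (c : Fin 2 → ℝ) (v : Fin 2 → Plane) :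
    L (∑ i, c i • v i) = ∑ i, c i • L (v i) := by
  simp only [map_sum, map_smul]

theorem map_sum_smul₂ (A : Plane →L[ℝ] Plane →L[ℝ] ℝ) (c d : Fin 2 → ℝ) (v : Fin 2 → Plane) :
    A (∑ i, c i • v i) (∑ j, d j • v j) = ∑ i, ∑ j, c i * A (v i) (v j) * d j := by
  simp only [Fin.sum_univ_two, map_add, map_smul, add_apply, smul_apply, smul_eq_mul]
  ring

/-- The coordinate vector fields are linearly independent. -/
theorem sum_coordVec_ne_zero (he : e ∈ IsManifold.maximalAtlas (𝓡 2) ∞ M) (hy : y ∈ e.target)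
    {c : Fin 2 → ℝ} (hc : c ≠ 0) : ∑ i, c i • (coordVec e i y : Plane) ≠ 0 := by
  intro h0
  have hd := (contMDiffAt_chart_symm he hy).mdifferentiableAt (by simp)
  have hd' := (contMDiffAt_chart he (e.map_target hy)).mdifferentiableAt (by simp)
  have h1 := mfderiv_comp (I' := 𝓡 2) y hd' hd
  have h2 : e ∘ e.symm =ᶠ[nhds y] id := by
    filter_upwards [e.open_target.mem_nhds hy] with w hw
    exact e.right_inv hw
  have h3 := h2.mfderiv_eq (I := 𝓘(ℝ, Plane)) (I' := 𝓘(ℝ, Plane))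
  have h4 : ∀ i, (mfderiv (𝓡 2) 𝓘(ℝ, Plane) e (e.symm y) : Plane →L[ℝ] Plane)
      (coordVec e i y : Plane) = EuclideanSpace.single i (1 : ℝ) := fun i => by
    have h6 := congrArg (fun L : Plane →L[ℝ] Plane => L (EuclideanSpace.single i 1))
      (h1.symm.trans (h3.trans mfderiv_id))
    exact h6
  have h5 := map_sum_smul (mfderiv (𝓡 2) 𝓘(ℝ, Plane) e (e.symm y)) c fun i => coordVec e i y
  have h6 : ∑ i, c i • (EuclideanSpace.single i (1 : ℝ) : Plane) = 0 := by
    have h7 : ∑ i, c i • (mfderiv (𝓡 2) 𝓘(ℝ, Plane) e (e.symm y) : Plane →L[ℝ] Plane)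
      (coordVec e i y : Plane) = 0 := by
      refine h5.symm.trans ?_
      exact (congrArg (mfderiv (𝓡 2) 𝓘(ℝ, Plane) e (e.symm y) : Plane →L[ℝ] Plane) h0).trans
        (map_zero _)
    refine Eq.trans ?_ h7
    exact Finset.sum_congr rfl fun i _ => congrArg _ (h4 i).symm
  refine hc (funext fun j => ?_)
  have h8 := congrArg (fun v : Plane => v j) h6
  fin_cases j <;> simpa using h8

/-- The transformation law of the coordinate vector fields. -/
theorem coordVec_transition (he : e ∈ IsManifold.maximalAtlas (𝓡 2) ∞ M)
    (he' : e' ∈ IsManifold.maximalAtlas (𝓡 2) ∞ M) (hy : y ∈ e.target)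
    (hy' : e.symm y ∈ e'.source) (a : Fin 2) :
    (coordVec e a y : Plane) =
      ∑ i, jacobian (transition e e') y i a • (coordVec e' i (transition e e' y) : Plane) := by
  have ht : transition e e' y ∈ e'.target := e'.map_source hy'
  have h1 : e.symm =ᶠ[nhds y] e'.symm ∘ transition e e' := by
    filter_upwards [eventually_transition hy hy'] with w hw
    exact (e'.left_inv hw.2).symm
  have hd := (contDiffAt_transition he he' hy hy').differentiableAt (by simp)
  have h2 : MDifferentiableAt 𝓘(ℝ, Plane) (𝓡 2) e'.symm (transition e e' y) :=
    (contMDiffAt_chart_symm he' ht).mdifferentiableAt (by simp)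
  have h3 := mfderiv_comp (I' := 𝓘(ℝ, Plane)) y h2 hd.mdifferentiableAt
  have h4 := h1.mfderiv_eq (I := 𝓘(ℝ, Plane)) (I' := 𝓡 2)
  have h5 : (coordVec e a y : Plane) =
      (mfderiv 𝓘(ℝ, Plane) (𝓡 2) e'.symm (transition e e' y) : Plane →L[ℝ] Plane)
        (fderiv ℝ (transition e e') y (EuclideanSpace.single a 1)) := by
    rw [← mfderiv_eq_fderiv]
    have h6 := congrArg (fun L : Plane →L[ℝ] Plane => L (EuclideanSpace.single a 1)) (h4.trans h3)
    exact h6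
  rw [h5, fderiv_single _ hd]
  exact map_sum_smul _ _ _

/-- The chain rule for the two opposite transition maps, whose composition is locally the identity.
-/
theorem det_jacobian_transition_ne_zero (he : e ∈ IsManifold.maximalAtlas (𝓡 2) ∞ M)
    (he' : e' ∈ IsManifold.maximalAtlas (𝓡 2) ∞ M) (hy : y ∈ e.target)
    (hy' : e.symm y ∈ e'.source) : (jacobian (transition e e') y).det ≠ 0 := by
  have ht : transition e e' y ∈ e'.target := e'.map_source hy'
  have hx : e'.symm (transition e e' y) = e.symm y := e'.left_inv hy'
  have ht' : e'.symm (transition e e' y) ∈ e.source := hx ▸ e.map_target hy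
  have hd := (contDiffAt_transition he he' hy hy').differentiableAt (by simp)
  have hd' := contDiffAt_transition he' he ht ht'
  have hJ : jacobian (transition e' e) (transition e e' y) * jacobian (transition e e') y = 1 := by
    ext j a
    have h1 := pd_comp_map (f := fun w => transition e' e w j)
      ((contDiffAt_coord hd' j).differentiableAt (by simp)) hd a
    have h2 : (fun w => transition e' e (transition e e' w) j) =ᶠ[nhds y] fun w => w j := by
      filter_upwards [eventually_transition hy hy'] with w hw
      rw [transition, transition, e'.left_inv hw.2, e.right_inv hw.1]
    rw [pd_congr h2] at h1
    have h3 : pd a (fun w => w j) y = (1 : Matrix (Fin 2) (Fin 2) ℝ) j a := by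
      have : (fun w : Plane => w j) = (EuclideanSpace.proj (𝕜 := ℝ) j : Plane →L[ℝ] ℝ) := rfl
      rw [pd, this, ContinuousLinearMap.fderiv]
      simp [Matrix.one_apply]
    rw [← h3, h1, Matrix.mul_apply]
    simp only [jacobian_apply]
    exact Finset.sum_congr rfl fun i _ => mul_comm _ _
  intro h
  have := congrArg Matrix.det hJ
  rw [Matrix.det_mul, h, mul_zero, Matrix.det_one] at this
  exact zero_ne_one this

/-- The transformation law of a tensor field. -/
theorem tensorCoord_transition (he : e ∈ IsManifold.maximalAtlas (𝓡 2) ∞ M)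
    (he' : e' ∈ IsManifold.maximalAtlas (𝓡 2) ∞ M) (hy : y ∈ e.target)
    (hy' : e.symm y ∈ e'.source)
    (T : ∀ x : M, TangentSpace (𝓡 2) x →L[ℝ] TangentSpace (𝓡 2) x →L[ℝ] ℝ) :
    tensorCoord e T y = (jacobian (transition e e') y).transpose *
      tensorCoord e' T (transition e e' y) * jacobian (transition e e') y := by
  have hx : e'.symm (transition e e' y) = e.symm y := e'.left_inv hy'
  -- All tangent spaces are definitionally the plane. Forgetting the dependence on the base point
  -- allows the two expressions for that point to be exchanged by rewriting.
  let T' : M → Plane →L[ℝ] Plane →L[ℝ] ℝ := T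
  ext a b
  have h1 : tensorCoord e T y a b = T' (e.symm y) (coordVec e a y : Plane)
    (coordVec e b y : Plane) := rfl
  have h2 : ∀ i j, tensorCoord e' T (transition e e' y) i j = T' (e.symm y)
      (coordVec e' i (transition e e' y) : Plane) (coordVec e' j (transition e e' y) : Plane) := by
    intro i j
    rw [← hx]
    rfl
  rw [h1, coordVec_transition he he' hy hy' a, coordVec_transition he he' hy hy' b]
  refine (map_sum_smul₂ (T' (e.symm y)) _ _ _).trans ?_
  simp only [Matrix.mul_apply, Matrix.transpose_apply, h2, Fin.sum_univ_two]
  ring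

variable [IsManifold (𝓡 2) ∞ M]

/-- The coordinate vector fields of a chart are smooth. -/
theorem contMDiffAt_coordVec (he : e ∈ IsManifold.maximalAtlas (𝓡 2) ∞ M) (hy : y ∈ e.target)
    (a : Fin 2) :
    ContMDiffAt 𝓘(ℝ, Plane) (𝓡 2).tangent ∞
      (fun w => (⟨e.symm w, coordVec e a w⟩ : TangentBundle (𝓡 2) M)) y := by
  -- The coordinate field is the tangent map of `e.symm` applied to a constant vector field on the
  -- plane.
  have h1 := (contMDiffOn_symm_of_mem_maximalAtlas he).contMDiffOn_tangentMapWithin (m := ∞)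
    (by simp) e.open_target.uniqueMDiffOn
  have h2 : ContMDiff 𝓘(ℝ, Plane) 𝓘(ℝ, Plane).tangent ∞
      (fun w : Plane => (⟨w, (EuclideanSpace.single a (1 : ℝ) : Plane)⟩ :
        TangentBundle 𝓘(ℝ, Plane) Plane)) := fun w =>
    contMDiffAt_vectorSpace_iff_contDiffAt.mpr contDiffAt_const
  have h3 := h1.comp h2.contMDiffOn (s := e.target) (fun w hw => hw)
  refine (h3.congr fun w hw => ?_).contMDiffAt (e.open_target.mem_nhds hy)
  simp only [Function.comp_apply, tangentMapWithin, coordVec]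
  rw [mfderivWithin_of_mem_nhds (e.open_target.mem_nhds hw)]

/-- The components of a smooth tensor field are smooth. -/
theorem contDiffAt_tensorCoord (he : e ∈ IsManifold.maximalAtlas (𝓡 2) ∞ M) (hy : y ∈ e.target)
    (T : Tensor02 M) (a b : Fin 2) :
    ContDiffAt ℝ ∞ (fun w => tensorCoord e T w a b) y := by
  rw [← contMDiffAt_iff_contDiffAt]
  have : ContMDiffAt 𝓘(ℝ, Plane) ((𝓡 2).prod 𝓘(ℝ)) ∞
      (fun w => Bundle.TotalSpace.mk' ℝ (E := Bundle.Trivial M ℝ) (e.symm w)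
        (T (e.symm w) (coordVec e a w) (coordVec e b w))) y := by
    apply ContMDiffAt.clm_bundle_apply₂ (F₁ := Plane) (F₂ := Plane)
    · exact ContMDiffAt.comp y T.contMDiff.contMDiffAt (contMDiffAt_chart_symm he hy)
    · exact contMDiffAt_coordVec he hy a
    · exact contMDiffAt_coordVec he hy b
  simp only [Bundle.contMDiffAt_totalSpace] at this
  exact this.2

/-- A metric as a tensor field. -/
def Metric.toTensor (ρ : Metric M) : Tensor02 M := ⟨ρ.inner, ρ.contMDiff⟩

theorem quadratic_form_pos (ρ : Metric M) (he : e ∈ IsManifold.maximalAtlas (𝓡 2) ∞ M)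
    (hy : y ∈ e.target) {c : Fin 2 → ℝ} (hc : c ≠ 0) :
    0 < ∑ i, ∑ j, c i * tensorCoord e ρ.inner y i j * c j := by
  have h := ρ.pos (e.symm y) _ (sum_coordVec_ne_zero he hy hc)
  exact h.trans_eq (map_sum_smul₂ (ρ.inner (e.symm y)) c c fun i => coordVec e i y)

variable {ρ : Metric M} {𝔷 : Tensor02 M} {u : M → ℝ}

theorem isLocalSolution (hρ : HasScalarCurvatureNegOne ρ) (h𝔷 : IsTT ρ 𝔷)
    (hu : IsSolution ρ 𝔷 u) (he : e ∈ IsManifold.maximalAtlas (𝓡 2) ∞ M) :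
    IsLocalSolution (tensorCoord e ρ.inner) (tensorCoord e 𝔷) (funCoord e u) e.target := by
  have hs : ∀ y, ∀ a b, tensorCoord e ρ.inner y a b = tensorCoord e ρ.inner y b a :=
    fun y a b => ρ.symm _ _ _
  have hp : ∀ y ∈ e.target, 0 < tensorCoord e ρ.inner y 0 0 := fun y hy => by
    have := quadratic_form_pos ρ he hy (c := ![1, 0]) fun h => by simpa using congrFun h 0
    simpa using this
  refine ⟨e.open_target, fun y hy => contDiffAt_tensorCoord he hy ρ.toTensor,
    fun y hy => contDiffAt_tensorCoord he hy 𝔷, fun y hy => contDiffAt_funCoord he hy hu.smooth,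
    fun y _ => hs y, hp, fun y hy => ?_, fun y _ a b => h𝔷.symm _ _ _, h𝔷.trace_free e he,
    h𝔷.div_free e he, hρ e he, hu.equation e he⟩
  have h0 := hp y hy
  -- On the vector `(-G 0 1, G 0 0)` the quadratic form takes the value `G 0 0 * det G`.
  have := quadratic_form_pos ρ he hy
    (c := ![-tensorCoord e ρ.inner y 0 1, tensorCoord e ρ.inner y 0 0])
    fun h => h0.ne' (by simpa using congrFun h 1)
  simp only [Fin.sum_univ_two, Matrix.cons_val_zero, Matrix.cons_val_one, hs y 1 0] at this
  refine pos_of_mul_pos_right (a := tensorCoord e ρ.inner y 0 0) ?_ h0.le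
  rw [Matrix.det_fin_two, hs y 1 0]
  linarith

theorem related_transition (hρ : HasScalarCurvatureNegOne ρ) (h𝔷 : IsTT ρ 𝔷)
    (hu : IsSolution ρ 𝔷 u) (he : e ∈ IsManifold.maximalAtlas (𝓡 2) ∞ M)
    (he' : e' ∈ IsManifold.maximalAtlas (𝓡 2) ∞ M) (hy : y ∈ e.target)
    (hy' : e.symm y ∈ e'.source) :
    Related (transition e e') (tensorCoord e ρ.inner) (tensorCoord e' ρ.inner)
      (tensorCoord e 𝔷) (tensorCoord e' 𝔷) (funCoord e u) (funCoord e' u) y := by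
  have ht : transition e e' y ∈ e'.target := e'.map_source hy'
  have h := isLocalSolution hρ h𝔷 hu he'
  exact ⟨contDiffAt_transition he he' hy hy', h.smooth_metric _ ht,
    det_jacobian_transition_ne_zero he he' hy hy', (h.det_pos _ ht).ne',
    tensorCoord_transition he he' hy hy' _, tensorCoord_transition he he' hy hy' _,
    congrArg u (e'.left_inv hy').symm⟩

/-- `|∇_g log B|` does not depend on the chart. -/
theorem gradLogB_transition (hρ : HasScalarCurvatureNegOne ρ) (h𝔷 : IsTT ρ 𝔷)
    (hu : IsSolution ρ 𝔷 u) (he : e ∈ IsManifold.maximalAtlas (𝓡 2) ∞ M)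
    (he' : e' ∈ IsManifold.maximalAtlas (𝓡 2) ∞ M) (hy : y ∈ e.target)
    (hy' : e.symm y ∈ e'.source) :
    gradLogB ρ 𝔷 u e y = gradLogB ρ 𝔷 u e' (transition e e' y) := by
  have h := isLocalSolution hρ h𝔷 hu he'
  have hrel : ∀ w, w ∈ e.target ∧ e.symm w ∈ e'.source → ∀ᶠ z in nhds w,
      Related (transition e e') (tensorCoord e ρ.inner) (tensorCoord e' ρ.inner)
        (tensorCoord e 𝔷) (tensorCoord e' 𝔷) (funCoord e u) (funCoord e' u) z := fun w hw => by
    filter_upwards [eventually_transition hw.1 hw.2] with z hz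
    exact related_transition hρ h𝔷 hu he he' hz.1 hz.2
  have hmem : ∀ w, w ∈ e.target ∧ e.symm w ∈ e'.source → ∀ᶠ z in nhds (transition e e' w),
      z ∈ e'.target := fun w hw => e'.open_target.mem_nhds (e'.map_source hw.2)
  have hs := fun w hw => (hmem w hw).mono fun z hz => h.metric_symm z hz
  have hf := fun w hw => (hmem w hw).mono fun z hz => h.smooth_fun z hz
  have ht : transition e e' y ∈ e'.target := e'.map_source hy'
  refine gradNorm_pullback (contDiffAt_transition he he' hy hy')
    ((h.smooth_B ht).log (by linarith [h.one_le_B ht])) ?_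
    (det_jacobian_transition_ne_zero he he' hy hy')
    (Related.gMetric_inv_eq (hrel y ⟨hy, hy'⟩) (hs y ⟨hy, hy'⟩) (hf y ⟨hy, hy'⟩))
  filter_upwards [eventually_transition hy hy'] with w hw
  rw [Related.B_eq (hrel w hw) (hs w hw) (hf w hw)]

/-- Only continuity is claimed, since the square root need not be smooth where the gradient
vanishes; this suffices for the existence of a maximum. -/
theorem IsLocalSolution.continuousAt_gradNorm {G Z : Plane → Matrix (Fin 2) (Fin 2) ℝ}
    {f : Plane → ℝ} {U : Set Plane} (h : IsLocalSolution G Z f U) (hy : y ∈ U) :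
    ContinuousAt (gradNorm (gMetric G Z f) fun z => Real.log (B G Z f z)) y := by
  have hl : ContDiffAt ℝ ∞ (fun z => Real.log (B G Z f z)) y :=
    (h.smooth_B hy).log (by linarith [h.one_le_B hy])
  have hc : ContinuousAt (fun w => Real.sqrt (∑ a, ∑ b, gInv G Z f w a b *
      pd a (fun z => Real.log (B G Z f z)) w * pd b (fun z => Real.log (B G Z f z)) w)) y := by
    refine Real.continuous_sqrt.continuousAt.comp (ContDiffAt.continuousAt (𝕜 := ℝ) (n := ∞) ?_)
    exact ContDiffAt.sum fun a _ => ContDiffAt.sum fun b _ =>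
      ((contDiffAt_gInv (h.smooth_metric y hy) (h.det_pos y hy).ne' (h.smooth_tensor y hy)
        (h.smooth_fun y hy) (h.normSq_nonneg hy) a b).mul (contDiffAt_pd hl a)).mul
        (contDiffAt_pd hl b)
  refine hc.congr ?_
  filter_upwards [h.isOpen.mem_nhds hy] with w hw
  rw [gradNorm, h.gMetric_inv hw]

/-- On a compact surface `|∇_g log B|` is at most `3`. -/
theorem gradLogB_le [CompactSpace M] (hρ : HasScalarCurvatureNegOne ρ) (h𝔷 : IsTT ρ 𝔷)
    (hu : IsSolution ρ 𝔷 u) (he : e ∈ IsManifold.maximalAtlas (𝓡 2) ∞ M) (hy : y ∈ e.target) :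
    gradLogB ρ 𝔷 u e y ≤ 3 := by
  -- Each point uses its own preferred chart. Independence of the chart identifies this function
  -- with the local expression in any chart, which gives continuity although the preferred chart may
  -- jump.
  set F : M → ℝ := fun x => gradLogB ρ 𝔷 u (chartAt Plane x) (chartAt Plane x x) with hF
  have hchart : ∀ x : M, chartAt Plane x ∈ IsManifold.maximalAtlas (𝓡 2) ∞ M :=
    fun x => IsManifold.chart_mem_maximalAtlas x
  have hFe : ∀ e' ∈ IsManifold.maximalAtlas (𝓡 2) ∞ M, ∀ w ∈ e'.target,
      gradLogB ρ 𝔷 u e' w = F (e'.symm w) := fun e' he' w hw =>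
    gradLogB_transition hρ h𝔷 hu he' (hchart _) hw (mem_chart_source Plane (e'.symm w))
  have hcont : Continuous F := by
    refine continuous_iff_continuousAt.mpr fun x => ?_
    have hx := mem_chart_source Plane x
    have h := (isLocalSolution hρ h𝔷 hu (hchart x)).continuousAt_gradNorm
      ((chartAt Plane x).map_source hx)
    refine (ContinuousAt.comp h ((chartAt Plane x).continuousAt hx)).congr ?_
    filter_upwards [(chartAt Plane x).open_source.mem_nhds hx] with z hz
    have := hFe _ (hchart x) _ ((chartAt Plane x).map_source hz)
    rwa [(chartAt Plane x).left_inv hz] at this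
  obtain ⟨x, -, hx⟩ := isCompact_univ.exists_isMaxOn ⟨e.symm y, Set.mem_univ _⟩ hcont.continuousOn
  have ht : chartAt Plane x x ∈ (chartAt Plane x).target :=
    (chartAt Plane x).map_source (mem_chart_source Plane x)
  -- The global maximum is read in one fixed chart, where the local estimate applies.
  have hmax : IsLocalMax (gradLogB ρ 𝔷 u (chartAt Plane x)) (chartAt Plane x x) := by
    filter_upwards [(chartAt Plane x).open_target.mem_nhds ht] with w hw
    rw [hFe _ (hchart x) w hw]
    exact hx (Set.mem_univ _)
  calc gradLogB ρ 𝔷 u e y = F (e.symm y) := hFe e he y hy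
    _ ≤ F x := hx (Set.mem_univ _)
    _ ≤ 3 := (isLocalSolution hρ h𝔷 hu (hchart x)).gradNorm_le_of_isLocalMax ht hmax

end Surface

end Moncrief

end

theorem lemma4p2 :
    ∃ C : ℝ, 0 < C ∧
      ∀ (M : Type*) [TopologicalSpace M] [T2Space M] [CompactSpace M]
        [ChartedSpace Moncrief.Plane M] [IsManifold (𝓡 2) ∞ M]
        (ρ : Moncrief.Metric M) (_ : Moncrief.HasScalarCurvatureNegOne ρ)
        (𝔷 : Moncrief.Tensor02 M) (_ : Moncrief.IsTT ρ 𝔷) (_ : Moncrief.IsNontrivial 𝔷)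
        (u : M → ℝ) (_ : Moncrief.IsSolution ρ 𝔷 u),
        ∀ e ∈ IsManifold.maximalAtlas (𝓡 2) ∞ M, ∀ y ∈ e.target,
          Moncrief.gradLogB ρ 𝔷 u e y ≤ C := by
  exact ⟨3, by norm_num, fun M _ _ _ _ _ ρ hρ 𝔷 h𝔷 _ u hu e he y hy =>
    Moncrief.gradLogB_le hρ h𝔷 hu he hy⟩
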